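/- Let $\mathcal C$ be an abelian category with enough projectives, let $A$ be an object of $\mathcal C$ with a projective resolution $(A_\bullet,a_\bullet)$, and choose a projective resolution $(B_\bullet,b_\bullet)$ of every object $B$. Write $\widetilde B_0=B$, $\widetilde B_{k+1}=\ker(B_k\to\widetilde B_k)$ for the syzygies and $B^{+k}_\bullet=B_{\bullet+k}$ for the induced resolution of $\widetilde B_k$. Let $A[n]_k=A_{k+n}$ with differential $(-1)^n a$, and $A_k=B_k=0$ for $k<0$. All functors below take values in abelian groups. **Ext.** $\mathrm{Ext}^n(A,B)=H^n(\mathrm{Hom}(A_\bullet,B))$, $n\in\mathbb Z$, with the connecting homomorphisms $\delta^n$ of the long exact cohomology sequence. **Chain maps.** $\mathcal Ext^n(A,B)$ is the group of chain maps $A[n]_\bullet\to B_\bullet$ modulo chain homotopy. **Hypercohomology construction.** An almost chain map of degree $n$ is a family $(\varphi_k\colon A_{k+n}\to B_k)_{k\in\mathbb Z}$ with $b_k\varphi_k=(-1)^n\varphi_{k-1}a_{k+n}$ for all but finitely many $k$; it is nullhomotopic if there are $e_k\colon A_{k+n}\to B_{k+1}$ with $\varphi_k=b_{k+1}e_k+(-1)^n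 e_{k-1}a_{k+n}$ for all but finitely many $k$. $\widehat{\mathcal Ext}{}^n(A,B)$ is the group of almost chain maps modulo nullhomotopic ones. In both constructions $f\colon B\to C$ acts by composition with a chain map $f_\bullet\colon B_\bullet\to C_\bullet$ lifting $f$. **Completions.** For a cohomological functor $(T^\bullet,\delta^\bullet)$ let $T^n_{Res}(M)=\varinjlim_k T^{n+k}(\widetilde M_k)$ along the connecting homomorphisms of $0\to\widetilde M_{k+1}\to M_k\to\widetilde M_k\to0$, with connecting homomorphism $\varinjlim_k(-1)^k\delta^{n+k}$ for the short exact sequences $0\to\widetilde B_k\to E_k\to\widetilde D_k\to0$ obtained from $0\to B\to C\to D\to0$ by iterating the Horseshoe Lemma. Let $S^{-1}F(M)=\ker(F(\widetilde M_1)\to F(M_0))$, $S^{-k-1}F=S^{-1}S^{-k}F$, and $\widehat T^n=\varinjlim_k S^{-k}T^{n+k}$ along $S^{-k}$ of the natural transformations $T^{n+k}\to S^{-1}T^{n+k+1}$ induced by $\delta^{n+k}$, with connecting homomorphism $\varinjlim_k\varepsilon^{-k}$, where $\varepsilon^{-k-1}\colon S^{-k-1}F(D)\hookrightarrow S^{-k}F(\widetilde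 D_1)\xrightarrow{h^*}S^{-k}F(B)$ and $h^*\colon\widetilde D_1\to B$ is induced by a lift $D_0\to C$ of $D_0\to D$. A Mislin completion of $(T^\bullet,\delta^\bullet)$ is a morphism $\nu^\bullet$ from $T^\bullet$ to a cohomological functor vanishing on projectives through which every morphism from $T^\bullet$ to a cohomological functor vanishing on projectives factors uniquely. **Theorem.** 1. $H^n$ of the Vogel complex $\mathrm{Hyp}(A_\bullet,B_\bullet)/\mathrm{Bdd}(A_\bullet,B_\bullet)$, where $\mathrm{Hyp}_n=\prod_k\mathrm{Hom}(A_{k+n},B_k)$ and $\mathrm{Bdd}_n=\bigoplus_k\mathrm{Hom}(A_{k+n},B_k)$, is $\widehat{\mathcal Ext}{}^n(A,B)$, the class of $\varphi$ corresponding to the class of $\varphi$. 2. $\mathcal Ext^\bullet(A,-)$ and $\widehat{\mathcal Ext}{}^\bullet(A,-)$ are cohomological functors whose connecting homomorphisms $\Delta^n$, $\widehat\Delta^n$ for $0\to B\to C\to D\to0$ are, for every choice of $h^*$ as above and of a chain map $h_\bullet\colon D^{+1}_\bullet\to B_\bullet$ lifting it, given by $[\varphi]\mapsto[\,((-1)^{m+n}h_m\varphi_{m+1})_{m}\,]$,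 with zero component for $m<0$. 3. For every $n\in\mathbb Z$ let $\zeta_n\colon\mathrm{Ext}^n(A,B)\to\mathcal Ext^n(A,B)$ send $[\varphi\colon A_n\to B]$ to the class of any chain map $\varphi[n]_\bullet\colon A[n]_\bullet\to B_\bullet$ whose component in degree $0$ followed by $B_0\to B$ is $\varphi$ (such chain maps exist). Then $\zeta_\bullet\colon(\mathrm{Ext}^\bullet(A,-),\delta^\bullet)\to(\mathcal Ext^\bullet(A,-),\Delta^\bullet)$ is a well-defined isomorphism of cohomological functors. 4. $\widehat{\mathrm{Ext}}{}^\bullet(A,-)$, $\mathrm{Ext}_{Res}^\bullet(A,-)$ and $\mathcal Ext_{Res}^\bullet(A,-)$, with the connecting homomorphisms above, are cohomological functors, and there are isomorphisms of cohomological functors $$\widehat{\mathrm{Ext}}{}^\bullet(A,-)\xrightarrow{\ \omega\ }\mathrm{Ext}_{Res}^\bullet(A,-)\xrightarrow{\ \zeta\ }\mathcal Ext_{Res}^\bullet(A,-)\xrightarrow{\ \vartheta\ }\widehat{\mathcal Ext}{}^\bullet(A,-),$$ where $\omega$ is the direct limit of the composites $S^{-k}\mathrm{Ext}^{n+k}(A,M)\to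 S^{-k+1}\mathrm{Ext}^{n+k}(A,\widetilde M_1)\to\dots\to\mathrm{Ext}^{n+k}(A,\widetilde M_k)$ of the maps $\varepsilon$, $\zeta=\varinjlim_k\zeta_{n+k}$, and $\vartheta$ is the direct limit of the maps $\mathcal Ext^{n+2k}(A,\widetilde B_{2k})\to\widehat{\mathcal Ext}{}^n(A,B)$ sending the class of $\varphi\colon A[n+2k]_\bullet\to B^{+2k}_\bullet$ to the class of $\Phi$ with $\Phi_m=\varphi_{m-2k}\colon A_{m+n}\to B_m$ for $m\ge 2k$ and $\Phi_m=0$ for $m<2k$. In particular $\sigma=\vartheta\circ\zeta$, and $\sigma\circ\omega$, are isomorphisms of cohomological functors. 5. $(\widehat{\mathcal Ext}{}^\bullet(A,-),\widehat\Delta^\bullet)$ is a Mislin completion of $(\mathrm{Ext}^\bullet(A,-),\delta^\bullet)$. Its structure morphism is $\mathrm{Ext}^n\to\mathrm{Ext}^n_{Res}\xrightarrow{\sigma}\widehat{\mathcal Ext}{}^n$, the first map being the canonical one to the direct limit; it equals $\zeta_n$ followed by the map regarding a chain map as an almost chain map. -/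

import Mathlib

open CategoryTheory Limits

universe v u v' u'

namespace Mislin

noncomputable section

section CohomologicalFunctors

variable {C : Type u} [Category.{v} C] [Abelian C] {D : Type u'} [Category.{v'} D] [Abelian D]

/-- The structure of a cohomological functor on a family of functors `T n : C ⥤ D`, `n : ℤ`:
additivity, natural connecting homomorphisms `δ` for short exact sequences, long exact sequences. -/
structure CohStructure (T : ℤ → C ⥤ D) where
  additive (n : ℤ) : (T n).Additive
  δ (S : ShortComplex C) (hS : S.ShortExact) (n₀ n₁ : ℤ) (h : n₀ + 1 = n₁) :
    (T n₀).obj S.X₃ ⟶ (T n₁).obj S.X₁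
  naturality {S S' : ShortComplex C} (hS : S.ShortExact) (hS' : S'.ShortExact) (φ : S ⟶ S')
    (n₀ n₁ : ℤ) (h : n₀ + 1 = n₁) :
    δ S hS n₀ n₁ h ≫ (T n₁).map φ.τ₁ = (T n₀).map φ.τ₃ ≫ δ S' hS' n₀ n₁ h
  exact₁ (S : ShortComplex C) (hS : S.ShortExact) (n₀ n₁ : ℤ) (h : n₀ + 1 = n₁) :
    ∃ w : δ S hS n₀ n₁ h ≫ (T n₁).map S.f = 0, (ShortComplex.mk _ _ w).Exact
  exact₂ (S : ShortComplex C) (hS : S.ShortExact) (n : ℤ) :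
    ∃ w : (T n).map S.f ≫ (T n).map S.g = 0, (ShortComplex.mk _ _ w).Exact
  exact₃ (S : ShortComplex C) (hS : S.ShortExact) (n₀ n₁ : ℤ) (h : n₀ + 1 = n₁) :
    ∃ w : (T n₀).map S.g ≫ δ S hS n₀ n₁ h = 0, (ShortComplex.mk _ _ w).Exact

/-- A family of natural transformations is a morphism of cohomological functors if it commutes
with the connecting homomorphisms. -/
def IsCohMorphism {T U : ℤ → C ⥤ D} (t : CohStructure T) (s : CohStructure U)
    (ν : ∀ n, T n ⟶ U n) : Prop :=
  ∀ (S : ShortComplex C) (hS : S.ShortExact) (n₀ n₁ : ℤ) (h : n₀ + 1 = n₁),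
    t.δ S hS n₀ n₁ h ≫ (ν n₁).app S.X₁ = (ν n₀).app S.X₃ ≫ s.δ S hS n₀ n₁ h

/-- An isomorphism of cohomological functors. -/
def IsCohIso {T U : ℤ → C ⥤ D} (t : CohStructure T) (s : CohStructure U)
    (ν : ∀ n, T n ⟶ U n) : Prop :=
  IsCohMorphism t s ν ∧ ∀ n, IsIso (ν n)

/-- `T n` vanishes on projective objects for every `n`. -/
def VanishesOnProjectives (T : ℤ → C ⥤ D) : Prop :=
  ∀ (n : ℤ) (Q : C), Projective Q → IsZero ((T n).obj Q)

/-- `ν : T ⟶ U` exhibits the cohomological functor `U` as the Mislin completion of `T`. -/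
def IsMislinCompletion {T U : ℤ → C ⥤ D} (t : CohStructure T) (s : CohStructure U)
    (ν : ∀ n, T n ⟶ U n) : Prop :=
  IsCohMorphism t s ν ∧ VanishesOnProjectives U ∧
    ∀ (V : ℤ → C ⥤ D) (r : CohStructure V), VanishesOnProjectives V →
      ∀ μ : ∀ n, T n ⟶ V n, IsCohMorphism t r μ →
        ∃! κ : ∀ n, U n ⟶ V n, IsCohMorphism s r κ ∧ ∀ n, ν n ≫ κ n = μ n

end CohomologicalFunctors

section Syzygies

variable {C : Type u} [Category.{v} C] [Abelian C]

/-- Auxiliary recursion: the `k`-th syzygy `Y` with the epimorphism from the `k`-th term. -/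
def syzAux {X : C} (R : ProjectiveResolution X) :
    ∀ k : ℕ, Σ' (Y : C) (p : R.complex.X k ⟶ Y), R.complex.d (k + 1) k ≫ p = 0
  | 0 => ⟨X, R.π.f 0, R.complex_d_comp_π_f_zero⟩
  | k + 1 => ⟨kernel (syzAux R k).2.1, kernel.lift _ (R.complex.d (k + 1) k) (syzAux R k).2.2, by
      rw [← cancel_mono (kernel.ι _)]; simp⟩

/-- The `k`-th syzygy of `R`: `X` itself for `k = 0`, and the kernel of
`R_k ⟶ syz R k` for `k + 1`. -/
def syz {X : C} (R : ProjectiveResolution X) (k : ℕ) : C := (syzAux R k).1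

/-- The epimorphism `R_k ⟶ syz R k`. -/
def syzπ {X : C} (R : ProjectiveResolution X) (k : ℕ) : R.complex.X k ⟶ syz R k :=
  (syzAux R k).2.1

/-- The monomorphism `syz R (k + 1) ⟶ R_k`. -/
def syzι {X : C} (R : ProjectiveResolution X) (k : ℕ) : syz R (k + 1) ⟶ R.complex.X k :=
  kernel.ι (syzπ R k)

instance {X : C} (R : ProjectiveResolution X) (k : ℕ) : Mono (syzι R k) := by
  unfold syzι; exact inferInstanceAs (Mono (kernel.ι _))

lemma d_syzπ {X : C} (R : ProjectiveResolution X) (k : ℕ) :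
    R.complex.d (k + 1) k ≫ syzπ R k = 0 := (syzAux R k).2.2

lemma syzι_π {X : C} (R : ProjectiveResolution X) (k : ℕ) : syzι R k ≫ syzπ R k = 0 :=
  kernel.condition _

lemma syzπ_ι {X : C} (R : ProjectiveResolution X) (k : ℕ) :
    syzπ R (k + 1) ≫ syzι R k = R.complex.d (k + 1) k :=
  kernel.lift_ι _ _ (syzAux R k).2.2

lemma d_exact_syzπ {X : C} (R : ProjectiveResolution X) (k : ℕ) :
    (ShortComplex.mk _ _ (d_syzπ R k)).Exact := by
  cases k with
  | zero => exact R.exact₀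
  | succ k =>
    let α : ShortComplex.mk _ _ (d_syzπ R (k + 1)) ⟶
        ShortComplex.mk _ _ (R.complex.d_comp_d (k + 2) (k + 1) k) :=
      { τ₁ := 𝟙 _
        τ₂ := 𝟙 _
        τ₃ := syzι R k
        comm₁₂ := by simp
        comm₂₃ := by simp [syzπ_ι] }
    have : Mono α.τ₃ := inferInstanceAs (Mono (syzι R k))
    have : Epi α.τ₁ := inferInstanceAs (Epi (𝟙 _))
    have : IsIso α.τ₂ := inferInstanceAs (IsIso (𝟙 _))
    exact (ShortComplex.exact_iff_of_epi_of_isIso_of_mono α).2 (R.exact_succ k)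

instance syzπ_epi {X : C} (R : ProjectiveResolution X) : ∀ k : ℕ, Epi (syzπ R k)
  | 0 => inferInstanceAs (Epi (R.π.f 0))
  | k + 1 => (d_exact_syzπ R k).epi_kernelLift

/-- The short exact sequence `0 ⟶ syz R (k + 1) ⟶ R_k ⟶ syz R k ⟶ 0`. -/
@[simps]
def syzSES {X : C} (R : ProjectiveResolution X) (k : ℕ) : ShortComplex C where
  X₁ := syz R (k + 1)
  X₂ := R.complex.X k
  X₃ := syz R k
  f := syzι R k
  g := syzπ R k
  zero := syzι_π R k

lemma syzSES_shortExact {X : C} (R : ProjectiveResolution X) (k : ℕ) :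
    (syzSES R k).ShortExact where
  exact := ShortComplex.exact_of_f_is_kernel _ (kernelIsKernel (syzπ R k))
  mono_f := inferInstanceAs (Mono (syzι R k))
  epi_g := inferInstanceAs (Epi (syzπ R k))

/-- The complex `R_{• + k}`, with `R_k` in degree `0` and unchanged differentials. -/
def shiftComplex (K : ChainComplex C ℕ) (k : ℕ) : ChainComplex C ℕ where
  X i := K.X (k + i)
  d i j := K.d (k + i) (k + j)
  shape i j h := K.shape _ _ (fun h' => h (by simp only [ComplexShape.down_Rel] at h' ⊢; omega))

lemma shiftComplex_exactAt {X : C} (R : ProjectiveResolution X) (k n : ℕ) :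
    (shiftComplex R.complex k).ExactAt (n + 1) := by
  rw [HomologicalComplex.exactAt_iff' _ (n + 2) (n + 1) n (by simp) (by simp)]
  exact R.exact_succ (k + n)

/-- `R_{• + k}` as a projective resolution of the `k`-th syzygy of `R`. -/
def shift {X : C} (R : ProjectiveResolution X) (k : ℕ) : ProjectiveResolution (syz R k) where
  complex := shiftComplex R.complex k
  projective n := R.projective (k + n)
  π := (ChainComplex.toSingle₀Equiv (shiftComplex R.complex k) (syz R k)).symm
    ⟨syzπ R k, d_syzπ R k⟩
  quasiIso := ⟨fun n => by
    cases n with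
    | zero =>
      rw [ChainComplex.quasiIsoAt₀_iff, ShortComplex.quasiIso_iff_of_zeros']
      · refine (ShortComplex.exact_and_epi_g_iff_of_iso ?_).2
          ⟨d_exact_syzπ R k, syzπ_epi R k⟩
        refine ShortComplex.isoMk (Iso.refl _) (Iso.refl _) (Iso.refl _) ?_ ?_
        · exact (Category.id_comp _).trans (Category.comp_id _).symm
        · refine (Category.id_comp _).trans (Eq.trans ?_ (Category.comp_id _).symm)
          exact (ChainComplex.toSingle₀Equiv_symm_apply_f_zero
            (C := shiftComplex R.complex k) (syzπ R k) (d_syzπ R k)).symm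
      · exact (shiftComplex R.complex k).shape 0 0 (by simp)
      all_goals rfl
    | succ n =>
      rw [quasiIsoAt_iff_exactAt']
      · exact shiftComplex_exactAt R k n
      · apply ChainComplex.exactAt_succ_single_obj⟩

/-- The morphism to the next syzygy induced by a morphism killed by `syzπ`. -/
def syzLift {X Y : C} (R : ProjectiveResolution X) (k : ℕ) (φ : Y ⟶ R.complex.X k)
    (h : φ ≫ syzπ R k = 0) : Y ⟶ syz R (k + 1) := kernel.lift (syzπ R k) φ h

lemma syzLift_ι {X Y : C} (R : ProjectiveResolution X) (k : ℕ) (φ : Y ⟶ R.complex.X k)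
    (h : φ ≫ syzπ R k = 0) : syzLift R k φ h ≫ syzι R k = φ := kernel.lift_ι _ _ _

/-- A morphism lifting `f` on syzygies, degree by degree. -/
def syzMap {X Y : C} (R : ProjectiveResolution X) (R' : ProjectiveResolution Y) (f : X ⟶ Y) :
    ∀ k : ℕ, syz R k ⟶ syz R' k
  | 0 => f
  | k + 1 => syzLift R' k
      (syzι R k ≫ Projective.factorThru (syzπ R k ≫ syzMap R R' f k) (syzπ R' k)) (by
        rw [Category.assoc, Projective.factorThru_comp, ← Category.assoc, syzι_π, zero_comp])

/-- `s` is a sequence of morphisms between syzygies in which `s (k + 1)` is a lift of `s k`. -/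
def IsSyzLift {X Y : C} (R : ProjectiveResolution X) (R' : ProjectiveResolution Y)
    (s : ∀ k : ℕ, syz R k ⟶ syz R' k) : Prop :=
  ∀ k, ∃ g : R.complex.X k ⟶ R'.complex.X k,
    g ≫ syzπ R' k = syzπ R k ≫ s k ∧ syzι R k ≫ g = s (k + 1) ≫ syzι R' k

lemma isSyzLift_syzMap {X Y : C} (R : ProjectiveResolution X) (R' : ProjectiveResolution Y)
    (f : X ⟶ Y) : IsSyzLift R R' (syzMap R R' f) := fun k =>
  ⟨Projective.factorThru (syzπ R k ≫ syzMap R R' f k) (syzπ R' k),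
    Projective.factorThru_comp _ _, (syzLift_ι _ _ _ _).symm⟩

lemma isSyzLift_id {X : C} (R : ProjectiveResolution X) :
    IsSyzLift R R (fun k => 𝟙 (syz R k)) := fun k => ⟨𝟙 _, by simp, by simp⟩

lemma IsSyzLift.comp {X Y Z : C} {R : ProjectiveResolution X} {R' : ProjectiveResolution Y}
    {R'' : ProjectiveResolution Z} {s : ∀ k : ℕ, syz R k ⟶ syz R' k}
    {s' : ∀ k : ℕ, syz R' k ⟶ syz R'' k} (h : IsSyzLift R R' s) (h' : IsSyzLift R' R'' s') :
    IsSyzLift R R'' (fun k => s k ≫ s' k) := fun k => by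
  obtain ⟨g, h₁, h₂⟩ := h k
  obtain ⟨g', h₁', h₂'⟩ := h' k
  refine ⟨g ≫ g', ?_, ?_⟩
  · rw [Category.assoc, h₁', ← Category.assoc, h₁, Category.assoc]
  · rw [← Category.assoc, h₂, Category.assoc, h₂', Category.assoc]

lemma IsSyzLift.add {X Y : C} {R : ProjectiveResolution X} {R' : ProjectiveResolution Y}
    {s s' : ∀ k : ℕ, syz R k ⟶ syz R' k}
    (h : IsSyzLift R R' s) (h' : IsSyzLift R R' s') :
    IsSyzLift R R' (fun k => s k + s' k) := fun k => by
  obtain ⟨g, h₁, h₂⟩ := h k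
  obtain ⟨g', h₁', h₂'⟩ := h' k
  exact ⟨g + g', by simp [h₁, h₁'], by simp [h₂, h₂']⟩

lemma IsSyzLift.exists_factor_succ {X Y : C} {R : ProjectiveResolution X}
    {R' : ProjectiveResolution Y} {s s' : ∀ k : ℕ, syz R k ⟶ syz R' k}
    (h : IsSyzLift R R' s) (h' : IsSyzLift R R' s') (k : ℕ)
    (u : syz R k ⟶ R'.complex.X k) (hu : s k - s' k = u ≫ syzπ R' k) :
    ∃ e : R.complex.X k ⟶ syz R' (k + 1), s (k + 1) - s' (k + 1) = syzι R k ≫ e := by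
  obtain ⟨g, h₁, h₂⟩ := h k
  obtain ⟨g', h₁', h₂'⟩ := h' k
  have hz : (g - g' - syzπ R k ≫ u) ≫ syzπ R' k = 0 := by
    rw [Preadditive.sub_comp, Preadditive.sub_comp, h₁, h₁', Category.assoc, ← hu,
      Preadditive.comp_sub, sub_self]
  refine ⟨syzLift R' k _ hz, ?_⟩
  rw [← cancel_mono (syzι R' k), Preadditive.sub_comp, ← h₂, ← h₂', Category.assoc, syzLift_ι,
    Preadditive.comp_sub, Preadditive.comp_sub, ← Category.assoc _ (syzπ R k) u, syzι_π,
    zero_comp, sub_zero]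

lemma IsSyzLift.exists_factor {X Y : C} {R : ProjectiveResolution X}
    {R' : ProjectiveResolution Y} {s s' : ∀ k : ℕ, syz R k ⟶ syz R' k}
    (h : IsSyzLift R R' s) (h' : IsSyzLift R R' s') (h0 : s 0 = s' 0) :
    ∀ k : ℕ, ∃ u : syz R k ⟶ R'.complex.X k, s k - s' k = u ≫ syzπ R' k
  | 0 => ⟨0, by simp [h0]⟩
  | k + 1 => by
    obtain ⟨u, hu⟩ := IsSyzLift.exists_factor h h' h0 k
    obtain ⟨e, he⟩ := h.exists_factor_succ h' k u hu
    exact ⟨syzι R k ≫ Projective.factorThru e (syzπ R' (k + 1)), by simp [he]⟩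

/-- The morphism of short exact sequences given by two consecutive terms of a lift. -/
lemma IsSyzLift.exists_hom {X Y : C} {R : ProjectiveResolution X}
    {R' : ProjectiveResolution Y} {s : ∀ k : ℕ, syz R k ⟶ syz R' k}
    (h : IsSyzLift R R' s) (k : ℕ) :
    ∃ φ : syzSES R k ⟶ syzSES R' k, φ.τ₁ = s (k + 1) ∧ φ.τ₃ = s k := by
  obtain ⟨g, h₁, h₂⟩ := h k
  exact ⟨{ τ₁ := s (k + 1), τ₂ := g, τ₃ := s k, comm₁₂ := h₂.symm, comm₂₃ := h₁ }, rfl, rfl⟩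

end Syzygies

section Resolution

variable {C : Type u} [Category.{v} C] [Abelian C] {D : Type u'} [Category.{v'} D] [Abelian D]
  {T : ℤ → C ⥤ D} (t : CohStructure T)

/-- The connecting homomorphism of `0 ⟶ syz_{k + 1} ⟶ R_k ⟶ syz_k ⟶ 0`. -/
def syzδ {X : C} (R : ProjectiveResolution X) (k : ℕ) (n₀ n₁ : ℤ) (h : n₀ + 1 = n₁) :
    (T n₀).obj (syz R k) ⟶ (T n₁).obj (syz R (k + 1)) :=
  t.δ (syzSES R k) (syzSES_shortExact R k) n₀ n₁ h

lemma map_syzπ_syzδ {X : C} (R : ProjectiveResolution X) (k : ℕ) (n₀ n₁ : ℤ) (h : n₀ + 1 = n₁) :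
    (T n₀).map (syzπ R k) ≫ syzδ t R k n₀ n₁ h = 0 :=
  (t.exact₃ (syzSES R k) (syzSES_shortExact R k) n₀ n₁ h).1

lemma IsSyzLift.syzδ_naturality {X Y : C} {R : ProjectiveResolution X}
    {R' : ProjectiveResolution Y} {s : ∀ k : ℕ, syz R k ⟶ syz R' k} (hs : IsSyzLift R R' s)
    (k : ℕ) (n₀ n₁ : ℤ) (h : n₀ + 1 = n₁) :
    syzδ t R k n₀ n₁ h ≫ (T n₁).map (s (k + 1)) = (T n₀).map (s k) ≫ syzδ t R' k n₀ n₁ h := by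
  obtain ⟨φ, h₁, h₂⟩ := hs.exists_hom k
  rw [← h₁, ← h₂]
  exact t.naturality _ _ φ _ _ _

variable [HasColimitsOfShape ℕ D] (P : ∀ X : C, ProjectiveResolution X)

/-- The direct system `T^{n + k}(syz_k M)`, `k : ℕ`, along the connecting homomorphisms of
`0 ⟶ syz_{k + 1} M ⟶ M_k ⟶ syz_k M ⟶ 0`. -/
def resSystem (n : ℤ) (M : C) : ℕ ⥤ D :=
  Functor.ofSequence (X := fun k : ℕ => (T (n + k)).obj (syz (P M) k)) fun k =>
    syzδ t (P M) k (n + k) (n + (k + 1 : ℕ)) (by push_cast; ring)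

/-- The terms of the resolution construction. -/
def resObj (n : ℤ) (M : C) : D := colimit (resSystem t P n M)

/-- The canonical morphism to the direct limit. -/
def resι (n : ℤ) (k : ℕ) (M : C) : (T (n + k)).obj (syz (P M) k) ⟶ resObj t P n M :=
  colimit.ι (resSystem t P n M) k

lemma syzδ_resι (n : ℤ) (k : ℕ) (M : C) :
    syzδ t (P M) k (n + k) (n + (k + 1 : ℕ)) (by push_cast; ring) ≫ resι t P n (k + 1) M =
      resι t P n k M := by
  have := colimit.w (resSystem t P n M) (homOfLE (Nat.le_add_right k 1))
  erw [Functor.ofSequence_map_homOfLE_succ] at this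
  exact this

lemma res_hom_ext {n : ℤ} {M : C} {Z : D} {f g : resObj t P n M ⟶ Z}
    (h : ∀ (k : ℕ), resι t P n k M ≫ f = resι t P n k M ≫ g) : f = g :=
  colimit.hom_ext h

lemma map_resι_eq (n : ℤ) {M N : C} {s s' : ∀ k : ℕ, syz (P M) k ⟶ syz (P N) k}
    (h : IsSyzLift (P M) (P N) s) (h' : IsSyzLift (P M) (P N) s') (h0 : s 0 = s' 0) (k : ℕ) :
    (T (n + k)).map (s k) ≫ resι t P n k N = (T (n + k)).map (s' k) ≫ resι t P n k N := by
  have := t.additive (n + k)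
  obtain ⟨u, hu⟩ := h.exists_factor h' h0 k
  rw [← sub_eq_zero, ← Preadditive.sub_comp, ← Functor.map_sub, hu, ← syzδ_resι,
    Functor.map_comp, Category.assoc, ← Category.assoc _ (syzδ _ _ _ _ _ _), map_syzπ_syzδ,
    zero_comp, comp_zero]

/-- The morphism induced on direct limits by a sequence of lifts on syzygies. -/
def resDesc (n : ℤ) {M N : C} (s : ∀ k : ℕ, syz (P M) k ⟶ syz (P N) k)
    (h : IsSyzLift (P M) (P N) s) : resObj t P n M ⟶ resObj t P n N :=
  colimMap (NatTrans.ofSequence (F := resSystem t P n M) (G := resSystem t P n N)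
    (fun k => (T (n + k)).map (s k)) (fun k => by
      erw [Functor.ofSequence_map_homOfLE_succ, Functor.ofSequence_map_homOfLE_succ]
      exact h.syzδ_naturality t _ _ _ _))

lemma resι_resDesc (n : ℤ) {M N : C} (s : ∀ k : ℕ, syz (P M) k ⟶ syz (P N) k)
    (h : IsSyzLift (P M) (P N) s) (k : ℕ) :
    resι t P n k M ≫ resDesc t P n s h = (T (n + k)).map (s k) ≫ resι t P n k N :=
  ι_colimMap _ _

/-- The resolution construction as a family of functors: `M ↦ colim_k T^{n + k}(syz_k M)`. -/
def resFunctor (n : ℤ) : C ⥤ D where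
  obj M := resObj t P n M
  map {M N} f := resDesc t P n (syzMap (P M) (P N) f) (isSyzLift_syzMap (P M) (P N) f)
  map_id M := res_hom_ext t P fun k => by
    rw [resι_resDesc, map_resι_eq t P n (isSyzLift_syzMap (P M) (P M) (𝟙 M))
      (isSyzLift_id (P M)) rfl]
    simp
  map_comp {M N K} f g := res_hom_ext t P fun k => by
    rw [resι_resDesc, map_resι_eq t P n (isSyzLift_syzMap (P M) (P K) (f ≫ g))
      ((isSyzLift_syzMap (P M) (P N) f).comp (isSyzLift_syzMap (P N) (P K) g)) rfl,
      ← Category.assoc, resι_resDesc, Category.assoc, resι_resDesc]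
    simp

/-- The canonical morphism `T^m(syz_k M) ⟶ T_Res^n(M)` for `m = n + k`. -/
def resLeg (n : ℤ) (k : ℕ) (m : ℤ) (h : n + k = m) (M : C) :
    (T m).obj (syz (P M) k) ⟶ (resFunctor t P n).obj M :=
  eqToHom (congrArg (fun j => (T j).obj (syz (P M) k)) h.symm) ≫ resι t P n k M

/-- A system of short exact sequences `0 ⟶ syz_k X₁ ⟶ E k ⟶ syz_k X₃ ⟶ 0`, starting with `S`,
obtained by iterating the Horseshoe Lemma with projective middle terms `Q k`. -/
structure Horseshoe (S : ShortComplex C) where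
  E : ℕ → C
  f (k : ℕ) : syz (P S.X₁) k ⟶ E k
  g (k : ℕ) : E k ⟶ syz (P S.X₃) k
  zero (k : ℕ) : f k ≫ g k = 0
  shortExact (k : ℕ) : (ShortComplex.mk (f k) (g k) (zero k)).ShortExact
  iso₀ : S.X₂ ≅ E 0
  f_iso₀ : S.f ≫ iso₀.hom = f 0
  iso₀_g : iso₀.hom ≫ g 0 = S.g
  Q : ℕ → C
  projective (k : ℕ) : Projective (Q k)
  i (k : ℕ) : (P S.X₁).complex.X k ⟶ Q k
  p (k : ℕ) : Q k ⟶ (P S.X₃).complex.X k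
  zero_mid (k : ℕ) : i k ≫ p k = 0
  shortExact_mid (k : ℕ) : (ShortComplex.mk (i k) (p k) (zero_mid k)).ShortExact
  κ (k : ℕ) : E (k + 1) ⟶ Q k
  ρ (k : ℕ) : Q k ⟶ E k
  zero_col (k : ℕ) : κ k ≫ ρ k = 0
  shortExact_col (k : ℕ) : (ShortComplex.mk (κ k) (ρ k) (zero_col k)).ShortExact
  f_κ (k : ℕ) : f (k + 1) ≫ κ k = syzι (P S.X₁) k ≫ i k
  g_ι (k : ℕ) : g (k + 1) ≫ syzι (P S.X₃) k = κ k ≫ p k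
  i_ρ (k : ℕ) : i k ≫ ρ k = syzπ (P S.X₁) k ≫ f k
  ρ_g (k : ℕ) : ρ k ≫ g k = p k ≫ syzπ (P S.X₃) k

/-- The connecting homomorphisms `r.δ` of the resolution construction are the direct limits of
`(-1)^k δ` for the short exact sequences of syzygies of a Horseshoe system. -/
def IsResConnecting (r : CohStructure (resFunctor t P)) : Prop :=
  ∀ (S : ShortComplex C) (hS : S.ShortExact), Nonempty (Horseshoe P S) ∧
    ∀ (H : Horseshoe P S) (n₀ n₁ : ℤ) (h : n₀ + 1 = n₁) (k : ℕ) (m₀ m₁ : ℤ) (h₀ : n₀ + k = m₀)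
      (h₁ : n₁ + k = m₁) (hm : m₀ + 1 = m₁),
      resLeg t P n₀ k m₀ h₀ S.X₃ ≫ r.δ S hS n₀ n₁ h =
        (-1 : ℤ) ^ k • (t.δ (ShortComplex.mk (H.f k) (H.g k) (H.zero k)) (H.shortExact k) m₀ m₁ hm ≫
          resLeg t P n₁ k m₁ h₁ S.X₁)

end Resolution

section Ext

open CochainComplex.HomComplex

variable {C : Type u} [Category.{v} C] [Abelian C] {A : C} (R : ProjectiveResolution A)

/-- The cochain complex `Hom(R_•, B)` of abelian groups: `Hom(R_n, B)` in degree `n`, with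
differential given by precomposition with the differential of `R`. -/
@[simps]
def extComplex (B : C) : CochainComplex AddCommGrpCat.{v} ℤ where
  X n := (preadditiveCoyoneda.obj (.op (R.cochainComplex.X (-n)))).obj B
  d n m := (preadditiveCoyoneda.map (R.cochainComplex.d (-m) (-n)).op).app B
  shape n m h := by
    rw [R.cochainComplex.shape (-m) (-n) (by
      intro h'; apply h; simp only [ComplexShape.up_Rel] at h' ⊢; omega)]
    rw [op_zero, Functor.map_zero]
    rfl
  d_comp_d' i j k _ _ := by
    rw [← NatTrans.comp_app, ← Functor.map_comp, ← op_comp, R.cochainComplex.d_comp_d, op_zero,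
      Functor.map_zero]
    rfl

/-- `Hom(R_•, B)` as a functor of `B`. -/
def extComplexFunctor : C ⥤ CochainComplex AddCommGrpCat.{v} ℤ where
  obj B := extComplex R B
  map f :=
    { f := fun n => (preadditiveCoyoneda.obj (.op (R.cochainComplex.X (-n)))).map f
      comm' := fun i j _ => (preadditiveCoyoneda.map (R.cochainComplex.d (-j) (-i)).op).naturality f }
  map_id B := by ext n : 1; exact (preadditiveCoyoneda.obj (.op (R.cochainComplex.X (-n)))).map_id B
  map_comp f g := by ext n : 1; exact (preadditiveCoyoneda.obj (.op (R.cochainComplex.X (-n)))).map_comp f g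

instance : (extComplexFunctor R).Additive where
  map_add {B B' f g} := by
    ext n : 1
    exact (preadditiveCoyoneda.obj (.op (R.cochainComplex.X (-n)))).map_add

/-- `Ext^n(A, -)`: the cohomology of `Hom(R_•, -)`, where `R` is a projective resolution of `A`. -/
def extFunctor (n : ℤ) : C ⥤ AddCommGrpCat.{v} :=
  extComplexFunctor R ⋙ HomologicalComplex.homologyFunctor _ _ n

/-- The class in `Ext^n(A, B)` of `φ : R_n ⟶ B` with `φ ∘ d = 0`. -/
def extMk {B : C} (n : ℤ) (φ : R.cochainComplex.X (-n) ⟶ B)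
    (hφ : R.cochainComplex.d (-(n + 1)) (-n) ≫ φ = 0) : (extFunctor R n).obj B :=
  (extComplex R B).homologyπ n (((extComplex R B).sc n).abCyclesIso.inv ⟨φ, by
    have h : (extComplex R B).d n (n + 1) φ = 0 := hφ
    have h' := CochainComplex.next ℤ n
    rw [← h'] at h
    exact h⟩)

lemma extComplex_shortExact (S : ShortComplex C) (hS : S.ShortExact) :
    (S.map (extComplexFunctor R)).ShortExact :=
  HomologicalComplex.shortExact_of_degreewise_shortExact _ fun n => by
    have := hS.mono_f
    have := hS.epi_g
    have hn : Projective (R.cochainComplex.X (-n)) := inferInstance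
    refine { exact := ?_, mono_f := ?_, epi_g := ?_ }
    · rw [ShortComplex.ab_exact_iff]
      intro φ hφ
      exact ⟨hS.exact.lift φ hφ, hS.exact.lift_f φ hφ⟩
    · rw [AddCommGrpCat.mono_iff_injective]
      intro φ ψ h
      exact (cancel_mono S.f).1 h
    · rw [AddCommGrpCat.epi_iff_surjective]
      intro φ
      exact ⟨Projective.factorThru φ S.g, Projective.factorThru_comp φ S.g⟩

/-- The structure of a cohomological functor on `Ext^•(A, -)` given by the long exact cohomology
sequence of `0 ⟶ Hom(R_•, S.X₁) ⟶ Hom(R_•, S.X₂) ⟶ Hom(R_•, S.X₃) ⟶ 0`. -/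
def extStructure : CohStructure (extFunctor R) where
  additive n := by unfold extFunctor; infer_instance
  δ S hS n₀ n₁ h := (extComplex_shortExact R S hS).δ n₀ n₁ h
  naturality {S S'} hS hS' φ n₀ n₁ h :=
    HomologicalComplex.HomologySequence.δ_naturality ((extComplexFunctor R).mapShortComplex.map φ)
      (extComplex_shortExact R S hS) (extComplex_shortExact R S' hS') n₀ n₁ h
  exact₁ S hS n₀ n₁ h :=
    ⟨_, (extComplex_shortExact R S hS).homology_exact₁ n₀ n₁ h⟩
  exact₂ S hS n := ⟨_, (extComplex_shortExact R S hS).homology_exact₂ n⟩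
  exact₃ S hS n₀ n₁ h :=
    ⟨_, (extComplex_shortExact R S hS).homology_exact₃ n₀ n₁ h⟩

end Ext

section ChainMaps

open CochainComplex CochainComplex.HomComplex

variable {C : Type u} [Category.{v} C] [Abelian C] {F G H : CochainComplex C ℤ}

/-- Postcomposition with a chain map, on chain maps modulo homotopy. -/
def chainPost (F : CochainComplex C ℤ) (θ : G ⟶ H) (n : ℤ) :
    CohomologyClass F G n →+ CohomologyClass F H n :=
  CohomologyClass.descAddMonoidHom
    (AddMonoidHom.mk' (fun z => CohomologyClass.mk (z.postcomp θ)) (fun z z' => by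
      rw [← CohomologyClass.mk_add]
      congr 1
      ext : 1
      exact Cochain.add_comp _ _ _ (add_zero n))) (by
    intro z hz
    rw [mem_coboundaries_iff z (n - 1) (by lia)] at hz
    obtain ⟨e, he⟩ := hz
    rw [AddMonoidHom.mem_ker]
    refine (CohomologyClass.mk_eq_zero_iff _).2 ?_
    rw [mem_coboundaries_iff _ (n - 1) (by lia)]
    refine ⟨e.comp (Cochain.ofHom θ) (add_zero _), ?_⟩
    rw [δ_comp_ofHom, he]
    rfl)

lemma chainPost_mk (θ : G ⟶ H) (n : ℤ) (z : Cocycle F G n) :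
    chainPost F θ n (CohomologyClass.mk z) = CohomologyClass.mk (z.postcomp θ) := rfl

lemma chainPost_eq {θ θ' : G ⟶ H} (h : Homotopy θ θ') (n : ℤ) :
    chainPost F θ n = chainPost F θ' n := by
  ext z
  obtain ⟨z, rfl⟩ := z.mk_surjective
  rw [chainPost_mk, chainPost_mk, ← sub_eq_zero, ← CohomologyClass.mk_sub,
    CohomologyClass.mk_eq_zero_iff, mem_coboundaries_iff _ (n - 1) (by lia)]
  refine ⟨z.1.comp (Cochain.ofHomotopy h) (by lia), ?_⟩
  rw [δ_comp z.1 (Cochain.ofHomotopy h) _ (n + 1) 0 n (by lia) rfl (by lia),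
    Cocycle.δ_eq_zero, Cochain.zero_comp, smul_zero, add_zero, δ_ofHomotopy, Cochain.comp_sub]
  rfl

lemma chainPost_id (n : ℤ) : chainPost F (𝟙 G) n = AddMonoidHom.id _ := by
  ext z
  obtain ⟨z, rfl⟩ := z.mk_surjective
  rw [chainPost_mk]
  exact congrArg _ (Subtype.ext (Cochain.comp_id _))

lemma chainPost_comp {K : CochainComplex C ℤ} (θ : G ⟶ H) (θ' : H ⟶ K) (n : ℤ) :
    chainPost F (θ ≫ θ') n = (chainPost F θ' n).comp (chainPost F θ n) := by
  ext z
  obtain ⟨z, rfl⟩ := z.mk_surjective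
  simp only [AddMonoidHom.comp_apply, chainPost_mk]
  refine congrArg _ (Subtype.ext ?_)
  simp

/-- The bounded cochains: families `(F^p ⟶ G^{p + n})_p` with finitely many nonzero members. -/
def Bdd (F G : CochainComplex C ℤ) (n : ℤ) : AddSubgroup (Cochain F G n) where
  carrier := {φ | {p : ℤ | φ.v p (p + n) rfl ≠ 0}.Finite}
  zero_mem' := by simp
  add_mem' {φ ψ} hφ hψ := (hφ.union hψ).subset fun p hp => by
    by_contra h
    simp only [Set.mem_union, Set.mem_ofPred_eq, not_or, not_not] at h
    exact hp (by simp [h.1, h.2])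
  neg_mem' {φ} hφ := by simpa using hφ

lemma Bdd.comp {n m k : ℤ} {φ : Cochain F G n} (hφ : φ ∈ Bdd F G n) (ψ : Cochain G H m)
    (h : n + m = k) : φ.comp ψ h ∈ Bdd F H k :=
  Set.Finite.subset hφ fun p hp h0 => hp (by
    rw [Cochain.comp_v φ ψ h p (p + n) (p + k) rfl (by lia), h0, zero_comp])

lemma Bdd.δ {n : ℤ} (m : ℤ) {φ : Cochain F G n} (hφ : φ ∈ Bdd F G n) :
    HomComplex.δ n m φ ∈ Bdd F G m := by
  by_cases h : n + 1 = m
  · subst h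
    have h' : ∀ p : ℤ, φ.v p (p + n) rfl = 0 → φ.v (p + 1) (p + 1 + n) rfl = 0 →
        (HomComplex.δ n (n + 1) φ).v p (p + (n + 1)) rfl = 0 := by
      intro p h₁ h₂
      rw [δ_v n (n + 1) rfl φ p (p + (n + 1)) rfl (p + n) (p + 1) (by lia) rfl, h₁, zero_comp,
        zero_add]
      have : φ.v (p + 1) (p + (n + 1)) (by lia) = 0 := by
        have e : p + 1 + n = p + (n + 1) := by lia
        have : ∀ (q : ℤ) (hq : p + 1 + n = q), φ.v (p + 1) q hq = 0 := by
          rintro q rfl; exact h₂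
        exact this _ e
      rw [this, comp_zero, smul_zero]
    refine (Set.Finite.union hφ (hφ.image (fun p => p - 1))).subset fun p hp => ?_
    by_contra hn
    simp only [Set.mem_union, Set.mem_image, Set.mem_ofPred_eq, not_or, not_not] at hn
    refine hp (h' p hn.1 ?_)
    by_contra h₂
    exact hn.2 ⟨p + 1, h₂, by lia⟩
  · rw [δ_shape n m h]
    exact AddSubgroup.zero_mem _

/-- The almost chain maps of degree `n`: the families `(F^p ⟶ G^{p + n})_p` for which all but
finitely many of the squares with the differentials commute up to `(-1)^n`. -/
def almostCocycles (F G : CochainComplex C ℤ) (n : ℤ) : AddSubgroup (Cochain F G n) :=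
  (Bdd F G (n + 1)).comap (δ_hom ℤ F G n (n + 1)).toAddMonoidHom

lemma mem_almostCocycles (n : ℤ) (φ : Cochain F G n) :
    φ ∈ almostCocycles F G n ↔ δ n (n + 1) φ ∈ Bdd F G (n + 1) := Iff.rfl

/-- The families which are nullhomotopic in all but finitely many degrees. -/
def almostNull (F G : CochainComplex C ℤ) (n : ℤ) : AddSubgroup (Cochain F G n) :=
  Bdd F G n ⊔ (δ_hom ℤ F G (n - 1) n).toAddMonoidHom.range

lemma mem_almostNull (n : ℤ) (φ : Cochain F G n) :
    φ ∈ almostNull F G n ↔ ∃ e : Cochain F G (n - 1), φ - δ (n - 1) n e ∈ Bdd F G n := by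
  constructor
  · intro h
    obtain ⟨b, hb, _, ⟨e, rfl⟩, rfl⟩ := AddSubgroup.mem_sup.1 h
    refine ⟨e, ?_⟩
    convert hb using 1
    exact add_sub_cancel_right _ _
  · rintro ⟨e, he⟩
    exact AddSubgroup.mem_sup.2 ⟨_, he, _, ⟨e, rfl⟩, sub_add_cancel _ _⟩

/-- Almost chain maps of degree `n` modulo nullhomotopic almost chain maps. -/
abbrev AlmostClass (F G : CochainComplex C ℤ) (n : ℤ) : Type v :=
  almostCocycles F G n ⧸ (almostNull F G n).addSubgroupOf (almostCocycles F G n)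

/-- The class of an almost chain map. -/
def almostMk {n : ℤ} (φ : Cochain F G n) (h : φ ∈ almostCocycles F G n) : AlmostClass F G n :=
  QuotientAddGroup.mk ⟨φ, h⟩

lemma almostMk_eq_iff {n : ℤ} {φ ψ : Cochain F G n} (h : φ ∈ almostCocycles F G n)
    (h' : ψ ∈ almostCocycles F G n) :
    almostMk φ h = almostMk ψ h' ↔ φ - ψ ∈ almostNull F G n := by
  rw [eq_comm]
  refine (QuotientAddGroup.eq (s := (almostNull F G n).addSubgroupOf (almostCocycles F G n))).trans
    ?_
  rw [AddSubgroup.mem_addSubgroupOf, neg_add_eq_sub]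
  rfl

lemma almostCocycles_comp_ofHom {n : ℤ} {φ : Cochain F G n} (h : φ ∈ almostCocycles F G n)
    (θ : G ⟶ H) : φ.comp (Cochain.ofHom θ) (add_zero n) ∈ almostCocycles F H n := by
  rw [mem_almostCocycles, δ_comp_ofHom]
  exact Bdd.comp h _ _

/-- Postcomposition with a chain map, on almost chain maps modulo homotopy. -/
def almostPost (F : CochainComplex C ℤ) (θ : G ⟶ H) (n : ℤ) :
    AlmostClass F G n →+ AlmostClass F H n :=
  QuotientAddGroup.lift _
    (AddMonoidHom.mk' (fun φ : almostCocycles F G n =>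
      almostMk (φ.1.comp (Cochain.ofHom θ) (add_zero n)) (almostCocycles_comp_ofHom φ.2 θ))
      (fun φ ψ => congrArg _ (Subtype.ext (Cochain.add_comp _ _ _ (add_zero n))))) (by
    rintro ⟨φ, h⟩ hφ
    rw [AddSubgroup.mem_addSubgroupOf, mem_almostNull] at hφ
    obtain ⟨e, he⟩ := hφ
    rw [AddMonoidHom.mem_ker]
    refine (QuotientAddGroup.eq_zero_iff _).2 ?_
    rw [AddSubgroup.mem_addSubgroupOf, mem_almostNull]
    refine ⟨e.comp (Cochain.ofHom θ) (add_zero _), ?_⟩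
    rw [δ_comp_ofHom, ← Cochain.sub_comp]
    exact Bdd.comp he _ _)

lemma almostPost_mk (θ : G ⟶ H) {n : ℤ} (φ : Cochain F G n) (h : φ ∈ almostCocycles F G n) :
    almostPost F θ n (almostMk φ h) =
      almostMk (φ.comp (Cochain.ofHom θ) (add_zero n)) (almostCocycles_comp_ofHom h θ) := rfl

lemma almostClass_hom_ext {n : ℤ} {M : Type*} [AddCommGroup M] {f g : AlmostClass F G n →+ M}
    (hfg : ∀ φ h, f (almostMk φ h) = g (almostMk φ h)) : f = g := by
  ext x
  exact hfg x.1 x.2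

lemma almostPost_eq {θ θ' : G ⟶ H} (h : Homotopy θ θ') (n : ℤ) :
    almostPost F θ n = almostPost F θ' n := by
  refine almostClass_hom_ext fun φ hφ => ?_
  rw [almostPost_mk, almostPost_mk, almostMk_eq_iff, mem_almostNull]
  refine ⟨φ.comp (Cochain.ofHomotopy h) (by lia), ?_⟩
  rw [δ_comp φ (Cochain.ofHomotopy h) _ (n + 1) 0 n (by lia) rfl (by lia), δ_ofHomotopy,
    Cochain.comp_sub, sub_add_cancel_left]
  refine AddSubgroup.neg_mem _ ?_
  rw [Int.negOnePow_neg, Int.negOnePow_one, Units.neg_smul, one_smul]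
  exact AddSubgroup.neg_mem _ (Bdd.comp hφ _ _)

lemma almostPost_id (n : ℤ) : almostPost F (𝟙 G) n = AddMonoidHom.id _ :=
  almostClass_hom_ext fun φ hφ => by
    rw [almostPost_mk]
    exact congrArg _ (Subtype.ext (Cochain.comp_id _))

lemma almostPost_comp {K : CochainComplex C ℤ} (θ : G ⟶ H) (θ' : H ⟶ K) (n : ℤ) :
    almostPost F (θ ≫ θ') n = (almostPost F θ' n).comp (almostPost F θ n) :=
  almostClass_hom_ext fun φ hφ => by
    simp only [AddMonoidHom.comp_apply, almostPost_mk]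
    refine congrArg _ (Subtype.ext ?_)
    simp

lemma cocycle_le_almostCocycles {n : ℤ} (z : Cocycle F G n) : z.1 ∈ almostCocycles F G n := by
  rw [mem_almostCocycles, Cocycle.δ_eq_zero]
  exact AddSubgroup.zero_mem _

/-- The quotient map from chain maps modulo homotopy to almost chain maps modulo homotopy. -/
def chainToAlmost (F G : CochainComplex C ℤ) (n : ℤ) :
    CohomologyClass F G n →+ AlmostClass F G n :=
  CohomologyClass.descAddMonoidHom
    (AddMonoidHom.mk' (fun z => almostMk z.1 (cocycle_le_almostCocycles z)) (fun _ _ => rfl)) (by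
    intro z hz
    rw [mem_coboundaries_iff z (n - 1) (by lia)] at hz
    obtain ⟨e, he⟩ := hz
    rw [AddMonoidHom.mem_ker]
    refine (QuotientAddGroup.eq_zero_iff _).2 ?_
    rw [AddSubgroup.mem_addSubgroupOf, mem_almostNull]
    refine ⟨e, ?_⟩
    rw [he, sub_self]
    exact AddSubgroup.zero_mem _)

/-- The quotient complex `Hyp(F, G) / Bdd(F, G)`. -/
def vogelComplex (F G : CochainComplex C ℤ) : CochainComplex AddCommGrpCat.{v} ℤ where
  X n := AddCommGrpCat.of (Cochain F G n ⧸ Bdd F G n)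
  d n m := AddCommGrpCat.ofHom
    (QuotientAddGroup.map (Bdd F G n) (Bdd F G m) (δ_hom ℤ F G n m).toAddMonoidHom
      (fun _ h => Bdd.δ m h))
  shape n m h := by
    ext x
    exact congrArg (QuotientAddGroup.mk (s := Bdd F G m)) (δ_shape n m h x)
  d_comp_d' i j k _ _ := by
    ext x
    exact congrArg (QuotientAddGroup.mk (s := Bdd F G k)) (δ_δ i j k x)

end ChainMaps

section ChainFunctors

open CochainComplex CochainComplex.HomComplex

variable {C : Type u} [Category.{v} C] [Abelian C]

/-- A chain map of projective resolutions lifting `f`. -/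
def liftHom {X Y : C} (R : ProjectiveResolution X) (R' : ProjectiveResolution Y) (f : X ⟶ Y) :
    ProjectiveResolution.Hom R R' f where
  hom := ProjectiveResolution.lift f R R'
  hom_f_zero_comp_π_f_zero :=
    HomologicalComplex.congr_hom (ProjectiveResolution.lift_commutes f R R') 0

/-- Two lifts of the same morphism are homotopic. -/
def homHomotopy {X Y : C} {R : ProjectiveResolution X} {R' : ProjectiveResolution Y} {f : X ⟶ Y}
    (h h' : ProjectiveResolution.Hom R R' f) : Homotopy h.hom' h'.hom' :=
  (ProjectiveResolution.liftHomotopy f h.hom h'.hom h.hom_comp_π h'.hom_comp_π).extend _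

/-- The identity as a lift. -/
def idHom {X : C} (R : ProjectiveResolution X) : ProjectiveResolution.Hom R R (𝟙 X) where
  hom := 𝟙 _
  hom_f_zero_comp_π_f_zero := by
    have : 𝟙 R.complex ≫ R.π = R.π ≫ (ChainComplex.single₀ C).map (𝟙 X) := by simp
    exact HomologicalComplex.congr_hom this 0

/-- The composition of lifts. -/
def compHom {X Y Z : C} {R : ProjectiveResolution X} {R' : ProjectiveResolution Y}
    {R'' : ProjectiveResolution Z} {f : X ⟶ Y} {g : Y ⟶ Z} (h : ProjectiveResolution.Hom R R' f)
    (h' : ProjectiveResolution.Hom R' R'' g) : ProjectiveResolution.Hom R R'' (f ≫ g) where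
  hom := h.hom ≫ h'.hom
  hom_f_zero_comp_π_f_zero := by
    have : (h.hom ≫ h'.hom) ≫ R''.π = R.π ≫ (ChainComplex.single₀ C).map (f ≫ g) := by
      rw [Category.assoc, h'.hom_comp_π, ← Category.assoc, h.hom_comp_π, Category.assoc,
        Functor.map_comp]
    exact HomologicalComplex.congr_hom this 0

lemma idHom_hom' {X : C} (R : ProjectiveResolution X) : (idHom R).hom' = 𝟙 _ :=
  HomologicalComplex.extendMap_id _ _

lemma compHom_hom' {X Y Z : C} {R : ProjectiveResolution X} {R' : ProjectiveResolution Y}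
    {R'' : ProjectiveResolution Z} {f : X ⟶ Y} {g : Y ⟶ Z} (h : ProjectiveResolution.Hom R R' f)
    (h' : ProjectiveResolution.Hom R' R'' g) : (compHom h h').hom' = h.hom' ≫ h'.hom' :=
  HomologicalComplex.extendMap_comp _ _ _

variable {A : C} (R : ProjectiveResolution A) (P : ∀ X : C, ProjectiveResolution X)

/-- `B ↦` the group of chain maps `R[n]_• ⟶ (P B)_•` modulo homotopy. A morphism acts by
postcomposition with any chain map lifting it. -/
def chainExt (n : ℤ) : C ⥤ AddCommGrpCat.{v} where
  obj B := AddCommGrpCat.of (CohomologyClass R.cochainComplex (P B).cochainComplex n)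
  map {B B'} f := AddCommGrpCat.ofHom
    (chainPost R.cochainComplex (liftHom (P B) (P B') f).hom' n)
  map_id B := by
    rw [chainPost_eq (homHomotopy _ (idHom (P B))), idHom_hom', chainPost_id]
    rfl
  map_comp {B B' B''} f g := by
    rw [chainPost_eq (homHomotopy _ (compHom (liftHom (P B) (P B') f) (liftHom (P B') (P B'') g))),
      compHom_hom', chainPost_comp]
    rfl

/-- `B ↦` the group of almost chain maps `R[n]_• ⟶ (P B)_•` modulo nullhomotopic ones. A morphism
acts by postcomposition with any chain map lifting it. -/
def vogel (n : ℤ) : C ⥤ AddCommGrpCat.{v} where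
  obj B := AddCommGrpCat.of (AlmostClass R.cochainComplex (P B).cochainComplex n)
  map {B B'} f := AddCommGrpCat.ofHom
    (almostPost R.cochainComplex (liftHom (P B) (P B') f).hom' n)
  map_id B := by
    rw [almostPost_eq (homHomotopy _ (idHom (P B))), idHom_hom', almostPost_id]
    rfl
  map_comp {B B' B''} f g := by
    rw [almostPost_eq (homHomotopy _ (compHom (liftHom (P B) (P B') f)
      (liftHom (P B') (P B'') g))), compHom_hom', almostPost_comp]
    rfl

end ChainFunctors

section Satellites

variable {C : Type u} [Category.{v} C] [Abelian C] {D : Type u'} [Category.{v'} D] [Abelian D]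
  (P : ∀ X : C, ProjectiveResolution X)

/-- For a short exact sequence `S` and a resolution `R` of `S.X₃`, the morphism
`h : syz R 1 ⟶ S.X₁` is induced by a lift of the identity of `S.X₃` to a morphism from
`0 ⟶ syz R 1 ⟶ R_0 ⟶ S.X₃ ⟶ 0` to `S`. -/
def IsLiftOfId (S : ShortComplex C) (R : ProjectiveResolution S.X₃) (h : syz R 1 ⟶ S.X₁) : Prop :=
  ∃ c : R.complex.X 0 ⟶ S.X₂, c ≫ S.g = syzπ R 0 ∧ syzι R 0 ≫ c = h ≫ S.f

lemma kernel_map_eq (F : C ⥤ D) [F.Additive] {M N : C} {R : ProjectiveResolution M}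
    {R' : ProjectiveResolution N} {s s' : ∀ k : ℕ, syz R k ⟶ syz R' k}
    (h : IsSyzLift R R' s) (h' : IsSyzLift R R' s') (h0 : s 0 = s' 0) :
    kernel.ι (F.map (syzι R 0)) ≫ F.map (s 1) = kernel.ι (F.map (syzι R 0)) ≫ F.map (s' 1) := by
  obtain ⟨e, he⟩ := h.exists_factor_succ h' 0 0 (by rw [h0, sub_self, zero_comp])
  rw [← sub_eq_zero, ← Preadditive.comp_sub, ← Functor.map_sub, he, Functor.map_comp,
    kernel.condition_assoc, zero_comp]

/-- The morphism on first left satellites induced by a lift on syzygies. -/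
def satDesc (F : C ⥤ D) {M N : C} (R : ProjectiveResolution M)
    (R' : ProjectiveResolution N) (s : ∀ k : ℕ, syz R k ⟶ syz R' k) (h : IsSyzLift R R' s) :
    kernel (F.map (syzι R 0)) ⟶ kernel (F.map (syzι R' 0)) :=
  kernel.lift _ (kernel.ι (F.map (syzι R 0)) ≫ F.map (s 1)) (by
    obtain ⟨g, -, hg⟩ := h 0
    rw [Category.assoc, ← Functor.map_comp, ← hg, Functor.map_comp, kernel.condition_assoc,
      zero_comp])

lemma satDesc_ι (F : C ⥤ D) {M N : C} (R : ProjectiveResolution M)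
    (R' : ProjectiveResolution N) (s : ∀ k : ℕ, syz R k ⟶ syz R' k) (h : IsSyzLift R R' s) :
    satDesc F R R' s h ≫ kernel.ι (F.map (syzι R' 0)) =
      kernel.ι (F.map (syzι R 0)) ≫ F.map (s 1) :=
  kernel.lift_ι _ _ _

/-- The first left satellite `S⁻¹F` of an additive functor: `M ↦ Ker (F(syz_1 M) ⟶ F(M_0))`. -/
def satOne (F : C ⥤ D) [F.Additive] : C ⥤ D where
  obj M := kernel (F.map (syzι (P M) 0))
  map {M N} f := satDesc F (P M) (P N) (syzMap (P M) (P N) f) (isSyzLift_syzMap (P M) (P N) f)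
  map_id M := by
    rw [← cancel_mono (kernel.ι (F.map (syzι (P M) 0))), satDesc_ι,
      kernel_map_eq F (isSyzLift_syzMap (P M) (P M) (𝟙 M)) (isSyzLift_id (P M)) rfl]
    simp
  map_comp {M N K} f g := by
    rw [← cancel_mono (kernel.ι (F.map (syzι (P K) 0))), satDesc_ι,
      kernel_map_eq F (isSyzLift_syzMap (P M) (P K) (f ≫ g))
        ((isSyzLift_syzMap (P M) (P N) f).comp (isSyzLift_syzMap (P N) (P K) g)) rfl,
      Category.assoc, satDesc_ι, ← Category.assoc, satDesc_ι, Category.assoc, Functor.map_comp]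

/-- The inclusion `(S⁻¹F)(M) ⟶ F(syz_1 M)`. -/
def satι (F : C ⥤ D) [F.Additive] (M : C) : (satOne P F).obj M ⟶ F.obj (syz (P M) 1) :=
  kernel.ι (F.map (syzι (P M) 0))

instance (F : C ⥤ D) [F.Additive] (M : C) : Mono (satι P F M) :=
  inferInstanceAs (Mono (kernel.ι (F.map (syzι (P M) 0))))

lemma satι_comp (F : C ⥤ D) [F.Additive] (M : C) : satι P F M ≫ F.map (syzι (P M) 0) = 0 :=
  kernel.condition _

lemma map_satι (F : C ⥤ D) [F.Additive] {M N : C} (f : M ⟶ N) :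
    (satOne P F).map f ≫ satι P F N = satι P F M ≫ F.map (syzMap (P M) (P N) f 1) :=
  satDesc_ι F (P M) (P N) _ (isSyzLift_syzMap (P M) (P N) f)

/-- The morphism to `(S⁻¹F)(M)` given by the universal property of the kernel. -/
def satLift (F : C ⥤ D) [F.Additive] {M : C} {Z : D} (φ : Z ⟶ F.obj (syz (P M) 1))
    (h : φ ≫ F.map (syzι (P M) 0) = 0) : Z ⟶ (satOne P F).obj M :=
  kernel.lift _ φ h

lemma satLift_ι (F : C ⥤ D) [F.Additive] {M : C} {Z : D} (φ : Z ⟶ F.obj (syz (P M) 1))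
    (h : φ ≫ F.map (syzι (P M) 0) = 0) : satLift P F φ h ≫ satι P F M = φ :=
  kernel.lift_ι _ _ _

lemma satOne_additive (F : C ⥤ D) [F.Additive] : (satOne P F).Additive where
  map_add {M N f g} := by
    rw [← cancel_mono (satι P F N), Preadditive.add_comp, map_satι, map_satι, map_satι,
      ← Preadditive.comp_add, ← Functor.map_add]
    exact kernel_map_eq F (isSyzLift_syzMap (P M) (P N) (f + g))
      ((isSyzLift_syzMap (P M) (P N) f).add (isSyzLift_syzMap (P M) (P N) g)) rfl

/-- The natural transformation `S⁻¹F ⟶ S⁻¹G` induced by `F ⟶ G`. -/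
def satOneMap {F G : C ⥤ D} [F.Additive] [G.Additive] (φ : F ⟶ G) : satOne P F ⟶ satOne P G where
  app M := satLift P G (satι P F M ≫ φ.app (syz (P M) 1)) (by
    rw [Category.assoc, ← φ.naturality, ← Category.assoc, satι_comp, zero_comp])
  naturality {M N} f := by
    refine (cancel_mono (satι P G N)).1 ((Category.assoc _ _ _).trans ?_)
    rw [satLift_ι]
    refine Eq.trans ?_ (Category.assoc _ _ _).symm
    rw [map_satι, ← Category.assoc, map_satι, ← Category.assoc, satLift_ι, Category.assoc,
      Category.assoc, φ.naturality]

/-- The iterated left satellites `S^{-k}F`, with `S^{-(k + 1)}F = S⁻¹(S^{-k}F)`. -/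
def satAux (F : C ⥤ D) (hF : F.Additive) : ℕ → {G : C ⥤ D // G.Additive}
  | 0 => ⟨F, hF⟩
  | k + 1 => ⟨@satOne C _ _ D _ _ P (satAux F hF k).1 (satAux F hF k).2,
      @satOne_additive C _ _ D _ _ P (satAux F hF k).1 (satAux F hF k).2⟩

/-- The iterated left satellite `S^{-k}F`. -/
def sat (F : C ⥤ D) (hF : F.Additive) (k : ℕ) : C ⥤ D := (satAux P F hF k).1

instance (F : C ⥤ D) (hF : F.Additive) (k : ℕ) : (sat P F hF k).Additive :=
  (satAux P F hF k).2

/-- The morphism `S^{-k}φ : S^{-k}F ⟶ S^{-k}(S⁻¹G) = S^{-(k + 1)}G` for `φ : F ⟶ S⁻¹G`. -/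
def satTrans {F G : C ⥤ D} (hF : F.Additive) (hG : G.Additive) (φ : F ⟶ satOne P G) :
    ∀ k : ℕ, sat P F hF k ⟶ sat P G hG (k + 1)
  | 0 => φ
  | k + 1 => satOneMap P (F := sat P F hF k) (G := sat P G hG (k + 1)) (satTrans hF hG φ k)

/-- The morphism `(S⁻¹F)(S.X₃) ⟶ F(syz_1 S.X₃) ⟶ F(S.X₁)` given by the inclusion of the kernel
and `h : syz_1 S.X₃ ⟶ S.X₁`. -/
def satε (F : C ⥤ D) [F.Additive] (S : ShortComplex C) (h : syz (P S.X₃) 1 ⟶ S.X₁) :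
    (satOne P F).obj S.X₃ ⟶ F.obj S.X₁ :=
  satι P F S.X₃ ≫ F.map h

/-- The composite `S^{-l}F(syz_k M) ⟶ S^{-l + 1}F(syz_{k + 1} M) ⟶ … ⟶ F(syz_{k + l} M)` of the
connecting homomorphisms of the short exact sequences of syzygies of `M`. -/
def satChain (F : C ⥤ D) (hF : F.Additive) (M : C)
    (h : ∀ k, syz (P (syz (P M) k)) 1 ⟶ syz (P M) (k + 1)) :
    ∀ (l k K : ℕ), k + l = K → ((sat P F hF l).obj (syz (P M) k) ⟶ F.obj (syz (P M) K))
  | 0, _, _, e => eqToHom (congrArg (fun j => F.obj (syz (P M) j)) e)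
  | l + 1, k, K, e => satε P (sat P F hF l) (syzSES (P M) k) (h k) ≫
      satChain F hF M h l (k + 1) K (by omega)

variable {T : ℤ → C ⥤ D} (t : CohStructure T)

/-- The connecting homomorphism of `0 ⟶ syz_1 X ⟶ R_0 ⟶ X ⟶ 0`. -/
def syzδ₀ {X : C} (R : ProjectiveResolution X) (n₀ n₁ : ℤ) (h : n₀ + 1 = n₁) :
    (T n₀).obj X ⟶ (T n₁).obj (syz R 1) :=
  syzδ t R 0 n₀ n₁ h

lemma syzδ₀_comp {X : C} (R : ProjectiveResolution X) (n₀ n₁ : ℤ) (h : n₀ + 1 = n₁) :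
    syzδ₀ t R n₀ n₁ h ≫ (T n₁).map (syzι R 0) = 0 :=
  (t.exact₁ (syzSES R 0) (syzSES_shortExact R 0) n₀ n₁ h).1

lemma syzδ₀_naturality {X Y : C} (R : ProjectiveResolution X) (R' : ProjectiveResolution Y)
    (f : X ⟶ Y) (n₀ n₁ : ℤ) (h : n₀ + 1 = n₁) :
    syzδ₀ t R n₀ n₁ h ≫ (T n₁).map (syzMap R R' f 1) = (T n₀).map f ≫ syzδ₀ t R' n₀ n₁ h :=
  (isSyzLift_syzMap R R' f).syzδ_naturality t 0 n₀ n₁ h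

/-- The natural transformation `T^n ⟶ S⁻¹T^{n + 1}` given by the connecting homomorphism of
`0 ⟶ syz_1 M ⟶ M_0 ⟶ M ⟶ 0`. -/
def satδ (n₀ n₁ : ℤ) (h : n₀ + 1 = n₁) :
    letI := t.additive n₁
    T n₀ ⟶ satOne P (T n₁) :=
  letI := t.additive n₁
  { app := fun M => satLift P (T n₁) (syzδ₀ t (P M) n₀ n₁ h)
      (syzδ₀_comp t (P M) n₀ n₁ h)
    naturality := fun M N f => by
      refine (cancel_mono (satι P (T n₁) N)).1 ((Category.assoc _ _ _).trans ?_)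
      rw [satLift_ι]
      refine Eq.trans ?_ (Category.assoc _ _ _).symm
      rw [map_satι, ← Category.assoc, satLift_ι]
      exact (syzδ₀_naturality t (P M) (P N) f n₀ n₁ h).symm }

variable [HasColimitsOfShape ℕ D]

/-- The direct system `S^{-k}T^{n + k}`, `k : ℕ`. -/
def satSystem (n : ℤ) : ℕ ⥤ (C ⥤ D) :=
  Functor.ofSequence (X := fun k : ℕ => sat P (T (n + k)) (t.additive _) k) fun k =>
    satTrans P (t.additive _) (t.additive _)
      (satδ P t (n + k) (n + (k + 1 : ℕ)) (by push_cast; ring)) k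

/-- The satellite functor construction `colim_k S^{-k}T^{n + k}`. -/
def satFunctor (n : ℤ) : C ⥤ D := colimit (satSystem P t n)

/-- The canonical morphism `S^{-k}T^m ⟶ colim_k S^{-k}T^{n + k}` for `m = n + k`. -/
def satLeg (n : ℤ) (k : ℕ) (m : ℤ) (h : n + k = m) :
    sat P (T m) (t.additive m) k ⟶ satFunctor P t n :=
  eqToHom (congrArg (fun j => sat P (T j) (t.additive j) k) h.symm) ≫ colimit.ι (satSystem P t n) k

/-- The connecting homomorphisms `r.δ` of the satellite functor construction are the direct limits
of the connecting homomorphisms `S^{-(k + 1)}T^m(S.X₃) ⟶ S^{-k}T^m(S.X₁)`. -/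
def IsSatConnecting (r : CohStructure (satFunctor P t)) : Prop :=
  ∀ (S : ShortComplex C) (hS : S.ShortExact), (∃ h, IsLiftOfId S (P S.X₃) h) ∧
    ∀ h, IsLiftOfId S (P S.X₃) h →
      ∀ (n₀ n₁ : ℤ) (hn : n₀ + 1 = n₁) (k : ℕ) (m : ℤ) (h₀ : n₀ + (k + 1 : ℕ) = m)
        (h₁ : n₁ + k = m),
        (satLeg P t n₀ (k + 1) m h₀).app S.X₃ ≫ r.δ S hS n₀ n₁ hn =
          satε P (sat P (T m) (t.additive m) k) S h ≫ (satLeg P t n₁ k m h₁).app S.X₁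

/-- `ω` is the comparison from the satellite functor construction to the resolution construction
which is the direct limit of the morphisms `S^{-k}T^m(M) ⟶ T^m(syz_k M)`. -/
def IsSatComparison (ω : ∀ n, satFunctor P t n ⟶ resFunctor t P n) : Prop :=
  ∀ M : C, (∀ k, ∃ h, IsLiftOfId (syzSES (P M) k) (P (syz (P M) k)) h) ∧
    ∀ h : ∀ k, syz (P (syz (P M) k)) 1 ⟶ syz (P M) (k + 1),
      (∀ k, IsLiftOfId (syzSES (P M) k) (P (syz (P M) k)) (h k)) →
        ∀ (n : ℤ) (k : ℕ) (m : ℤ) (hm : n + k = m),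
          (satLeg P t n k m hm).app M ≫ (ω n).app M =
            satChain P (T m) (t.additive m) M h k 0 k (Nat.zero_add k) ≫ resLeg t P n k m hm M

end Satellites

section Formulae

open CochainComplex CochainComplex.HomComplex

variable {C : Type u} [Category.{v} C] [Abelian C]

/-- The augmentation `R_0 ⟶ X`. -/
def aug {X : C} (R : ProjectiveResolution X) : R.cochainComplex.X 0 ⟶ X :=
  (R.cochainComplexXIso 0 0).hom ≫ syzπ R 0

/-- The identity of `R_{k + m}`, seen as an isomorphism to the `m`-th term of `R_{• + k}`. -/
def shiftXIso {X : C} (R : ProjectiveResolution X) (k m : ℕ) :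
    R.complex.X (k + m) ≅ (shift R k).complex.X m :=
  Iso.refl _

/-- The family `π^n : R_• ⟶ R_{• + 1}` of degree `1`, with component `(-1)^{m + n} id` from
`R_{m + 1}` to the `m`-th term of `R_{• + 1}` for `m ≥ 0`, and zero components otherwise. -/
def shiftProj {X : C} (R : ProjectiveResolution X) (n : ℤ) :
    Cochain R.cochainComplex (shift R 1).cochainComplex 1 :=
  Cochain.mk fun p q hpq =>
    if h : q ≤ 0 then
      (n - q).negOnePow • ((R.cochainComplexXIso p (1 + (-q).toNat) (by omega)).hom ≫
        (shiftXIso R 1 (-q).toNat).hom ≫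
          ((shift R 1).cochainComplexXIso q (-q).toNat (by omega)).inv)
    else 0

/-- The family `R_{• + k} ⟶ R_•` of degree `-k` with the identity as component from the `m`-th term
of `R_{• + k}` to `R_{k + m}` for `m ≥ 0`. -/
def unshift {X : C} (R : ProjectiveResolution X) (k : ℕ) :
    Cochain (shift R k).cochainComplex R.cochainComplex (-k) :=
  Cochain.mk fun p q hpq =>
    if h : p ≤ 0 then
      ((shift R k).cochainComplexXIso p (-p).toNat (by omega)).hom ≫
        (shiftXIso R k (-p).toNat).inv ≫ (R.cochainComplexXIso q (k + (-p).toNat) (by omega)).inv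
    else 0

variable {A : C} (R : ProjectiveResolution A) (P : ∀ X : C, ProjectiveResolution X)

/-- The family `h_• ∘ π^n ∘ φ` of degree `n + 1` for a family `φ` of degree `n`. -/
def connCochain {S : ShortComplex C} {h₁ : syz (P S.X₃) 1 ⟶ S.X₁}
    (h : ProjectiveResolution.Hom (shift (P S.X₃) 1) (P S.X₁) h₁) (n₀ n₁ : ℤ) (hn : n₀ + 1 = n₁)
    (φ : Cochain R.cochainComplex (P S.X₃).cochainComplex n₀) :
    Cochain R.cochainComplex (P S.X₁).cochainComplex n₁ :=
  (φ.comp (shiftProj (P S.X₃) n₀) hn).comp (Cochain.ofHom h.hom') (add_zero n₁)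

/-- The chain map `z : R[n]_• ⟶ (P B)_•` lifts the cocycle `φ : R_n ⟶ B`. -/
def LiftsCocycle {B : C} (n : ℤ) (φ : R.cochainComplex.X (-n) ⟶ B)
    (z : Cocycle R.cochainComplex (P B).cochainComplex n) : Prop :=
  z.1.v (-n) 0 (neg_add_cancel n) ≫ aug (P B) = φ

/-- `ζ^n : Ext^n(A, B) ⟶ 𝓔xt^n(A, B)` sends the class of a cocycle `φ : R_n ⟶ B` to the class of
any chain map lifting `φ`. -/
def IsZeta (ζ : ∀ n, extFunctor R n ⟶ chainExt R P n) : Prop :=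
  ∀ (n : ℤ) (B : C) (φ : R.cochainComplex.X (-n) ⟶ B)
    (hφ : R.cochainComplex.d (-(n + 1)) (-n) ≫ φ = 0),
    (∃ z, LiftsCocycle R P n φ z) ∧
      ∀ z, LiftsCocycle R P n φ z → (ζ n).app B (extMk R n φ hφ) = CohomologyClass.mk z

/-- The explicit formula for the connecting homomorphisms of `𝓔xt^•(A, -)`:
`[φ] ↦ [h_• ∘ π^n ∘ φ]` for any `h_•` lifting a lift `h₁` of the identity of `S.X₃`. -/
def IsChainConnecting (Δ : CohStructure (chainExt R P)) : Prop :=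
  ∀ (S : ShortComplex C) (hS : S.ShortExact), (∃ h₁, IsLiftOfId S (P S.X₃) h₁) ∧
    ∀ h₁, IsLiftOfId S (P S.X₃) h₁ →
      Nonempty (ProjectiveResolution.Hom (shift (P S.X₃) 1) (P S.X₁) h₁) ∧
      ∀ (h : ProjectiveResolution.Hom (shift (P S.X₃) 1) (P S.X₁) h₁)
        (n₀ n₁ : ℤ) (hn : n₀ + 1 = n₁)
        (φ : Cocycle R.cochainComplex (P S.X₃).cochainComplex n₀),
        ∃ hφ : connCochain R P h n₀ n₁ hn φ.1 ∈
            cocycle R.cochainComplex (P S.X₁).cochainComplex n₁,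
          Δ.δ S hS n₀ n₁ hn (CohomologyClass.mk φ) =
            CohomologyClass.mk ⟨connCochain R P h n₀ n₁ hn φ.1, hφ⟩

/-- The explicit formula for the connecting homomorphisms of the hypercohomology construction:
`[φ] ↦ [h_• ∘ π^n ∘ φ]` for any `h_•` lifting a lift `h₁` of the identity of `S.X₃`. -/
def IsVogelConnecting (Δ : CohStructure (vogel R P)) : Prop :=
  ∀ (S : ShortComplex C) (hS : S.ShortExact), (∃ h₁, IsLiftOfId S (P S.X₃) h₁) ∧
    ∀ h₁, IsLiftOfId S (P S.X₃) h₁ →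
      Nonempty (ProjectiveResolution.Hom (shift (P S.X₃) 1) (P S.X₁) h₁) ∧
      ∀ (h : ProjectiveResolution.Hom (shift (P S.X₃) 1) (P S.X₁) h₁)
        (n₀ n₁ : ℤ) (hn : n₀ + 1 = n₁)
        (φ : Cochain R.cochainComplex (P S.X₃).cochainComplex n₀)
        (hφ : φ ∈ almostCocycles R.cochainComplex (P S.X₃).cochainComplex n₀),
        ∃ hφ' : connCochain R P h n₀ n₁ hn φ ∈
            almostCocycles R.cochainComplex (P S.X₁).cochainComplex n₁,
          Δ.δ S hS n₀ n₁ hn (almostMk φ hφ) = almostMk (connCochain R P h n₀ n₁ hn φ) hφ'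

/-- `ϑ^n` is given on the even terms `𝓔xt^{n + 2k}(A, syz_{2k} B)` of the direct system by
`[φ] ↦ [Φ]`, where `Φ_m = φ_m` for `m ≥ 2k` and `Φ_m = 0` for `m < 2k`. Here a chain map `φ` to the
resolution `P (syz_{2k} B)` is first composed with a comparison map to the resolution
`(P B)_{• + 2k}` of `syz_{2k} B`. -/
def IsTheta (Δ : CohStructure (chainExt R P)) (ϑ : ∀ n, resFunctor Δ P n ⟶ vogel R P n) : Prop :=
  ∀ (n : ℤ) (k : ℕ) (m : ℤ) (hm : n + (2 * k : ℕ) = m) (B : C),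
    Nonempty (ProjectiveResolution.Hom (P (syz (P B) (2 * k))) (shift (P B) (2 * k)) (𝟙 _)) ∧
    ∀ (c : ProjectiveResolution.Hom (P (syz (P B) (2 * k))) (shift (P B) (2 * k)) (𝟙 _))
      (φ : Cocycle R.cochainComplex (P (syz (P B) (2 * k))).cochainComplex m),
      ∃ hΦ : (φ.postcomp c.hom').1.comp (unshift (P B) (2 * k)) (by omega) ∈
          almostCocycles R.cochainComplex (P B).cochainComplex n,
        (ϑ n).app B (resLeg Δ P n (2 * k) m hm B (CohomologyClass.mk φ)) =
          almostMk ((φ.postcomp c.hom').1.comp (unshift (P B) (2 * k)) (by omega)) hΦ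

/-- `ζR` is the direct limit of the maps `ζ^{n + k}` at the syzygies. -/
def IsResZeta (Δ : CohStructure (chainExt R P)) (ζ : ∀ n, extFunctor R n ⟶ chainExt R P n)
    (ζR : ∀ n, resFunctor (extStructure R) P n ⟶ resFunctor Δ P n) : Prop :=
  ∀ (n : ℤ) (k : ℕ) (m : ℤ) (hm : n + k = m) (B : C),
    resLeg (extStructure R) P n k m hm B ≫ (ζR n).app B =
      (ζ m).app (syz (P B) k) ≫ resLeg Δ P n k m hm B

/-- The cohomology of the Vogel complex is the group of almost chain maps modulo nullhomotopic
ones, through the map sending the class of a cocycle represented by `φ` to the class of `φ`. -/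
def IsVogelCohomology : Prop :=
  ∀ (B : C) (n : ℤ), ∃ e : (vogelComplex R.cochainComplex (P B).cochainComplex).homology n ≅
      (vogel R P n).obj B,
    ∀ (c : (vogelComplex R.cochainComplex (P B).cochainComplex).cycles n)
      (φ : Cochain R.cochainComplex (P B).cochainComplex n),
      (vogelComplex R.cochainComplex (P B).cochainComplex).iCycles n c =
          QuotientAddGroup.mk (s := Bdd R.cochainComplex (P B).cochainComplex n) φ →
        ∃ hφ : φ ∈ almostCocycles R.cochainComplex (P B).cochainComplex n,
          e.hom ((vogelComplex R.cochainComplex (P B).cochainComplex).homologyπ n c) =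
            almostMk φ hφ

end Formulae

end

end Mislin

/-!
The resolution construction `T_Res^n(M) = colim_k T^{n + k}(syz_k M)` is the centre of the proof:
every other functor of the theorem is compared with it, and the cohomological structures on the
other functors are transported along these comparisons.

**The resolution construction.** A morphism `M ⟶ N` lifts to the syzygies, and two lifts differ in
degree `k` by a morphism factoring through the projective `N_k ⟶ syz_k N`. The connecting
homomorphism kills such morphisms, so the lifts induce a well-defined morphism on direct limits. In
the same way a lift `syz_1 D ⟶ B` of the identity of `D`, for `0 ⟶ B ⟶ C ⟶ D ⟶ 0`, continues to
morphisms `s_k : syz_{k + 1} D ⟶ syz_k B`, and these induce the connecting homomorphism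
(`resConn`). By `Horseshoe.exists_lift`, the `s_k` can be chosen so that `s_k` composed with the
connecting homomorphism of `syz_k D` is `(-1)^k` times the connecting homomorphism of the `k`-th
sequence of a horseshoe. Hence the long exact sequences are sequential colimits of exact sequences
of abelian groups (`resStructure`). All of this is carried out for syzygy systems, which include
the syzygies of a resolution, their tails, and the middle column of a horseshoe.

**The universal property.** The resolution construction vanishes on projectives. If `T` itself
vanishes on projectives, all transition maps are isomorphisms, and so is `T ⟶ T_Res`; this gives
existence of factorisations by functoriality of the construction. Uniqueness on the `k`-th leg
follows by induction on `k`, moving from `M` to its first syzygy (`isMislinCompletion_res`).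

**Satellites.** The maps `S^{-k}T^{n + k}(M) ⟶ T^{n + k}(syz_k M)` are injective and, for `k ≥ 1`,
their images contain the kernel of `T^{n + k}(syz_k M) ⟶ T^{n + k}(M_{k - 1})`, because the
satellites vanish on projectives. This kernel contains the image of the transition map, so the
direct limit of these maps is an isomorphism (`isIso_satToRes`).

**Chain maps and almost chain maps.** Let `Φ` be a family of degree `n` which is a chain map in
degrees at least `k`. Its component in degree `k`, followed by `B_k ⟶ syz_k B` and multiplied by
`(-1)^{kn}`, is a cocycle with a class in `Ext^{n + k}(A, syz_k B)` (`syzClass`). The sign is the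
one for which these classes, for growing `k`, correspond to each other under the connecting
homomorphisms (`syzδ_syzClass`). Projectivity of the terms of the resolution of `A` shows that every
class arises (`exists_syzClass_eq`), and that `Φ` is nullhomotopic in degrees at least `k` if its
class vanishes (`exists_homotopy_of_syzClass_eq_zero`). For `k = 0` this is the isomorphism of
`Ext^n(A, B)` with homotopy classes of chain maps; in the direct limit it is the isomorphism of the
hypercohomology construction with the resolution construction of `Ext`. The formulae for the
connecting homomorphisms and for `ϑ` are checked on these classes.
-/

open CategoryTheory Limits

universe w

namespace Mislin

noncomputable section

/-! ### Transport of cohomological functors along natural isomorphisms -/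

section Transport

variable {C : Type u} [Category.{v} C] [Abelian C] {D : Type u'} [Category.{v'} D] [Abelian D]
  {T U V : ℤ → C ⥤ D}

lemma exact_of_isIso_squares {S₁ S₂ : ShortComplex D} (h : S₁.Exact) (a : S₁.X₁ ⟶ S₂.X₁)
    (b : S₁.X₂ ⟶ S₂.X₂) (c : S₁.X₃ ⟶ S₂.X₃) [IsIso a] [IsIso b] [IsIso c]
    (h₁ : a ≫ S₂.f = S₁.f ≫ b) (h₂ : b ≫ S₂.g = S₁.g ≫ c) : S₂.Exact :=
  ShortComplex.exact_of_iso (ShortComplex.isoMk (asIso a) (asIso b) (asIso c) h₁ h₂) h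

/-- The structure of a cohomological functor carried over along natural isomorphisms. -/
def CohStructure.transport (t : CohStructure T) (e : ∀ n, T n ≅ U n) : CohStructure U where
  additive n := by
    have := t.additive n
    exact Functor.additive_of_iso (e n)
  δ S hS n₀ n₁ h := (e n₀).inv.app S.X₃ ≫ t.δ S hS n₀ n₁ h ≫ (e n₁).hom.app S.X₁
  naturality hS hS' φ n₀ n₁ h := by
    rw [Category.assoc, Category.assoc, ← NatTrans.naturality, NatTrans.naturality_assoc,
      reassoc_of% (t.naturality hS hS' φ n₀ n₁ h)]
  exact₁ S hS n₀ n₁ h := by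
    obtain ⟨w, hw⟩ := t.exact₁ S hS n₀ n₁ h
    refine ⟨?_, exact_of_isIso_squares hw ((e n₀).hom.app S.X₃) ((e n₁).hom.app S.X₁)
      ((e n₁).hom.app S.X₂) ?_ ?_⟩
    · rw [Category.assoc, Category.assoc, ← NatTrans.naturality, reassoc_of% w]
      simp
    · simp
    · simp
  exact₂ S hS n := by
    obtain ⟨w, hw⟩ := t.exact₂ S hS n
    refine ⟨?_, exact_of_isIso_squares hw ((e n).hom.app S.X₁) ((e n).hom.app S.X₂)
      ((e n).hom.app S.X₃) ?_ ?_⟩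
    · rw [← Functor.map_comp, S.zero]
      have := t.additive n
      have := Functor.additive_of_iso (e n)
      simp
    · simp
    · simp
  exact₃ S hS n₀ n₁ h := by
    obtain ⟨w, hw⟩ := t.exact₃ S hS n₀ n₁ h
    refine ⟨?_, exact_of_isIso_squares hw ((e n₀).hom.app S.X₂) ((e n₀).hom.app S.X₃)
      ((e n₁).hom.app S.X₁) ?_ ?_⟩
    · rw [NatTrans.naturality_assoc, reassoc_of% w]
      simp
    · simp
    · simp

lemma CohStructure.isCohMorphism_transport (t : CohStructure T) (e : ∀ n, T n ≅ U n) :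
    IsCohMorphism t (t.transport e) (fun n => (e n).hom) := fun S hS n₀ n₁ h => by
  simp [CohStructure.transport]

lemma CohStructure.isCohMorphism_transport_inv (t : CohStructure T) (e : ∀ n, T n ≅ U n) :
    IsCohMorphism (t.transport e) t (fun n => (e n).inv) := fun S hS n₀ n₁ h => by
  simp [CohStructure.transport]

lemma IsCohMorphism.comp {t : CohStructure T} {s : CohStructure U} {r : CohStructure V}
    {μ : ∀ n, T n ⟶ U n} {ν : ∀ n, U n ⟶ V n} (hμ : IsCohMorphism t s μ)
    (hν : IsCohMorphism s r ν) : IsCohMorphism t r (fun n => μ n ≫ ν n) :=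
  fun S hS n₀ n₁ h => by
    rw [NatTrans.comp_app, NatTrans.comp_app, reassoc_of% (hμ S hS n₀ n₁ h), hν S hS n₀ n₁ h,
      Category.assoc]

lemma IsCohMorphism.inv {t : CohStructure T} {s : CohStructure U} {μ : ∀ n, T n ⟶ U n}
    (hμ : IsCohMorphism t s μ) [∀ n, IsIso (μ n)] :
    IsCohMorphism s t (fun n => CategoryTheory.inv (μ n)) :=
  fun S hS n₀ n₁ h => by
    rw [← cancel_epi ((μ n₀).app S.X₃), ← reassoc_of% (hμ S hS n₀ n₁ h)]
    simp

lemma IsCohIso.comp {t : CohStructure T} {s : CohStructure U} {r : CohStructure V}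
    {μ : ∀ n, T n ⟶ U n} {ν : ∀ n, U n ⟶ V n} (hμ : IsCohIso t s μ)
    (hν : IsCohIso s r ν) : IsCohIso t r (fun n => μ n ≫ ν n) :=
  ⟨hμ.1.comp hν.1, fun n => by
    have := hμ.2 n
    have := hν.2 n
    infer_instance⟩

/-- A Mislin completion followed by an isomorphism of cohomological functors is a Mislin
completion. -/
lemma IsMislinCompletion.comp_iso {t : CohStructure T} {s : CohStructure U} {r : CohStructure V}
    {ν : ∀ n, T n ⟶ U n} {e : ∀ n, U n ⟶ V n} (hν : IsMislinCompletion t s ν)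
    (he : IsCohIso s r e) : IsMislinCompletion t r (fun n => ν n ≫ e n) := by
  have := he.2
  refine ⟨hν.1.comp he.1, fun n Q hQ => (hν.2.1 n Q hQ).of_iso (asIso ((e n).app Q)).symm, ?_⟩
  intro W q hW μ hμ
  obtain ⟨κ, ⟨hκ, hκ'⟩, huniq⟩ := hν.2.2 W q hW μ hμ
  refine ⟨fun n => inv (e n) ≫ κ n, ⟨he.1.inv.comp hκ, fun n => by simp [hκ']⟩, ?_⟩
  rintro κ' ⟨h₁, h₂⟩
  have := huniq (fun n => e n ≫ κ' n) ⟨he.1.comp h₁, fun n => by rw [← h₂]; simp⟩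
  funext n
  rw [← this]
  simp

end Transport

/-! ### Sequential colimits of abelian groups -/

section Ab

instance : PreservesColimitsOfShape ℕ (forget AddCommGrpCat.{v}) :=
  have := preservesFilteredColimitsOfSize_shrink.{0, v, 0, v} (forget AddCommGrpCat.{v})
  PreservesFilteredColimitsOfSize.preserves_filtered_colimits ℕ

lemma exists_map_eq_zero_of_isColimit {F : ℕ ⥤ AddCommGrpCat.{v}} {c : Cocone F}
    (hc : IsColimit c) {k : ℕ} (x : F.obj k) (hx : c.ι.app k x = 0) :
    ∃ (l : ℕ) (f : k ⟶ l), F.map f x = 0 := by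
  obtain ⟨l, f, hl⟩ := (IsColimit.eq_iff' hc x 0).1 (by rw [hx, map_zero])
  exact ⟨l, f, by rw [hl, map_zero]⟩

lemma neg_one_pow_smul_smul {X : Type*} [AddCommGroup X] (k : ℕ) (x : X) :
    (-1 : ℤ) ^ k • (-1 : ℤ) ^ k • x = x := by
  rw [smul_smul, ← mul_pow]
  simp

/-- A complex of abelian groups is exact if it is a sequential colimit of exact ones. Only the
second map has to be compatible with the transition maps. -/
lemma exact_of_isColimit {S : ShortComplex AddCommGrpCat.{v}} {F : ℕ → AddCommGrpCat.{v}}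
    {G H : ℕ ⥤ AddCommGrpCat.{v}}
    {c₂ : Cocone G} (hc₂ : IsColimit c₂) {c₃ : Cocone H} (hc₃ : IsColimit c₃)
    (e₁ : ∀ k, F k ⟶ S.X₁) (e₂ : c₂.pt ⟶ S.X₂) [Epi e₂] (e₃ : c₃.pt ⟶ S.X₃) [Mono e₃]
    (a : ∀ k, F k ⟶ G.obj k) (b : G ⟶ H)
    (ha : ∀ k, e₁ k ≫ S.f = a k ≫ c₂.ι.app k ≫ e₂)
    (hb : ∀ k, c₂.ι.app k ≫ e₂ ≫ S.g = b.app k ≫ c₃.ι.app k ≫ e₃)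
    (h : ∀ k (y : G.obj k), b.app k y = 0 → ∃ z, a k z = y) : S.Exact := by
  rw [ShortComplex.ab_exact_iff]
  intro x hx
  obtain ⟨x, rfl⟩ := (AddCommGrpCat.epi_iff_surjective e₂).1 inferInstance x
  obtain ⟨k, y, rfl⟩ := Concrete.isColimit_exists_rep G hc₂ x
  have h0 : c₃.ι.app k (b.app k y) = 0 := by
    apply (AddCommGrpCat.mono_iff_injective e₃).1 inferInstance
    rw [map_zero, ← hx]
    exact (ConcreteCategory.congr_hom (hb k) y).symm
  obtain ⟨l, f, hf⟩ := exists_map_eq_zero_of_isColimit hc₃ _ h0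
  have h1 : b.app l (G.map f y) = 0 := by
    rw [← hf]
    exact ConcreteCategory.congr_hom (b.naturality f) y
  obtain ⟨z, hz⟩ := h l _ h1
  refine ⟨e₁ l z, (ConcreteCategory.congr_hom (ha l) z).trans ?_⟩
  have h2 : c₂.ι.app l (G.map f y) = c₂.ι.app k y := ConcreteCategory.congr_hom (c₂.w f) y
  simp only [ConcreteCategory.comp_apply]
  rw [hz, h2]

end Ab

/-! ### Syzygy systems -/

section SyzSystems

variable {C : Type u} [Category.{v} C] [Abelian C]

/-- A sequence of short exact sequences `0 ⟶ E (k + 1) ⟶ Q k ⟶ E k ⟶ 0` with projective middle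
terms: the syzygies of a projective resolution of `E 0`, where `E (k + 1)` is allowed to be any
kernel of `Q k ⟶ E k`. -/
structure SyzSystem (C : Type u) [Category.{v} C] [Abelian C] where
  E : ℕ → C
  Q : ℕ → C
  κ (k : ℕ) : E (k + 1) ⟶ Q k
  ρ (k : ℕ) : Q k ⟶ E k
  zero (k : ℕ) : κ k ≫ ρ k = 0
  shortExact (k : ℕ) : (ShortComplex.mk (κ k) (ρ k) (zero k)).ShortExact
  projective (k : ℕ) : Projective (Q k)

namespace SyzSystem

attribute [instance] projective

/-- The syzygies of a projective resolution. -/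
abbrev ofRes {X : C} (R : ProjectiveResolution X) : SyzSystem C where
  E := syz R
  Q := R.complex.X
  κ := syzι R
  ρ := syzπ R
  zero := syzι_π R
  shortExact := syzSES_shortExact R
  projective k := R.projective k

/-- The syzygies of `E 1`. -/
abbrev tail (E : SyzSystem C) : SyzSystem C where
  E k := E.E (k + 1)
  Q k := E.Q (k + 1)
  κ k := E.κ (k + 1)
  ρ k := E.ρ (k + 1)
  zero k := E.zero (k + 1)
  shortExact k := E.shortExact (k + 1)
  projective k := E.projective (k + 1)

/-- The middle column of a horseshoe system. -/
abbrev ofHorseshoe {P : ∀ X : C, ProjectiveResolution X} {S : ShortComplex C} (H : Horseshoe P S) :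
    SyzSystem C where
  E := H.E
  Q := H.Q
  κ := H.κ
  ρ := H.ρ
  zero := H.zero_col
  shortExact := H.shortExact_col
  projective := H.projective

instance (E : SyzSystem C) (k : ℕ) : Mono (E.κ k) := (E.shortExact k).mono_f
instance (E : SyzSystem C) (k : ℕ) : Epi (E.ρ k) := (E.shortExact k).epi_g

/-- The morphism to the next syzygy induced by a morphism killed by `ρ`. -/
def lift (E : SyzSystem C) {k : ℕ} {Y : C} (φ : Y ⟶ E.Q k) (h : φ ≫ E.ρ k = 0) : Y ⟶ E.E (k + 1) :=
  (E.shortExact k).exact.lift φ h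

@[simp]
lemma lift_κ (E : SyzSystem C) {k : ℕ} {Y : C} (φ : Y ⟶ E.Q k) (h : φ ≫ E.ρ k = 0) :
    E.lift φ h ≫ E.κ k = φ :=
  (E.shortExact k).exact.lift_f φ h

/-- `s` is a sequence of morphisms between syzygies in which `s (k + 1)` is a lift of `s k`. -/
def IsLift (E E' : SyzSystem C) (s : ∀ k, E.E k ⟶ E'.E k) : Prop :=
  ∀ k, ∃ g : E.Q k ⟶ E'.Q k, g ≫ E'.ρ k = E.ρ k ≫ s k ∧ E.κ k ≫ g = s (k + 1) ≫ E'.κ k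

/-- A sequence of lifts of a given morphism. -/
def liftSeq (E E' : SyzSystem C) (f : E.E 0 ⟶ E'.E 0) : ∀ k, E.E k ⟶ E'.E k
  | 0 => f
  | k + 1 => E'.lift (E.κ k ≫ Projective.factorThru (E.ρ k ≫ liftSeq E E' f k) (E'.ρ k)) (by
      rw [Category.assoc, Projective.factorThru_comp, reassoc_of% E.zero, zero_comp])

lemma isLift_liftSeq (E E' : SyzSystem C) (f : E.E 0 ⟶ E'.E 0) : IsLift E E' (liftSeq E E' f) :=
  fun k => ⟨Projective.factorThru (E.ρ k ≫ liftSeq E E' f k) (E'.ρ k),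
    Projective.factorThru_comp _ _, (lift_κ _ _ _).symm⟩

variable {E E' E'' : SyzSystem C}

lemma isLift_id (E : SyzSystem C) : IsLift E E (fun k => 𝟙 (E.E k)) :=
  fun k => ⟨𝟙 _, by simp, by simp⟩

lemma isLift_zero (E E' : SyzSystem C) : IsLift E E' (fun _ => 0) :=
  fun k => ⟨0, by simp, by simp⟩

lemma IsLift.comp {s : ∀ k, E.E k ⟶ E'.E k} {s' : ∀ k, E'.E k ⟶ E''.E k} (h : IsLift E E' s)
    (h' : IsLift E' E'' s') : IsLift E E'' (fun k => s k ≫ s' k) := fun k => by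
  obtain ⟨g, h₁, h₂⟩ := h k
  obtain ⟨g', h₁', h₂'⟩ := h' k
  exact ⟨g ≫ g', by rw [Category.assoc, h₁', reassoc_of% h₁],
    by rw [reassoc_of% h₂, h₂', Category.assoc]⟩

lemma IsLift.tail {s : ∀ k, E.E k ⟶ E'.E k} (h : IsLift E E' s) :
    IsLift E.tail E'.tail (fun k => s (k + 1)) := fun k => h (k + 1)

/-- If the difference of two lifts in degree `k` factors through `ρ k`, their difference in degree
`k + 1` extends along `κ k`: subtracting the factorisation from the difference of the maps between
the projectives gives a morphism killed by `ρ k`. -/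
lemma IsLift.exists_extension {s s' : ∀ k, E.E k ⟶ E'.E k} (h : IsLift E E' s)
    (h' : IsLift E E' s') {k : ℕ} (hk : ∃ u : E.E k ⟶ E'.Q k, s k - s' k = u ≫ E'.ρ k) :
    ∃ e : E.Q k ⟶ E'.E (k + 1), s (k + 1) - s' (k + 1) = E.κ k ≫ e := by
  obtain ⟨u, hu⟩ := hk
  obtain ⟨g, h₁, h₂⟩ := h k
  obtain ⟨g', h₁', h₂'⟩ := h' k
  refine ⟨E'.lift (g - g' - E.ρ k ≫ u) ?_, ?_⟩
  · rw [Preadditive.sub_comp, Preadditive.sub_comp, h₁, h₁', Category.assoc, ← hu,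
      Preadditive.comp_sub, sub_self]
  · rw [← cancel_mono (E'.κ k), Preadditive.sub_comp, ← h₂, ← h₂', Category.assoc, lift_κ,
      Preadditive.comp_sub, Preadditive.comp_sub, reassoc_of% E.zero, zero_comp, sub_zero]

lemma IsLift.exists_factor {s s' : ∀ k, E.E k ⟶ E'.E k} (h : IsLift E E' s)
    (h' : IsLift E E' s') (h0 : ∃ u : E.E 0 ⟶ E'.Q 0, s 0 - s' 0 = u ≫ E'.ρ 0) :
    ∀ k, ∃ u : E.E k ⟶ E'.Q k, s k - s' k = u ≫ E'.ρ k
  | 0 => h0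
  | k + 1 => by
    obtain ⟨e, he⟩ := h.exists_extension h' (IsLift.exists_factor h h' h0 k)
    exact ⟨E.κ k ≫ Projective.factorThru e (E'.ρ (k + 1)), by simp [he]⟩

/-- For maps out of the tail of a system, differences which extend along `κ 0` in degree `0` extend
along `κ` in all degrees. -/
lemma IsLift.exists_extension_tail {s s' : ∀ k, E.E (k + 1) ⟶ E'.E k} (h : IsLift E.tail E' s)
    (h' : IsLift E.tail E' s') (h0 : ∃ u : E.Q 0 ⟶ E'.E 0, s 0 - s' 0 = E.κ 0 ≫ u) :
    ∀ k, ∃ u : E.Q k ⟶ E'.E k, s k - s' k = E.κ k ≫ u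
  | 0 => h0
  | k + 1 => h.exists_extension h' (h.exists_factor h' (by
      obtain ⟨u, hu⟩ := h0
      exact ⟨E.κ 0 ≫ Projective.factorThru u (E'.ρ 0), hu.trans (by simp)⟩) k)

end SyzSystem

end SyzSystems

/-! ### The direct limit along a syzygy system -/

section SysColim

open SyzSystem

variable {C : Type u} [Category.{v} C] [Abelian C] {D : Type u'} [Category.{v'} D] [Abelian D]
  {T U : ℤ → C ⥤ D} (t : CohStructure T) (t' : CohStructure U)

/-- The connecting homomorphism of `0 ⟶ E (k + 1) ⟶ Q k ⟶ E k ⟶ 0`. -/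
def sysδ (E : SyzSystem C) (k : ℕ) (n₀ n₁ : ℤ) (h : n₀ + 1 = n₁) :
    (T n₀).obj (E.E k) ⟶ (T n₁).obj (E.E (k + 1)) :=
  t.δ _ (E.shortExact k) n₀ n₁ h

lemma map_ρ_sysδ (E : SyzSystem C) (k : ℕ) (n₀ n₁ : ℤ) (h : n₀ + 1 = n₁) :
    (T n₀).map (E.ρ k) ≫ sysδ t E k n₀ n₁ h = 0 :=
  (t.exact₃ _ (E.shortExact k) n₀ n₁ h).1

lemma sysδ_map_κ (E : SyzSystem C) (k : ℕ) (n₀ n₁ : ℤ) (h : n₀ + 1 = n₁) :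
    sysδ t E k n₀ n₁ h ≫ (T n₁).map (E.κ k) = 0 :=
  (t.exact₁ _ (E.shortExact k) n₀ n₁ h).1

lemma SyzSystem.IsLift.sysδ_naturality {E E' : SyzSystem C} {s : ∀ k, E.E k ⟶ E'.E k}
    (hs : IsLift E E' s) (k : ℕ) (n₀ n₁ : ℤ) (h : n₀ + 1 = n₁) :
    sysδ t E k n₀ n₁ h ≫ (T n₁).map (s (k + 1)) = (T n₀).map (s k) ≫ sysδ t E' k n₀ n₁ h := by
  obtain ⟨g, h₁, h₂⟩ := hs k
  exact t.naturality (E.shortExact k) (E'.shortExact k)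
    { τ₁ := s (k + 1), τ₂ := g, τ₃ := s k, comm₁₂ := h₂.symm, comm₂₃ := h₁ } n₀ n₁ h

lemma sysδ_map_naturality_of_tail {E E' : SyzSystem C} {s : ∀ k, E.E (k + 1) ⟶ E'.E k}
    (h : IsLift E.tail E' s) (n₀ n₁ : ℤ) (hn : n₀ + 1 = n₁) (k : ℕ) :
    sysδ t E k (n₀ + k) (n₀ + (k + 1 : ℕ)) (by push_cast; ring) ≫
        sysδ t E (k + 1) (n₀ + (k + 1 : ℕ)) (n₁ + (k + 1 : ℕ)) (by lia) ≫
          (T (n₁ + (k + 1 : ℕ))).map (s (k + 1)) =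
      (sysδ t E k (n₀ + k) (n₁ + k) (by lia) ≫ (T (n₁ + k)).map (s k)) ≫
        sysδ t E' k (n₁ + k) (n₁ + (k + 1 : ℕ)) (by push_cast; ring) := by
  have := h.sysδ_naturality t k (n₁ + k) (n₁ + (k + 1 : ℕ)) (by push_cast; lia)
  refine Eq.trans ?_ ((congrArg _ this).trans (Category.assoc _ _ _).symm)
  have key : ∀ (m m' m'' : ℤ) (h₁ : n₀ + k + 1 = m) (h₂ : m + 1 = m'') (e : m = m')
      (g : (T m'').obj (E.E (k + 2)) ⟶ (T (n₁ + (k + 1 : ℕ))).obj (E'.E (k + 1))),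
      sysδ t E k (n₀ + k) m' (h₁.trans e) ≫ sysδ t E (k + 1) m' m'' (by lia) ≫ g =
      sysδ t E k (n₀ + k) m h₁ ≫ sysδ t E (k + 1) m m'' h₂ ≫ g := by
    rintro _ _ _ _ _ rfl _
    rfl
  exact key _ _ _ _ _ (by push_cast; lia) _

/-- The direct system `T^{n + k}(E k)`, `k : ℕ`, along the connecting homomorphisms. -/
def sysSystem (E : SyzSystem C) (n : ℤ) : ℕ ⥤ D :=
  Functor.ofSequence (X := fun k : ℕ => (T (n + k)).obj (E.E k)) fun k =>
    sysδ t E k (n + k) (n + (k + 1 : ℕ)) (by push_cast; ring)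

lemma sysSystem_map_succ (E : SyzSystem C) (n : ℤ) (k : ℕ) :
    (sysSystem t E n).map (homOfLE (Nat.le_add_right k 1)) =
      sysδ t E k (n + k) (n + (k + 1 : ℕ)) (by push_cast; ring) :=
  Functor.ofSequence_map_homOfLE_succ _ _

/-- A family of morphisms compatible with the connecting homomorphisms, as a morphism of direct
systems. -/
def sysTrans (E E' : SyzSystem C) (n n' : ℤ) (τ : ∀ k : ℕ, (T (n + k)).obj (E.E k) ⟶
    (U (n' + k)).obj (E'.E k))
    (hτ : ∀ k : ℕ, sysδ t E k (n + k) (n + (k + 1 : ℕ)) (by push_cast; ring) ≫ τ (k + 1) =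
      τ k ≫ sysδ t' E' k (n' + k) (n' + (k + 1 : ℕ)) (by push_cast; ring)) :
    sysSystem t E n ⟶ sysSystem t' E' n' :=
  NatTrans.ofSequence τ fun k => by
    rw [sysSystem_map_succ, sysSystem_map_succ]
    exact hτ k

variable [HasColimitsOfShape ℕ D]

/-- The direct limit of `T^{n + k}(E k)`. -/
def sysColim (E : SyzSystem C) (n : ℤ) : D := colimit (sysSystem t E n)

/-- The canonical morphism `T^m(E k) ⟶ colim_k T^{n + k}(E k)` for `m = n + k`. -/
def sysLeg (E : SyzSystem C) (n : ℤ) (k : ℕ) (m : ℤ) (h : n + k = m) :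
    (T m).obj (E.E k) ⟶ sysColim t E n :=
  eqToHom (congrArg (fun j => (T j).obj (E.E k)) h.symm) ≫ colimit.ι (sysSystem t E n) k

lemma sysLeg_self (E : SyzSystem C) (n : ℤ) (k : ℕ) :
    sysLeg t E n k (n + k) rfl = colimit.ι (sysSystem t E n) k := by
  unfold sysLeg
  exact Category.id_comp _

lemma sysδ_sysLeg (E : SyzSystem C) (n : ℤ) (k : ℕ) (m m' : ℤ) (h : n + k = m)
    (hm : m + 1 = m') :
    sysδ t E k m m' hm ≫ sysLeg t E n (k + 1) m' (by push_cast; lia) = sysLeg t E n k m h := by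
  subst h
  obtain rfl : n + (k + 1 : ℕ) = m' := by push_cast; lia
  rw [sysLeg_self, sysLeg_self, ← sysSystem_map_succ]
  exact colimit.w _ _

lemma sysColim_hom_ext {E : SyzSystem C} {n : ℤ} {Z : D} {f g : sysColim t E n ⟶ Z}
    (h : ∀ k m hm, sysLeg t E n k m hm ≫ f = sysLeg t E n k m hm ≫ g) : f = g :=
  colimit.hom_ext fun k => by
    have := h k _ rfl
    rwa [sysLeg_self] at this

/-- The morphism of direct limits induced by a compatible family. The two degrees `n` and `n'` may
differ, so that connecting homomorphisms are included. -/
def sysColimMap (E E' : SyzSystem C) (n n' : ℤ) (τ : ∀ k : ℕ, (T (n + k)).obj (E.E k) ⟶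
    (U (n' + k)).obj (E'.E k))
    (hτ : ∀ k : ℕ, sysδ t E k (n + k) (n + (k + 1 : ℕ)) (by push_cast; ring) ≫ τ (k + 1) =
      τ k ≫ sysδ t' E' k (n' + k) (n' + (k + 1 : ℕ)) (by push_cast; ring)) :
    sysColim t E n ⟶ sysColim t' E' n' :=
  colimMap (sysTrans t t' E E' n n' τ hτ)

lemma sysLeg_sysColimMap (E E' : SyzSystem C) (n n' : ℤ) (τ hτ) (k : ℕ) :
    sysLeg t E n k (n + k) rfl ≫ sysColimMap t t' E E' n n' τ hτ =
      τ k ≫ sysLeg t' E' n' k (n' + k) rfl := by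
  rw [sysLeg_self, sysLeg_self]
  exact ι_colimMap _ _

/-- Lifts of morphisms which agree up to a factorisation through a projective induce the same
morphism on direct limits. -/
lemma map_sysLeg_eq {E E' : SyzSystem C} (n : ℤ) {s s' : ∀ k, E.E k ⟶ E'.E k}
    (h : IsLift E E' s) (h' : IsLift E E' s')
    (h0 : ∃ u : E.E 0 ⟶ E'.Q 0, s 0 - s' 0 = u ≫ E'.ρ 0) (k : ℕ) (m : ℤ) (hm : n + k = m) :
    (T m).map (s k) ≫ sysLeg t E' n k m hm = (T m).map (s' k) ≫ sysLeg t E' n k m hm := by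
  have := t.additive m
  obtain ⟨u, hu⟩ := h.exists_factor h' h0 k
  rw [← sub_eq_zero, ← Preadditive.sub_comp, ← Functor.map_sub, hu,
    ← sysδ_sysLeg t E' n k m (m + 1) hm rfl, Functor.map_comp, Category.assoc,
    reassoc_of% (map_ρ_sysδ t E' k m (m + 1) rfl), zero_comp, comp_zero]

/-- The morphism on direct limits induced by a sequence of lifts. -/
def sysDesc (n : ℤ) {E E' : SyzSystem C} (s : ∀ k, E.E k ⟶ E'.E k) (h : IsLift E E' s) :
    sysColim t E n ⟶ sysColim t E' n :=
  sysColimMap t t E E' n n (fun k => (T (n + k)).map (s k)) fun _ => h.sysδ_naturality t _ _ _ _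

lemma sysLeg_sysDesc (n : ℤ) {E E' : SyzSystem C} (s : ∀ k, E.E k ⟶ E'.E k) (h : IsLift E E' s)
    (k : ℕ) (m : ℤ) (hm : n + k = m) :
    sysLeg t E n k m hm ≫ sysDesc t n s h = (T m).map (s k) ≫ sysLeg t E' n k m hm := by
  subst hm
  exact sysLeg_sysColimMap _ _ _ _ _ _ _ _ _

lemma sysDesc_comp_eq_id (n : ℤ) {E E' : SyzSystem C} (s : ∀ k, E.E k ⟶ E'.E k)
    (h : IsLift E E' s) (s' : ∀ k, E'.E k ⟶ E.E k) (h' : IsLift E' E s') (h0 : s 0 ≫ s' 0 = 𝟙 _) :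
    sysDesc t n s h ≫ sysDesc t n s' h' = 𝟙 _ :=
  sysColim_hom_ext t fun k m hm => by
    rw [reassoc_of% (sysLeg_sysDesc t n s h), sysLeg_sysDesc, ← Category.assoc, ← Functor.map_comp,
      map_sysLeg_eq t n (h.comp h') (isLift_id E) ⟨0, by simp [h0]⟩]
    simp

/-- The direct limit depends only on `E 0`. -/
lemma isIso_sysDesc (n : ℤ) {E E' : SyzSystem C} (s : ∀ k, E.E k ⟶ E'.E k)
    (h : IsLift E E' s) [IsIso (s 0)] : IsIso (sysDesc t n s h) :=
  ⟨sysDesc t n _ (isLift_liftSeq E' E (inv (s 0))),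
    sysDesc_comp_eq_id t n _ _ _ _ (by simp [liftSeq]),
    sysDesc_comp_eq_id t n _ _ _ _ (by simp [liftSeq])⟩

/-- The morphism of degree one on direct limits induced by a sequence of morphisms
`E (k + 1) ⟶ E' k`. -/
def sysConn {E E' : SyzSystem C} (s : ∀ k, E.E (k + 1) ⟶ E'.E k) (h : IsLift E.tail E' s)
    (n₀ n₁ : ℤ) (hn : n₀ + 1 = n₁) : sysColim t E n₀ ⟶ sysColim t E' n₁ :=
  sysColimMap t t E E' n₀ n₁
    (fun k => sysδ t E k (n₀ + k) (n₁ + k) (by lia) ≫ (T (n₁ + k)).map (s k))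
    (sysδ_map_naturality_of_tail t h n₀ n₁ hn)

lemma sysLeg_sysConn {E E' : SyzSystem C} (s : ∀ k, E.E (k + 1) ⟶ E'.E k)
    (h : IsLift E.tail E' s) (n₀ n₁ : ℤ) (hn : n₀ + 1 = n₁) (k : ℕ) (m₀ m₁ : ℤ)
    (h₀ : n₀ + k = m₀) (h₁ : n₁ + k = m₁) :
    sysLeg t E n₀ k m₀ h₀ ≫ sysConn t s h n₀ n₁ hn =
      sysδ t E k m₀ m₁ (by lia) ≫ (T m₁).map (s k) ≫ sysLeg t E' n₁ k m₁ h₁ := by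
  subst h₀ h₁
  exact (sysLeg_sysColimMap _ _ _ _ _ _ _ _ _).trans (Category.assoc _ _ _)

/-- The morphism of degree one sends the class of an element of `T^m(E (k + 1))` to the class of
its image in `T^m(E' k)`. -/
lemma sysLeg_succ_sysConn {E E' : SyzSystem C} (s : ∀ k, E.E (k + 1) ⟶ E'.E k)
    (h : IsLift E.tail E' s) (n₀ n₁ : ℤ) (hn : n₀ + 1 = n₁) (k : ℕ) (m : ℤ)
    (h₀ : n₀ + (k + 1 : ℕ) = m) (h₁ : n₁ + k = m) :
    sysLeg t E n₀ (k + 1) m h₀ ≫ sysConn t s h n₀ n₁ hn =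
      (T m).map (s k) ≫ sysLeg t E' n₁ k m h₁ := by
  rw [sysLeg_sysConn t s h n₀ n₁ hn (k + 1) m (m + 1) h₀ (by push_cast; lia)]
  have := h.sysδ_naturality t k m (m + 1) rfl
  dsimp only [SyzSystem.tail] at this
  erw [reassoc_of% this]
  rw [sysδ_sysLeg t E' n₁ k m (m + 1) h₁ rfl]

lemma sysConn_eq {E E' : SyzSystem C} {s s' : ∀ k, E.E (k + 1) ⟶ E'.E k}
    (h : IsLift E.tail E' s) (h' : IsLift E.tail E' s')
    (h0 : ∃ u : E.Q 0 ⟶ E'.E 0, s 0 - s' 0 = E.κ 0 ≫ u) (n₀ n₁ : ℤ) (hn : n₀ + 1 = n₁) :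
    sysConn t s h n₀ n₁ hn = sysConn t s' h' n₀ n₁ hn :=
  sysColim_hom_ext t fun k m hm => by
    have := t.additive (m + 1)
    rw [sysLeg_sysConn t s h n₀ n₁ hn k m (m + 1) hm (by lia),
      sysLeg_sysConn t s' h' n₀ n₁ hn k m (m + 1) hm (by lia), ← sub_eq_zero,
      ← Preadditive.comp_sub, ← Preadditive.sub_comp, ← Functor.map_sub]
    obtain ⟨u, hu⟩ := h.exists_extension_tail h' h0 k
    rw [hu, Functor.map_comp, Category.assoc, reassoc_of% (sysδ_map_κ t E k m (m + 1) rfl),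
      zero_comp]

end SysColim

/-! ### Horseshoe systems -/

section Horseshoes

open SyzSystem

variable {C : Type u} [Category.{v} C] [Abelian C]

/-- An extension of `Z` by `X`. -/
structure Extension (X Z : C) where
  E : C
  f : X ⟶ E
  g : E ⟶ Z
  zero : f ≫ g = 0
  shortExact : (ShortComplex.mk f g zero).ShortExact

namespace Extension

variable {A B : SyzSystem C} {k : ℕ} (e : Extension (A.E k) (B.E k))

/-- The epimorphism from a projective onto an extension given by the Horseshoe Lemma. -/
def cover : A.Q k ⊞ B.Q k ⟶ e.E :=
  haveI := e.shortExact.epi_g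
  biprod.desc (A.ρ k ≫ e.f) (Projective.factorThru (B.ρ k) e.g)

lemma inl_cover : biprod.inl ≫ e.cover = A.ρ k ≫ e.f := by simp [cover]

lemma cover_g : e.cover ≫ e.g = biprod.snd ≫ B.ρ k := by
  have := e.shortExact.epi_g
  ext
  · simp [cover, e.zero]
  · simp only [cover, biprod.inr_desc_assoc, biprod.inr_snd_assoc]
    exact Projective.factorThru_comp (B.ρ k) e.g

instance : Epi e.cover := by
  rw [Preadditive.epi_iff_cancel_zero]
  intro Z φ hφ
  have h₁ : e.f ≫ φ = 0 := by
    rw [← cancel_epi (A.ρ k), ← Category.assoc, ← inl_cover, Category.assoc, hφ, comp_zero,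
      comp_zero]
  have := e.shortExact.epi_g
  have h₂ : e.g ≫ e.shortExact.exact.desc φ h₁ = φ := e.shortExact.exact.g_desc φ h₁
  rw [← h₂, reassoc_of% e.cover_g] at hφ
  have h₃ := (cancel_epi _).1 (hφ.trans (comp_zero (f := biprod.snd)).symm)
  rw [← h₂, (cancel_epi _).1 (h₃.trans (comp_zero (f := B.ρ k)).symm), comp_zero]

/-- The inclusion of the next syzygy of the subobject into the kernel of the cover. -/
def nextF : A.E (k + 1) ⟶ kernel e.cover :=
  kernel.lift _ (A.κ k ≫ biprod.inl) (by
    rw [Category.assoc, inl_cover, reassoc_of% A.zero k, zero_comp])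

lemma nextF_ι : e.nextF ≫ kernel.ι e.cover = A.κ k ≫ biprod.inl := kernel.lift_ι _ _ _

/-- The projection of the kernel of the cover to the next syzygy of the quotient. -/
def nextG : kernel e.cover ⟶ B.E (k + 1) :=
  B.lift (kernel.ι e.cover ≫ biprod.snd) (by
    rw [Category.assoc, ← cover_g, kernel.condition_assoc, zero_comp])

lemma nextG_κ : e.nextG ≫ B.κ k = kernel.ι e.cover ≫ biprod.snd := lift_κ _ _ _

lemma nextF_nextG : e.nextF ≫ e.nextG = 0 := by
  rw [← cancel_mono (B.κ k), Category.assoc, nextG_κ, reassoc_of% e.nextF_ι]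
  simp

instance : Mono e.nextF := by
  have : Mono (A.κ k ≫ (biprod.inl : A.Q k ⟶ A.Q k ⊞ B.Q k)) := mono_comp _ _
  exact mono_of_mono_fac e.nextF_ι

instance : Epi e.nextG := by
  have := e.shortExact.mono_f
  rw [epi_iff_surjective_up_to_refinements]
  intro Y y
  have h₁ : (y ≫ B.κ k ≫ biprod.inr ≫ e.cover) ≫ e.g = 0 := by
    rw [Category.assoc, Category.assoc, Category.assoc, cover_g, biprod.inr_snd_assoc, B.zero,
      comp_zero]
  obtain ⟨Y', π, hπ, b, hb⟩ := surjective_up_to_refinements_of_epi (A.ρ k)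
    (e.shortExact.exact.lift _ h₁)
  have h₂ : b ≫ biprod.inl ≫ e.cover = π ≫ y ≫ B.κ k ≫ biprod.inr ≫ e.cover := by
    rw [inl_cover, ← reassoc_of% hb]
    exact congrArg (π ≫ ·) (e.shortExact.exact.lift_f _ h₁)
  refine ⟨Y', π, hπ, kernel.lift _ (π ≫ y ≫ B.κ k ≫ biprod.inr - b ≫ biprod.inl) (by
    rw [Preadditive.sub_comp]
    simp [h₂]), ?_⟩
  rw [← cancel_mono (B.κ k), Category.assoc, Category.assoc, nextG_κ, kernel.lift_ι_assoc]
  simp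

lemma next_exact : (ShortComplex.mk _ _ e.nextF_nextG).Exact := by
  have := e.shortExact.mono_f
  rw [ShortComplex.exact_iff_exact_up_to_refinements]
  intro Y x hx
  change Y ⟶ kernel e.cover at x
  replace hx : x ≫ e.nextG = 0 := hx
  have h₁ : x ≫ kernel.ι e.cover ≫ biprod.snd = 0 := by
    rw [← nextG_κ, reassoc_of% hx, zero_comp]
  have h₂ : (x ≫ kernel.ι e.cover ≫ biprod.fst) ≫ biprod.inl = x ≫ kernel.ι e.cover := by
    ext
    · simp
    · simpa using h₁.symm
  have h₃ : (x ≫ kernel.ι e.cover ≫ biprod.fst) ≫ A.ρ k = 0 := by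
    have : ((x ≫ kernel.ι e.cover ≫ biprod.fst) ≫ A.ρ k) ≫ e.f = 0 := by
      rw [Category.assoc, ← inl_cover, ← Category.assoc, h₂, Category.assoc, kernel.condition,
        comp_zero]
    exact (cancel_mono e.f).1 (this.trans zero_comp.symm)
  refine ⟨Y, 𝟙 Y, inferInstance, A.lift _ h₃, ?_⟩
  have : (𝟙 Y ≫ x) ≫ kernel.ι e.cover = (A.lift _ h₃ ≫ e.nextF) ≫ kernel.ι e.cover := by
    rw [Category.assoc, Category.assoc, nextF_ι, ← Category.assoc (A.lift _ h₃), lift_κ, h₂,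
      Category.id_comp]
  exact (cancel_mono _).1 this

/-- The kernel of the epimorphism onto an extension is an extension of the next syzygies. -/
def next : Extension (A.E (k + 1)) (B.E (k + 1)) where
  E := kernel e.cover
  f := e.nextF
  g := e.nextG
  zero := e.nextF_nextG
  shortExact :=
    { exact := e.next_exact
      mono_f := inferInstanceAs (Mono e.nextF)
      epi_g := inferInstanceAs (Epi e.nextG) }

end Extension

variable (P : ∀ X : C, ProjectiveResolution X)

/-- The extensions of syzygies obtained by iterating the Horseshoe Lemma. -/
def horseshoeExt {S : ShortComplex C} (hS : S.ShortExact) :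
    ∀ k, Extension ((ofRes (P S.X₁)).E k) ((ofRes (P S.X₃)).E k)
  | 0 => ⟨S.X₂, S.f, S.g, S.zero, hS⟩
  | k + 1 => (horseshoeExt hS k).next

lemma nonempty_horseshoe {S : ShortComplex C} (hS : S.ShortExact) : Nonempty (Horseshoe P S) :=
  ⟨{ E := fun k => (horseshoeExt P hS k).E
     f := fun k => (horseshoeExt P hS k).f
     g := fun k => (horseshoeExt P hS k).g
     zero := fun k => (horseshoeExt P hS k).zero
     shortExact := fun k => (horseshoeExt P hS k).shortExact
     iso₀ := Iso.refl _
     f_iso₀ := Category.comp_id _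
     iso₀_g := Category.id_comp _
     Q := fun k => (P S.X₁).complex.X k ⊞ (P S.X₃).complex.X k
     projective := fun _ => inferInstance
     i := fun _ => biprod.inl
     p := fun _ => biprod.snd
     zero_mid := fun _ => biprod.inl_snd
     shortExact_mid := fun _ =>
      (ShortComplex.Splitting.ofHasBinaryBiproduct _ _).shortExact
     κ := fun k => kernel.ι (horseshoeExt P hS k).cover
     ρ := fun k => (horseshoeExt P hS k).cover
     zero_col := fun _ => kernel.condition _
     shortExact_col := fun k =>
      { exact := ShortComplex.exact_of_f_is_kernel _ (kernelIsKernel _)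
        mono_f := inferInstanceAs (Mono (kernel.ι _))
        epi_g := inferInstanceAs (Epi (horseshoeExt P hS k).cover) }
     f_κ := fun _ => kernel.lift_ι _ _ _
     g_ι := fun _ => lift_κ _ _ _
     i_ρ := fun k => (horseshoeExt P hS k).inl_cover
     ρ_g := fun k => (horseshoeExt P hS k).cover_g }⟩

variable {P}

lemma exists_isLiftOfId {S : ShortComplex C} (hS : S.ShortExact) (R : ProjectiveResolution S.X₃) :
    ∃ h, IsLiftOfId S R h := by
  have := hS.mono_f
  have := hS.epi_g
  let π : R.complex.X 0 ⟶ S.X₃ := syzπ R 0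
  have h0 : (syzι R 0 ≫ Projective.factorThru π S.g) ≫ S.g = 0 := by
    rw [Category.assoc, Projective.factorThru_comp]
    exact syzι_π R 0
  exact ⟨hS.exact.lift _ h0, _, Projective.factorThru_comp π S.g, (hS.exact.lift_f _ h0).symm⟩

/-- Two morphisms into `S.X₁` which become restrictions along `i` of morphisms into `S.X₂` lifting
the same morphism differ by a restriction along `i`. -/
lemma exists_extension_of_lifts {S : ShortComplex C} (hS : S.ShortExact) {X Y : C} (i : X ⟶ Y)
    {h h' : X ⟶ S.X₁} {c c' : Y ⟶ S.X₂} (hc : i ≫ c = h ≫ S.f) (hc' : i ≫ c' = h' ≫ S.f)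
    (hg : c ≫ S.g = c' ≫ S.g) : ∃ u : Y ⟶ S.X₁, h - h' = i ≫ u := by
  have := hS.mono_f
  have h0 : (c - c') ≫ S.g = 0 := by rw [Preadditive.sub_comp, hg, sub_self]
  refine ⟨hS.exact.lift _ h0, ?_⟩
  rw [← cancel_mono S.f, Category.assoc, hS.exact.lift_f, Preadditive.sub_comp,
    Preadditive.comp_sub, hc, hc']

lemma IsLiftOfId.exists_extension {S : ShortComplex C} (hS : S.ShortExact)
    {R : ProjectiveResolution S.X₃} {h h' : syz R 1 ⟶ S.X₁} (hh : IsLiftOfId S R h)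
    (hh' : IsLiftOfId S R h') : ∃ u : R.complex.X 0 ⟶ S.X₁, h - h' = syzι R 0 ≫ u := by
  obtain ⟨c, h₁, h₂⟩ := hh
  obtain ⟨c', h₁', h₂'⟩ := hh'
  exact exists_extension_of_lifts hS _ h₂ h₂' (h₁.trans h₁'.symm)

/-- Lifts of identities are natural up to morphisms which extend to the projective. -/
lemma exists_extension_of_isLiftOfId {S S' : ShortComplex C} (hS' : S'.ShortExact) (φ : S ⟶ S')
    {R : ProjectiveResolution S.X₃} {R' : ProjectiveResolution S'.X₃}
    {l : syz R 1 ⟶ S.X₁} (hl : IsLiftOfId S R l) {l' : syz R' 1 ⟶ S'.X₁}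
    (hl' : IsLiftOfId S' R' l') {s : ∀ k, syz R k ⟶ syz R' k} (hs : IsSyzLift R R' s)
    (h0 : s 0 = φ.τ₃) :
    ∃ u : R.complex.X 0 ⟶ S'.X₁, l ≫ φ.τ₁ - s 1 ≫ l' = syzι R 0 ≫ u := by
  obtain ⟨c, hc, hc'⟩ := hl
  obtain ⟨d, hd, hd'⟩ := hl'
  obtain ⟨b, hb, hb'⟩ := hs 0
  refine exists_extension_of_lifts hS' (syzι R 0) (c := c ≫ φ.τ₂) (c' := b ≫ d) ?_ ?_ ?_
  · rw [reassoc_of% hc', Category.assoc, φ.comm₁₂]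
  · rw [reassoc_of% hb', hd', Category.assoc]
  · rw [Category.assoc, φ.comm₂₃, Category.assoc, hd]
    refine Eq.trans ?_ hb.symm
    rw [h0]
    exact (Category.assoc _ _ _).symm.trans (congrArg (· ≫ φ.τ₃) hc)

variable {D : Type u'} [Category.{v'} D] [Abelian D] {T : ℤ → C ⥤ D} (t : CohStructure T)

/-- The connecting homomorphism of `S` factors through the one of the syzygy sequence. -/
lemma syzδ_map_of_isLiftOfId {S : ShortComplex C} (hS : S.ShortExact)
    {l : syz (P S.X₃) 1 ⟶ S.X₁} (hl : IsLiftOfId S (P S.X₃) l) (n₀ n₁ : ℤ) (h : n₀ + 1 = n₁) :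
    syzδ t (P S.X₃) 0 n₀ n₁ h ≫ (T n₁).map l = t.δ S hS n₀ n₁ h := by
  obtain ⟨c, hc, hc'⟩ := hl
  let φ : syzSES (P S.X₃) 0 ⟶ S :=
    { τ₁ := l, τ₂ := c, τ₃ := 𝟙 S.X₃, comm₁₂ := hc'.symm, comm₂₃ := hc.trans
        (Category.comp_id (syzπ (P S.X₃) 0)).symm }
  refine (t.naturality (syzSES_shortExact (P S.X₃) 0) hS φ n₀ n₁ h).trans ?_
  exact (congrArg (· ≫ _) ((T n₀).map_id S.X₃)).trans (Category.id_comp _)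

/-- The connecting homomorphisms of the short exact sequences in a horseshoe system are induced, up
to the sign `(-1)^k`, by a single sequence of lifts `syz_{k + 1} X₃ ⟶ syz_k X₁`. The signs come from
the anticommutativity of the two ways around a horseshoe. -/
lemma Horseshoe.exists_lift {S : ShortComplex C} (H : Horseshoe P S) :
    ∃ s : ∀ k, syz (P S.X₃) (k + 1) ⟶ syz (P S.X₁) k,
      IsLift (ofRes (P S.X₃)).tail (ofRes (P S.X₁)) s ∧ IsLiftOfId S (P S.X₃) (s 0) ∧
      ∀ (k : ℕ) (n₀ n₁ : ℤ) (h : n₀ + 1 = n₁),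
        sysδ t (ofRes (P S.X₃)) k n₀ n₁ h ≫ (T n₁).map (s k) =
          (-1 : ℤ) ^ k • t.δ _ (H.shortExact k) n₀ n₁ h := by
  have hp (k : ℕ) : Epi (H.p k) := (H.shortExact_mid k).epi_g
  have hf (k : ℕ) : Mono (H.f k) := (H.shortExact k).mono_f
  have hi (k : ℕ) : Mono (H.i k) := (H.shortExact_mid k).mono_f
  -- sections of the projections of the horseshoe, and the resulting lifts of `syzπ` to `E k`
  let σ (k : ℕ) : (P S.X₃).complex.X k ⟶ H.Q k := Projective.factorThru (𝟙 _) (H.p k)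
  have hσ (k : ℕ) : σ k ≫ H.p k = 𝟙 _ := Projective.factorThru_comp _ _
  let c (k : ℕ) : (P S.X₃).complex.X k ⟶ H.E k := σ k ≫ H.ρ k
  have hc (k : ℕ) : c k ≫ H.g k = syzπ (P S.X₃) k := by
    simp only [c, Category.assoc, H.ρ_g, reassoc_of% (hσ k)]
  have h0 (k : ℕ) : (syzι (P S.X₃) k ≫ c k) ≫ H.g k = 0 := by
    rw [Category.assoc, hc, syzι_π]
  let l (k : ℕ) : syz (P S.X₃) (k + 1) ⟶ syz (P S.X₁) k := (H.shortExact k).exact.lift _ (h0 k)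
  have hl (k : ℕ) : l k ≫ H.f k = syzι (P S.X₃) k ≫ c k := (H.shortExact k).exact.lift_f _ (h0 k)
  refine ⟨fun k => (-1 : ℤ) ^ k • l k, fun k => ?_, ⟨c 0 ≫ H.iso₀.inv, ?_, ?_⟩,
    fun k n₀ n₁ h => ?_⟩
  · -- going through `syzι k` and `σ k`, or through `c (k + 1)` and `H.κ k`, gives two morphisms to
    -- `H.Q k` which agree after `H.p k`; their difference `b` into the subobject covers `l k` and
    -- restricts to `-l (k + 1)`, whence the alternating signs
    have h₁ : (syzπ (P S.X₃) (k + 1) ≫ syzι (P S.X₃) k ≫ σ k - c (k + 1) ≫ H.κ k) ≫ H.p k = 0 := by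
      rw [Preadditive.sub_comp, Category.assoc, Category.assoc, hσ, Category.comp_id,
        Category.assoc, ← H.g_ι, reassoc_of% (hc (k + 1)), sub_self]
    obtain ⟨b, hb⟩ : ∃ b, b ≫ H.i k =
        syzπ (P S.X₃) (k + 1) ≫ syzι (P S.X₃) k ≫ σ k - c (k + 1) ≫ H.κ k :=
      ⟨(H.shortExact_mid k).exact.lift _ h₁, (H.shortExact_mid k).exact.lift_f _ h₁⟩
    have e₁ : b ≫ syzπ (P S.X₁) k = syzπ (P S.X₃) (k + 1) ≫ l k := by
      rw [← cancel_mono (H.f k), Category.assoc, Category.assoc, ← H.i_ρ, reassoc_of% hb, hl,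
        Preadditive.sub_comp, Category.assoc (c (k + 1)), H.zero_col]
      simp [c]
    have e₂ : syzι (P S.X₃) (k + 1) ≫ b = - (l (k + 1) ≫ syzι (P S.X₁) k) := by
      rw [← cancel_mono (H.i k), Category.assoc, hb, Preadditive.comp_sub, ← Category.assoc,
        syzι_π, zero_comp, zero_sub, Preadditive.neg_comp, Category.assoc (l (k + 1)),
        ← H.f_κ, reassoc_of% (hl (k + 1))]
    refine ⟨(-1 : ℤ) ^ k • b, ?_, ?_⟩
    · simp only [ofRes, tail, Preadditive.zsmul_comp, Preadditive.comp_zsmul, e₁]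
    · simp only [ofRes, tail, Preadditive.zsmul_comp, Preadditive.comp_zsmul, e₂, pow_succ]
      simp
  · rw [Category.assoc, ← H.iso₀_g]
    exact (congrArg (c 0 ≫ ·) (Iso.inv_hom_id_assoc H.iso₀ (H.g 0))).trans (hc 0)
  · have h₁ : H.f 0 ≫ H.iso₀.inv = S.f := (Iso.comp_inv_eq H.iso₀).2 H.f_iso₀.symm
    have h₂ : (-1 : ℤ) ^ 0 • l 0 = l 0 := by simp
    rw [← Category.assoc, ← hl]
    refine (Category.assoc _ _ _).trans ?_
    rw [h₁]
    exact congrArg (· ≫ S.f) h₂.symm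
  · have := t.additive n₁
    have h₂ := t.naturality ((ofRes (P S.X₃)).shortExact k) (H.shortExact k)
      { τ₁ := l k, τ₂ := c k, τ₃ := 𝟙 _, comm₁₂ := hl k, comm₂₃ := (hc k).trans
          (Category.comp_id _).symm } n₀ n₁ h
    have h₃ : sysδ t (ofRes (P S.X₃)) k n₀ n₁ h ≫ (T n₁).map (l k) =
        t.δ _ (H.shortExact k) n₀ n₁ h :=
      h₂.trans (((T n₀).map_id _).symm ▸ Category.id_comp _)
    rw [← h₃, ← Preadditive.comp_zsmul, ← Functor.map_zsmul]

end Horseshoes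

/-! ### The resolution construction as a cohomological functor -/

section ResStructure

open SyzSystem

variable {C : Type u} [Category.{v} C] [Abelian C]

section Connecting

variable {D : Type u'} [Category.{v'} D] [Abelian D] [HasColimitsOfShape ℕ D]
  {T : ℤ → C ⥤ D} (t : CohStructure T) (P : ∀ X : C, ProjectiveResolution X)

lemma res_hom_ext' {n : ℤ} {M : C} {Z : D} {f g : (resFunctor t P n).obj M ⟶ Z}
    (h : ∀ k m hm, resLeg t P n k m hm M ≫ f = resLeg t P n k m hm M ≫ g) : f = g :=
  sysColim_hom_ext t (E := ofRes (P M)) h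

lemma syzδ_resLeg (n : ℤ) (k : ℕ) (m m' : ℤ) (h : n + k = m) (hm : m + 1 = m') (M : C) :
    syzδ t (P M) k m m' hm ≫ resLeg t P n (k + 1) m' (by push_cast; lia) M =
      resLeg t P n k m h M :=
  sysδ_sysLeg t (ofRes (P M)) n k m m' h hm

lemma resLeg_map (n : ℤ) {M N : C} (f : M ⟶ N) {s : ∀ k, syz (P M) k ⟶ syz (P N) k}
    (hs : IsSyzLift (P M) (P N) s) (h0 : s 0 = f) (k : ℕ) (m : ℤ) (hm : n + k = m) :
    resLeg t P n k m hm M ≫ (resFunctor t P n).map f =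
      (T m).map (s k) ≫ resLeg t P n k m hm N :=
  (sysLeg_sysDesc t n (E := ofRes (P M)) (E' := ofRes (P N)) _
    (isSyzLift_syzMap (P M) (P N) f) k m hm).trans
    (map_sysLeg_eq t n (E := ofRes (P M)) (E' := ofRes (P N)) (isSyzLift_syzMap (P M) (P N) f)
      hs ⟨0, (sub_eq_zero.2 h0.symm).trans zero_comp.symm⟩ k m hm)

/-- The resolution construction as a direct limit along a syzygy system. -/
def sysColimToRes (n : ℤ) (M : C) : sysColim t (ofRes (P M)) n ⟶ (resFunctor t P n).obj M := 𝟙 _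

instance (n : ℤ) (M : C) : IsIso (sysColimToRes t P n M) :=
  inferInstanceAs (IsIso (𝟙 (sysColim t (ofRes (P M)) n)))

lemma sysLeg_sysColimToRes (n : ℤ) (k : ℕ) (m : ℤ) (hm : n + k = m) (M : C) :
    sysLeg t (ofRes (P M)) n k m hm ≫ sysColimToRes t P n M = resLeg t P n k m hm M :=
  Category.comp_id _

lemma resFunctor_additive (n : ℤ) : (resFunctor t P n).Additive where
  map_add {M N f g} := res_hom_ext' t P fun k m hm => by
    have := t.additive m
    rw [resLeg_map t P n (f + g) ((isSyzLift_syzMap (P M) (P N) f).add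
        (isSyzLift_syzMap (P M) (P N) g)) rfl, Preadditive.comp_add,
      resLeg_map t P n f (isSyzLift_syzMap (P M) (P N) f) rfl,
      resLeg_map t P n g (isSyzLift_syzMap (P M) (P N) g) rfl, Functor.map_add,
      Preadditive.add_comp]

/-- The connecting homomorphisms of the resolution construction, induced by the lifts
`syz_{k + 1} S.X₃ ⟶ syz_k S.X₁` of a lift of the identity of `S.X₃`. -/
def resConn {S : ShortComplex C} (hS : S.ShortExact) (n₀ n₁ : ℤ) (h : n₀ + 1 = n₁) :
    (resFunctor t P n₀).obj S.X₃ ⟶ (resFunctor t P n₁).obj S.X₁ :=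
  sysConn t (E := ofRes (P S.X₃)) (E' := ofRes (P S.X₁)) _
    (isLift_liftSeq (ofRes (P S.X₃)).tail (ofRes (P S.X₁))
      (exists_isLiftOfId hS (P S.X₃)).choose) n₀ n₁ h

variable {P} in
lemma resConn_eq {S : ShortComplex C} (hS : S.ShortExact)
    {s : ∀ k, syz (P S.X₃) (k + 1) ⟶ syz (P S.X₁) k}
    (hs : IsLift (ofRes (P S.X₃)).tail (ofRes (P S.X₁)) s) (h0 : IsLiftOfId S (P S.X₃) (s 0))
    (n₀ n₁ : ℤ) (h : n₀ + 1 = n₁) :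
    resConn t P hS n₀ n₁ h = sysConn t (E := ofRes (P S.X₃)) (E' := ofRes (P S.X₁)) s hs n₀ n₁ h :=
  sysConn_eq t (E := ofRes (P S.X₃)) (E' := ofRes (P S.X₁)) _ hs
    (IsLiftOfId.exists_extension hS (exists_isLiftOfId hS (P S.X₃)).choose_spec h0) n₀ n₁ h

variable {P} in
lemma resLeg_resConn {S : ShortComplex C} (hS : S.ShortExact)
    {s : ∀ k, syz (P S.X₃) (k + 1) ⟶ syz (P S.X₁) k}
    (hs : IsLift (ofRes (P S.X₃)).tail (ofRes (P S.X₁)) s) (h0 : IsLiftOfId S (P S.X₃) (s 0))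
    (n₀ n₁ : ℤ) (h : n₀ + 1 = n₁) (k : ℕ) (m₀ m₁ : ℤ) (h₀ : n₀ + k = m₀) (h₁ : n₁ + k = m₁) :
    resLeg t P n₀ k m₀ h₀ S.X₃ ≫ resConn t P hS n₀ n₁ h =
      syzδ t (P S.X₃) k m₀ m₁ (by lia) ≫ (T m₁).map (s k) ≫ resLeg t P n₁ k m₁ h₁ S.X₁ := by
  rw [resConn_eq t hS hs h0]
  exact sysLeg_sysConn t (E := ofRes (P S.X₃)) (E' := ofRes (P S.X₁)) s hs n₀ n₁ h k m₀ m₁ h₀ h₁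

variable {P} in
lemma resLeg_succ_resConn {S : ShortComplex C} (hS : S.ShortExact)
    {s : ∀ k, syz (P S.X₃) (k + 1) ⟶ syz (P S.X₁) k}
    (hs : IsLift (ofRes (P S.X₃)).tail (ofRes (P S.X₁)) s) (h0 : IsLiftOfId S (P S.X₃) (s 0))
    (n₀ n₁ : ℤ) (h : n₀ + 1 = n₁) (k : ℕ) (m : ℤ) (h₀ : n₀ + (k + 1 : ℕ) = m) (h₁ : n₁ + k = m) :
    resLeg t P n₀ (k + 1) m h₀ S.X₃ ≫ resConn t P hS n₀ n₁ h =
      (T m).map (s k) ≫ resLeg t P n₁ k m h₁ S.X₁ := by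
  rw [resConn_eq t hS hs h0]
  exact sysLeg_succ_sysConn t (E := ofRes (P S.X₃)) (E' := ofRes (P S.X₁)) s hs n₀ n₁ h k m h₀ h₁

/-- The connecting homomorphisms of the resolution construction in terms of a horseshoe system. -/
lemma resLeg_resConn_horseshoe {S : ShortComplex C} (hS : S.ShortExact) (H : Horseshoe P S)
    (n₀ n₁ : ℤ) (h : n₀ + 1 = n₁) (k : ℕ) (m₀ m₁ : ℤ) (h₀ : n₀ + k = m₀)
    (h₁ : n₁ + k = m₁) (hm : m₀ + 1 = m₁) :
    resLeg t P n₀ k m₀ h₀ S.X₃ ≫ resConn t P hS n₀ n₁ h =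
      (-1 : ℤ) ^ k • (t.δ _ (H.shortExact k) m₀ m₁ hm ≫ resLeg t P n₁ k m₁ h₁ S.X₁) := by
  obtain ⟨s, hs, h0, hδ⟩ := H.exists_lift t
  rw [resLeg_resConn t hS hs h0 n₀ n₁ h k m₀ m₁ h₀ h₁, ← Preadditive.zsmul_comp, ← hδ k m₀ m₁ hm]
  exact (Category.assoc _ _ _).symm

lemma resConn_naturality {S S' : ShortComplex C} (hS : S.ShortExact) (hS' : S'.ShortExact)
    (φ : S ⟶ S') (n₀ n₁ : ℤ) (h : n₀ + 1 = n₁) :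
    resConn t P hS n₀ n₁ h ≫ (resFunctor t P n₁).map φ.τ₁ =
      (resFunctor t P n₀).map φ.τ₃ ≫ resConn t P hS' n₀ n₁ h := by
  obtain ⟨l, hl⟩ := exists_isLiftOfId hS (P S.X₃)
  obtain ⟨l', hl'⟩ := exists_isLiftOfId hS' (P S'.X₃)
  have hs := isLift_liftSeq (ofRes (P S.X₃)).tail (ofRes (P S.X₁)) l
  have hs' := isLift_liftSeq (ofRes (P S'.X₃)).tail (ofRes (P S'.X₁)) l'
  have h₁ := isSyzLift_syzMap (P S.X₁) (P S'.X₁) φ.τ₁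
  have h₃ := isSyzLift_syzMap (P S.X₃) (P S'.X₃) φ.τ₃
  -- both composites are induced by lifts of the same morphism, up to a map from a projective
  have key : ∃ u : (P S.X₃).complex.X 0 ⟶ S'.X₁,
      l ≫ φ.τ₁ - syzMap (P S.X₃) (P S'.X₃) φ.τ₃ 1 ≫ l' = syzι (P S.X₃) 0 ≫ u :=
    exists_extension_of_isLiftOfId hS' φ hl hl' h₃ rfl
  refine res_hom_ext' t P fun k m hm => ?_
  have := t.additive (m + 1)
  have e₁ : resLeg t P n₀ k m hm S.X₃ ≫ resConn t P hS n₀ n₁ h =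
      syzδ t (P S.X₃) k m (m + 1) rfl ≫ (T (m + 1)).map _ ≫
        resLeg t P n₁ k (m + 1) (by lia) S.X₁ :=
    resLeg_resConn t hS hs hl n₀ n₁ h k m (m + 1) hm (by lia)
  have e₂ : resLeg t P n₀ k m hm S'.X₃ ≫ resConn t P hS' n₀ n₁ h =
      syzδ t (P S'.X₃) k m (m + 1) rfl ≫ (T (m + 1)).map _ ≫
        resLeg t P n₁ k (m + 1) (by lia) S'.X₁ :=
    resLeg_resConn t hS' hs' hl' n₀ n₁ h k m (m + 1) hm (by lia)
  rw [reassoc_of% e₁, resLeg_map t P n₁ φ.τ₁ h₁ rfl,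
    reassoc_of% resLeg_map t P n₀ φ.τ₃ h₃ rfl k m hm, e₂,
    ← reassoc_of% h₃.syzδ_naturality t k m (m + 1) rfl]
  obtain ⟨u, hu⟩ := IsLift.exists_extension_tail (E := ofRes (P S.X₃)) (E' := ofRes (P S'.X₁))
    (IsLift.comp (E' := ofRes (P S.X₁)) hs h₁)
    (IsLift.comp (IsLift.tail (E := ofRes (P S.X₃)) (E' := ofRes (P S'.X₃)) h₃) hs') key k
  rw [← sub_eq_zero, ← Preadditive.comp_sub, ← Category.assoc, ← Category.assoc,
    ← Functor.map_comp, ← Functor.map_comp, ← Preadditive.sub_comp, ← Functor.map_sub]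
  erw [hu]
  rw [Functor.map_comp, ← Category.assoc, ← Category.assoc]
  erw [sysδ_map_κ t (ofRes (P S.X₃)) k m (m + 1) rfl]
  rw [zero_comp, zero_comp]

end Connecting

lemma Horseshoe.isLift_f {P : ∀ X : C, ProjectiveResolution X} {S : ShortComplex C}
    (H : Horseshoe P S) : IsLift (ofRes (P S.X₁)) (ofHorseshoe H) H.f :=
  fun k => ⟨H.i k, H.i_ρ k, (H.f_κ k).symm⟩

lemma Horseshoe.isLift_g {P : ∀ X : C, ProjectiveResolution X} {S : ShortComplex C}
    (H : Horseshoe P S) : IsLift (ofHorseshoe H) (ofRes (P S.X₃)) H.g :=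
  fun k => ⟨H.p k, (H.ρ_g k).symm, (H.g_ι k).symm⟩

variable {T : ℤ → C ⥤ AddCommGrpCat.{w}} (t : CohStructure T)
  (P : ∀ X : C, ProjectiveResolution X)

section

variable {P} {S : ShortComplex C} (H : Horseshoe P S) (n : ℤ)

/-- Lifts of the isomorphism from the middle term of a horseshoe system. -/
def horseshoeLift (k : ℕ) : H.E k ⟶ syz (P S.X₂) k :=
  liftSeq (ofHorseshoe H) (ofRes (P S.X₂)) H.iso₀.inv k

lemma isLift_horseshoeLift : IsLift (ofHorseshoe H) (ofRes (P S.X₂)) (horseshoeLift H) :=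
  isLift_liftSeq (ofHorseshoe H) (ofRes (P S.X₂)) H.iso₀.inv

/-- The direct limit along the middle column of a horseshoe system is the resolution construction
at the middle term of the short exact sequence. -/
def horseshoeComparison : sysColim t (ofHorseshoe H) n ⟶ (resFunctor t P n).obj S.X₂ :=
  sysDesc t n (E' := ofRes (P S.X₂)) (horseshoeLift H) (isLift_horseshoeLift H)

instance : IsIso (horseshoeComparison t H n) :=
  have : IsIso (horseshoeLift H 0) := inferInstanceAs (IsIso H.iso₀.inv)
  isIso_sysDesc t n (E := ofHorseshoe H) (E' := ofRes (P S.X₂)) (horseshoeLift H)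
    (isLift_horseshoeLift H)

lemma sysLeg_horseshoeComparison (k : ℕ) (m : ℤ) (hm : n + k = m) :
    sysLeg t (ofHorseshoe H) n k m hm ≫ horseshoeComparison t H n =
      (T m).map (horseshoeLift H k) ≫ resLeg t P n k m hm S.X₂ :=
  sysLeg_sysDesc t n (E' := ofRes (P S.X₂)) _ (isLift_horseshoeLift H) k m hm

lemma resLeg_map_f (k : ℕ) (m : ℤ) (hm : n + k = m) :
    resLeg t P n k m hm S.X₁ ≫ (resFunctor t P n).map S.f =
      (T m).map (H.f k) ≫ sysLeg t (ofHorseshoe H) n k m hm ≫ horseshoeComparison t H n := by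
  have e : H.f 0 ≫ H.iso₀.inv = S.f := (Iso.comp_inv_eq H.iso₀).2 H.f_iso₀.symm
  rw [resLeg_map t P n S.f (H.isLift_f.comp (isLift_horseshoeLift H)) e,
    sysLeg_horseshoeComparison, Functor.map_comp, Category.assoc]

lemma sysLeg_comparison_map_g (k : ℕ) (m : ℤ) (hm : n + k = m) :
    sysLeg t (ofHorseshoe H) n k m hm ≫ horseshoeComparison t H n ≫ (resFunctor t P n).map S.g =
      (T m).map (H.g k) ≫ resLeg t P n k m hm S.X₃ := by
  have h' := isSyzLift_syzMap (P S.X₂) (P S.X₃) S.g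
  have e : H.iso₀.inv ≫ S.g = H.g 0 := (Iso.inv_comp_eq H.iso₀).2 H.iso₀_g.symm
  rw [reassoc_of% sysLeg_horseshoeComparison t H n k m hm, resLeg_map t P n S.g h' rfl,
    ← Category.assoc, ← Functor.map_comp]
  exact map_sysLeg_eq t n (E' := ofRes (P S.X₃))
    ((isLift_horseshoeLift H).comp (E'' := ofRes (P S.X₃)) h') H.isLift_g
    ⟨0, (sub_eq_zero.2 e).trans zero_comp.symm⟩ k m hm

/-- Criterion for the exactness of a complex at a direct limit along a syzygy system. -/
lemma exact_of_sysColim {Z : ShortComplex AddCommGrpCat.{w}} {E₂ E₃ : SyzSystem C} {n₂ n₃ : ℤ}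
    {F : ℕ → AddCommGrpCat.{w}} (e₁ : ∀ k, F k ⟶ Z.X₁) (e₂ : sysColim t E₂ n₂ ⟶ Z.X₂) [IsIso e₂]
    (e₃ : sysColim t E₃ n₃ ⟶ Z.X₃) [IsIso e₃] (a : ∀ k : ℕ, F k ⟶ (T (n₂ + k)).obj (E₂.E k))
    (b : ∀ k : ℕ, (T (n₂ + k)).obj (E₂.E k) ⟶ (T (n₃ + k)).obj (E₃.E k))
    (hb : ∀ k : ℕ, sysδ t E₂ k (n₂ + k) (n₂ + (k + 1 : ℕ)) (by push_cast; ring) ≫ b (k + 1) =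
      b k ≫ sysδ t E₃ k (n₃ + k) (n₃ + (k + 1 : ℕ)) (by push_cast; ring))
    (hf : ∀ k, e₁ k ≫ Z.f = a k ≫ sysLeg t E₂ n₂ k _ rfl ≫ e₂)
    (hg : ∀ k, sysLeg t E₂ n₂ k _ rfl ≫ e₂ ≫ Z.g = b k ≫ sysLeg t E₃ n₃ k _ rfl ≫ e₃)
    (h : ∀ (k : ℕ) (y : (T (n₂ + k)).obj (E₂.E k)), b k y = 0 → ∃ z, a k z = y) : Z.Exact := by
  have : Epi (Y := Z.X₂) (X := (colimit.cocone (sysSystem t E₂ n₂)).pt) e₂ :=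
    inferInstanceAs (Epi e₂)
  have : Mono (Y := Z.X₃) (X := (colimit.cocone (sysSystem t E₃ n₃)).pt) e₃ :=
    inferInstanceAs (Mono e₃)
  refine exact_of_isColimit (colimit.isColimit (sysSystem t E₂ n₂))
    (colimit.isColimit (sysSystem t E₃ n₃)) e₁ e₂ e₃ a (sysTrans t t _ _ n₂ n₃ b hb)
    (fun k => ?_) (fun k => ?_) h
  · rw [hf, sysLeg_self]
    rfl
  · have := hg k
    rw [sysLeg_self, sysLeg_self] at this
    exact this

end

/-- The resolution construction is a cohomological functor. Its long exact sequences are the direct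
limits of the long exact sequences of the short exact sequences of a horseshoe system. -/
def resStructure : CohStructure (resFunctor t P) where
  additive := resFunctor_additive t P
  δ _ hS n₀ n₁ h := resConn t P hS n₀ n₁ h
  naturality hS hS' φ n₀ n₁ h := resConn_naturality t P hS hS' φ n₀ n₁ h
  exact₁ S hS n₀ n₁ h := by
    obtain ⟨H⟩ := nonempty_horseshoe P hS
    have w : resConn t P hS n₀ n₁ h ≫ (resFunctor t P n₁).map S.f = 0 :=
      res_hom_ext' t P fun k m hm => by
        have e : n₁ + (k : ℤ) = m + 1 := by lia
        have w := (t.exact₁ _ (H.shortExact k) m (m + 1) rfl).1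
        rw [reassoc_of% resLeg_resConn_horseshoe t P hS H n₀ n₁ h k m (m + 1) hm e rfl,
          Preadditive.zsmul_comp, Category.assoc, resLeg_map_f t H n₁ k (m + 1) e]
        erw [reassoc_of% w]
        rw [zero_comp, smul_zero, comp_zero]
    refine ⟨w, exact_of_sysColim t (E₂ := ofRes (P S.X₁)) (E₃ := ofHorseshoe H)
      (fun k => resLeg t P n₀ k _ rfl S.X₃) (sysColimToRes t P n₁ S.X₁) (horseshoeComparison t H n₁)
      (fun k => (-1 : ℤ) ^ k • t.δ _ (H.shortExact k) (n₀ + k) (n₁ + k) (by lia))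
      (fun k => (T (n₁ + k)).map (H.f k)) (fun _ => H.isLift_f.sysδ_naturality t _ _ _ _)
      (fun k => ?_) (fun k => ?_) (fun k y hy => ?_)⟩
    · rw [sysLeg_sysColimToRes, Preadditive.zsmul_comp]
      exact resLeg_resConn_horseshoe t P hS H n₀ n₁ h k _ (n₁ + k) rfl rfl (by lia)
    · rw [reassoc_of% sysLeg_sysColimToRes t P n₁ k _ rfl]
      exact resLeg_map_f t H n₁ k _ rfl
    · obtain ⟨z, hz⟩ := (ShortComplex.ab_exact_iff _).1
        (t.exact₁ _ (H.shortExact k) (n₀ + k) (n₁ + k) (by lia)).2 y hy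
      exact ⟨(-1 : ℤ) ^ k • z, (map_zsmul (AddCommGrpCat.Hom.hom ((-1 : ℤ) ^ k •
        t.δ _ (H.shortExact k) (n₀ + k) (n₁ + k) (by lia))) _ _).trans
        ((neg_one_pow_smul_smul k _).trans hz)⟩
  exact₂ S hS n := by
    obtain ⟨H⟩ := nonempty_horseshoe P hS
    have := resFunctor_additive t P n
    refine ⟨by rw [← Functor.map_comp, S.zero, Functor.map_zero],
      exact_of_sysColim t (E₂ := ofHorseshoe H) (E₃ := ofRes (P S.X₃))
      (fun k => resLeg t P n k _ rfl S.X₁) (horseshoeComparison t H n)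
      (sysColimToRes t P n S.X₃)
      (fun k => (T (n + k)).map (H.f k)) (fun k => (T (n + k)).map (H.g k))
      (fun _ => H.isLift_g.sysδ_naturality t _ _ _ _)
      (fun k => ?_) (fun k => ?_) (fun k y hy => ?_)⟩
    · exact resLeg_map_f t H n k _ rfl
    · rw [sysLeg_sysColimToRes]
      exact sysLeg_comparison_map_g t H n k _ rfl
    · exact (ShortComplex.ab_exact_iff _).1 (t.exact₂ _ (H.shortExact k) (n + k)).2 y hy
  exact₃ S hS n₀ n₁ h := by
    obtain ⟨H⟩ := nonempty_horseshoe P hS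
    obtain ⟨s, hs, h0, hδ⟩ := H.exists_lift t
    have w : (resFunctor t P n₀).map S.g ≫ resConn t P hS n₀ n₁ h = 0 := by
      rw [← cancel_epi (horseshoeComparison t H n₀)]
      refine sysColim_hom_ext t fun k m hm => ?_
      have e : n₁ + (k : ℤ) = m + 1 := by lia
      have w := (t.exact₃ _ (H.shortExact k) m (m + 1) rfl).1
      rw [reassoc_of% sysLeg_comparison_map_g t H n₀ k m hm,
        resLeg_resConn_horseshoe t P hS H n₀ n₁ h k m (m + 1) hm e rfl, Preadditive.comp_zsmul]
      erw [reassoc_of% w]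
      rw [zero_comp, smul_zero, comp_zero, comp_zero]
    refine ⟨w, exact_of_sysColim t (E₂ := ofRes (P S.X₃)) (E₃ := ofRes (P S.X₁))
      (fun k => sysLeg t (ofHorseshoe H) n₀ k _ rfl ≫ horseshoeComparison t H n₀)
      (sysColimToRes t P n₀ S.X₃) (sysColimToRes t P n₁ S.X₁)
      (fun k => (T (n₀ + k)).map (H.g k))
      (fun k => sysδ t (ofRes (P S.X₃)) k (n₀ + k) (n₁ + k) (by lia) ≫ (T (n₁ + k)).map (s k))
      (sysδ_map_naturality_of_tail t hs n₀ n₁ h)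
      (fun k => ?_) (fun k => ?_) (fun k y hy => ?_)⟩
    · rw [sysLeg_sysColimToRes]
      exact (Category.assoc _ _ _).trans (sysLeg_comparison_map_g t H n₀ k _ rfl)
    · rw [sysLeg_sysColimToRes, reassoc_of% sysLeg_sysColimToRes t P n₀ k _ rfl]
      exact (resLeg_resConn t hS hs h0 n₀ n₁ h k (n₀ + k) (n₁ + k) rfl rfl).trans
        (Category.assoc _ _ _).symm
    · refine (ShortComplex.ab_exact_iff _).1
        (t.exact₃ _ (H.shortExact k) (n₀ + k) (n₁ + k) (by lia)).2 y ?_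
      rw [hδ] at hy
      refine (neg_one_pow_smul_smul k _).symm.trans ((congrArg ((-1 : ℤ) ^ k • ·) hy).trans ?_)
      exact smul_zero _

lemma isResConnecting_resStructure : IsResConnecting t P (resStructure t P) :=
  fun _ hS => ⟨nonempty_horseshoe P hS, fun H n₀ n₁ h k m₀ m₁ h₀ h₁ hm =>
    resLeg_resConn_horseshoe t P hS H n₀ n₁ h k m₀ m₁ h₀ h₁ hm⟩

end ResStructure

/-! ### Functoriality of the resolution construction and its universal property -/

section ResFunctoriality

open SyzSystem

variable {C : Type u} [Category.{v} C] [Abelian C] {T U : ℤ → C ⥤ AddCommGrpCat.{w}}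
  {t : CohStructure T} {t' : CohStructure U} (P : ∀ X : C, ProjectiveResolution X)

/-- The value at `M` of the direct limit of a morphism of cohomological functors at the syzygies. -/
def resMapApp {μ : ∀ n, T n ⟶ U n} (hμ : IsCohMorphism t t' μ) (n : ℤ) (M : C) :
    (resFunctor t P n).obj M ⟶ (resFunctor t' P n).obj M :=
  sysColimMap t t' (ofRes (P M)) (ofRes (P M)) n n (fun k => (μ (n + k)).app (syz (P M) k))
    fun k => hμ _ ((ofRes (P M)).shortExact k) _ _ _

lemma resLeg_resMapApp {μ : ∀ n, T n ⟶ U n} (hμ : IsCohMorphism t t' μ) (n : ℤ) (k : ℕ) (m : ℤ)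
    (hm : n + k = m) (M : C) :
    resLeg t P n k m hm M ≫ resMapApp P hμ n M =
      (μ m).app (syz (P M) k) ≫ resLeg t' P n k m hm M := by
  subst hm
  exact sysLeg_sysColimMap t t' (ofRes (P M)) (ofRes (P M)) n n _ _ k

/-- The direct limit of a morphism of cohomological functors at the syzygies. -/
def resMap {μ : ∀ n, T n ⟶ U n} (hμ : IsCohMorphism t t' μ) (n : ℤ) :
    resFunctor t P n ⟶ resFunctor t' P n where
  app M := resMapApp P hμ n M
  naturality M N f := res_hom_ext' t P fun k m hm => by
    rw [reassoc_of% resLeg_map t P n f (isSyzLift_syzMap (P M) (P N) f) rfl k m hm,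
      resLeg_resMapApp, reassoc_of% resLeg_resMapApp P hμ n k m hm,
      resLeg_map t' P n f (isSyzLift_syzMap (P M) (P N) f) rfl k m hm, NatTrans.naturality_assoc]

lemma resLeg_resMap {μ : ∀ n, T n ⟶ U n} (hμ : IsCohMorphism t t' μ) (n : ℤ) (k : ℕ) (m : ℤ)
    (hm : n + k = m) (M : C) :
    resLeg t P n k m hm M ≫ (resMap P hμ n).app M =
      (μ m).app (syz (P M) k) ≫ resLeg t' P n k m hm M :=
  resLeg_resMapApp P hμ n k m hm M

lemma isCohMorphism_resMap {μ : ∀ n, T n ⟶ U n} (hμ : IsCohMorphism t t' μ) :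
    IsCohMorphism (resStructure t P) (resStructure t' P) (resMap P hμ) :=
  fun S hS n₀ n₁ h => res_hom_ext' t P fun k m hm => by
    obtain ⟨l, hl⟩ := exists_isLiftOfId hS (P S.X₃)
    have hs := isLift_liftSeq (ofRes (P S.X₃)).tail (ofRes (P S.X₁)) l
    have e : n₁ + (k : ℤ) = m + 1 := by lia
    have h₁ : resLeg t P n₀ k m hm S.X₃ ≫ (resStructure t P).δ S hS n₀ n₁ h = _ :=
      resLeg_resConn t hS hs hl n₀ n₁ h k m (m + 1) hm e
    have h₂ : resLeg t' P n₀ k m hm S.X₃ ≫ (resStructure t' P).δ S hS n₀ n₁ h = _ :=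
      resLeg_resConn t' hS hs hl n₀ n₁ h k m (m + 1) hm e
    have h₃ : syzδ t (P S.X₃) k m (m + 1) rfl ≫ (μ (m + 1)).app (syz (P S.X₃) (k + 1)) =
      (μ m).app (syz (P S.X₃) k) ≫ syzδ t' (P S.X₃) k m (m + 1) rfl :=
      hμ _ ((ofRes (P S.X₃)).shortExact k) m (m + 1) rfl
    rw [reassoc_of% h₁, reassoc_of% resLeg_resMap P hμ n₀ k m hm, h₂, resLeg_resMap P hμ]
    refine (congrArg _ (NatTrans.naturality_assoc _ _ _)).trans ?_
    exact (Category.assoc _ _ _).symm.trans ((congrArg (· ≫ _) h₃).trans (Category.assoc _ _ _))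

lemma isIso_resMap {μ : ∀ n, T n ⟶ U n} (hμ : IsCohMorphism t t' μ) [∀ n, IsIso (μ n)] (n : ℤ) :
    IsIso (resMap P hμ n) := by
  refine ⟨resMap P hμ.inv n, ?_, ?_⟩
  · ext M : 2
    refine res_hom_ext' t P fun k m hm => ?_
    rw [NatTrans.comp_app, reassoc_of% resLeg_resMap P hμ n k m hm, resLeg_resMap P hμ.inv]
    simp
  · ext M : 2
    refine res_hom_ext' t' P fun k m hm => ?_
    rw [NatTrans.comp_app, reassoc_of% resLeg_resMap P hμ.inv n k m hm, resLeg_resMap P hμ]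
    simp

variable (t)

/-- The canonical morphism from a cohomological functor to its resolution construction. -/
def resUnit (n : ℤ) : T n ⟶ resFunctor t P n where
  app M := resLeg t P n 0 n (add_zero n) M
  naturality M N f :=
    (resLeg_map t P n f (isSyzLift_syzMap (P M) (P N) f) rfl 0 n (add_zero n)).symm

lemma isCohMorphism_resUnit : IsCohMorphism t (resStructure t P) (resUnit t P) :=
  fun S hS n₀ n₁ h => by
    obtain ⟨l, hl⟩ := exists_isLiftOfId hS (P S.X₃)
    have hs := isLift_liftSeq (ofRes (P S.X₃)).tail (ofRes (P S.X₁)) l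
    have h₁ : (resUnit t P n₀).app S.X₃ ≫ (resStructure t P).δ S hS n₀ n₁ h =
        syzδ t (P S.X₃) 0 n₀ n₁ h ≫ (T n₁).map l ≫ (resUnit t P n₁).app S.X₁ :=
      resLeg_resConn t hS hs hl n₀ n₁ h 0 n₀ n₁ (add_zero _) (add_zero _)
    exact (congrArg (· ≫ _) (syzδ_map_of_isLiftOfId t hS hl n₀ n₁ h).symm).trans
      ((Category.assoc _ _ _).trans h₁.symm)

lemma vanishesOnProjectives_res : VanishesOnProjectives (resFunctor t P) := fun n Q hQ => by
  rw [IsZero.iff_id_eq_zero]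
  refine res_hom_ext' t P fun k m hm => ?_
  have := t.additive m
  let π : (P Q).complex.X 0 ⟶ Q := syzπ (P Q) 0
  have : Epi π := syzπ_epi (P Q) 0
  let u : Q ⟶ (P Q).complex.X 0 := Projective.factorThru (𝟙 Q) π
  have hu : 𝟙 Q = u ≫ π := (Projective.factorThru_comp (𝟙 Q) π).symm
  have h : (T m).map (𝟙 (syz (P Q) k)) ≫ resLeg t P n k m hm Q =
      (T m).map 0 ≫ resLeg t P n k m hm Q :=
    map_sysLeg_eq t n (isLift_id (ofRes (P Q))) (isLift_zero _ (ofRes (P Q)))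
      ⟨u, (sub_zero (𝟙 Q)).trans hu⟩ k m hm
  rw [CategoryTheory.Functor.map_id, CategoryTheory.Functor.map_zero, Category.id_comp,
    zero_comp] at h
  rw [Category.comp_id, comp_zero]
  exact h

lemma isIso_map_of_isIso_succ {D : Type*} [Category* D] (F : ℕ ⥤ D)
    (h : ∀ k, IsIso (F.map (homOfLE (Nat.le_add_right k 1)))) {i j : ℕ} (f : i ⟶ j) :
    IsIso (F.map f) := by
  obtain ⟨l, rfl⟩ := Nat.exists_eq_add_of_le (leOfHom f)
  induction l with
  | zero =>
    obtain rfl := Subsingleton.elim f (𝟙 i)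
    infer_instance
  | succ l ih =>
    obtain rfl := Subsingleton.elim f
      (homOfLE (Nat.le_add_right i l) ≫ homOfLE (Nat.le_add_right (i + l) 1))
    have := ih (homOfLE (Nat.le_add_right i l))
    have := h (i + l)
    rw [F.map_comp]
    infer_instance

/-- For functors vanishing on projectives the connecting homomorphisms of syzygy sequences are
isomorphisms. -/
lemma isIso_syzδ (hT : VanishesOnProjectives T) {X : C} (R : ProjectiveResolution X) (k : ℕ)
    (n₀ n₁ : ℤ) (h : n₀ + 1 = n₁) : IsIso (syzδ t R k n₀ n₁ h) := by
  have hQ := R.projective k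
  have h₁ := (t.exact₃ _ (syzSES_shortExact R k) n₀ n₁ h).2.mono_g
    ((hT n₀ _ hQ).eq_of_src _ _)
  have h₂ := (t.exact₁ _ (syzSES_shortExact R k) n₀ n₁ h).2.epi_f ((hT n₁ _ hQ).eq_of_tgt _ _)
  have h₁ : Mono (syzδ t R k n₀ n₁ h) := h₁
  have h₂ : Epi (syzδ t R k n₀ n₁ h) := h₂
  exact isIso_of_mono_of_epi _

lemma isIso_resUnit (hT : VanishesOnProjectives T) (n : ℤ) : IsIso (resUnit t P n) := by
  rw [NatTrans.isIso_iff_isIso_app]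
  intro M
  have (i j : ℕ) (f : i ⟶ j) : IsIso ((resSystem t P n M).map f) :=
    isIso_map_of_isIso_succ _ (fun k => by
      have := isIso_syzδ t hT (P M) k (n + k) (n + (k + 1 : ℕ)) (by push_cast; ring)
      exact (sysSystem_map_succ t (ofRes (P M)) n k).symm ▸ this) f
  have h₁ : IsIso (colimit.ι (resSystem t P n M) (0 : ℕ)) :=
    isIso_ι_of_isInitial (IsInitial.ofUniqueHom (fun k => homOfLE (Nat.zero_le k))
      fun _ _ => Subsingleton.elim _ _) _
  change IsIso (resLeg t P n 0 n (add_zero n) M)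
  have h₂ : IsIso (resι t P n 0 M) := h₁
  unfold resLeg
  exact IsIso.comp_isIso' inferInstance h₂

variable {P} in
/-- A morphism from the resolution construction to a cohomological functor vanishing on projectives
is determined by its composition with the canonical morphism: on the `k`-th leg at `M` this follows
by induction on `k`, since the connecting homomorphism to the first syzygy of `M` is injective on
the target and lowers `k`. -/
lemma res_hom_unique {s : CohStructure U} (hU : VanishesOnProjectives U)
    {κ κ' : ∀ n, resFunctor t P n ⟶ U n} (hκ : IsCohMorphism (resStructure t P) s κ)
    (hκ' : IsCohMorphism (resStructure t P) s κ')
    (h : ∀ n, resUnit t P n ≫ κ n = resUnit t P n ≫ κ' n) : κ = κ' := by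
  have key : ∀ (k : ℕ) (n m : ℤ) (hm : n + k = m) (M : C),
      resLeg t P n k m hm M ≫ (κ n).app M = resLeg t P n k m hm M ≫ (κ' n).app M := by
    intro k
    induction k with
    | zero =>
      intro n m hm M
      obtain rfl : n = m := by simpa using hm
      exact congrArg (fun τ => τ.app M) (h n)
    | succ k ih =>
      intro n m hm M
      have hS := syzSES_shortExact (P M) 0
      have := isIso_syzδ s hU (P M) 0 n (n + 1) rfl
      have hl : IsLiftOfId (syzSES (P M) 0) (P M) (𝟙 (syz (P M) 1)) :=
        ⟨𝟙 _, Category.id_comp _, (Category.comp_id _).trans (Category.id_comp _).symm⟩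
      have hs := isLift_liftSeq (ofRes (P M)).tail (ofRes (P (syz (P M) 1))) (𝟙 (syz (P M) 1))
      have e : n + 1 + (k : ℤ) = m := by push_cast at hm; lia
      have h₁ : resLeg t P n (k + 1) m hm M ≫
          (resStructure t P).δ (syzSES (P M) 0) hS n (n + 1) rfl = _ :=
        resLeg_succ_resConn (S := syzSES (P M) 0) t hS hs hl n (n + 1) rfl k m hm e
      have h₂ : _ ≫ (κ (n + 1)).app (syz (P M) 1) = (κ n).app M ≫ syzδ s (P M) 0 n (n + 1) rfl :=
        hκ (syzSES (P M) 0) hS n (n + 1) rfl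
      have h₂' : _ ≫ (κ' (n + 1)).app (syz (P M) 1) =
          (κ' n).app M ≫ syzδ s (P M) 0 n (n + 1) rfl :=
        hκ' (syzSES (P M) 0) hS n (n + 1) rfl
      let d : (U n).obj M ⟶ (U (n + 1)).obj (syz (P M) 1) := syzδ s (P M) 0 n (n + 1) rfl
      have : Mono d := inferInstanceAs (Mono (syzδ s (P M) 0 n (n + 1) rfl))
      refine (cancel_mono d).1 ((Category.assoc _ _ _).trans
        (Eq.trans ?_ (Category.assoc _ _ _).symm))
      refine (congrArg _ h₂.symm).trans (Eq.trans ?_ (congrArg _ h₂'))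
      refine (Category.assoc _ _ _).symm.trans (Eq.trans ?_ (Category.assoc _ _ _))
      refine (congrArg (· ≫ _) h₁).trans (Eq.trans ?_ (congrArg (· ≫ _) h₁).symm)
      exact (Category.assoc _ _ _).trans ((congrArg _ (ih (n + 1) m e (syz (P M) 1))).trans
        (Category.assoc _ _ _).symm)
  funext n
  ext M : 2
  exact res_hom_ext' t P fun k m hm => key k n m hm M

/-- The resolution construction is the Mislin completion. -/
lemma isMislinCompletion_res : IsMislinCompletion t (resStructure t P) (resUnit t P) := by
  refine ⟨isCohMorphism_resUnit t P, vanishesOnProjectives_res t P, fun V r hV μ hμ => ?_⟩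
  have := isIso_resUnit r P hV
  have hκ := (isCohMorphism_resMap P hμ).comp (isCohMorphism_resUnit r P).inv
  have hκ' (n : ℤ) : resUnit t P n ≫ resMap P hμ n ≫ inv (resUnit r P n) = μ n := by
    rw [← Category.assoc, IsIso.comp_inv_eq]
    ext M : 2
    exact resLeg_resMap P hμ n 0 n (add_zero n) M
  exact ⟨_, ⟨hκ, hκ'⟩, fun κ' h => res_hom_unique t hV h.1 hκ fun n => (h.2 n).trans (hκ' n).symm⟩

end ResFunctoriality

/-! ### The satellite functor construction -/

section Sat

open SyzSystem

variable {C : Type u} [Category.{v} C] [Abelian C]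

section General

variable {D : Type u'} [Category.{v'} D] [Abelian D] (P : ∀ X : C, ProjectiveResolution X)

lemma satι_map_eq (F : C ⥤ D) [F.Additive] {M N : C} {f g : syz (P M) 1 ⟶ N}
    (h : ∃ u : (P M).complex.X 0 ⟶ N, f - g = syzι (P M) 0 ≫ u) :
    satι P F M ≫ F.map f = satι P F M ≫ F.map g := by
  obtain ⟨u, hu⟩ := h
  rw [← sub_eq_zero, ← Preadditive.comp_sub, ← Functor.map_sub, hu, Functor.map_comp,
    reassoc_of% satι_comp P F M, zero_comp]

lemma satε_naturality (F : C ⥤ D) [F.Additive] {S S' : ShortComplex C} (hS' : S'.ShortExact)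
    (φ : S ⟶ S') {l : syz (P S.X₃) 1 ⟶ S.X₁} (hl : IsLiftOfId S (P S.X₃) l)
    {l' : syz (P S'.X₃) 1 ⟶ S'.X₁} (hl' : IsLiftOfId S' (P S'.X₃) l') :
    satε P F S l ≫ F.map φ.τ₁ = (satOne P F).map φ.τ₃ ≫ satε P F S' l' := by
  unfold satε
  rw [Category.assoc, ← Functor.map_comp, reassoc_of% map_satι, ← Functor.map_comp]
  exact satι_map_eq P F (exists_extension_of_isLiftOfId hS' φ hl hl'
    (isSyzLift_syzMap (P S.X₃) (P S'.X₃) φ.τ₃) rfl)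

lemma satOneMap_satε {F G : C ⥤ D} [F.Additive] [G.Additive] (φ : F ⟶ G) (S : ShortComplex C)
    (l : syz (P S.X₃) 1 ⟶ S.X₁) :
    (satOneMap P φ).app S.X₃ ≫ satε P G S l = satε P F S l ≫ φ.app S.X₁ := by
  unfold satε
  have : (satOneMap P φ).app S.X₃ ≫ satι P G S.X₃ = satι P F S.X₃ ≫ φ.app (syz (P S.X₃) 1) :=
    satLift_ι P G _ _
  rw [reassoc_of% this, ← φ.naturality, Category.assoc]

/-- The satellite vanishes on projectives, since `syz_1 ⟶ R_0` is split for a projective. -/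
lemma isZero_satOne (F : C ⥤ D) [F.Additive] (Q : C) [Projective Q] :
    IsZero ((satOne P F).obj Q) := by
  let π : (P Q).complex.X 0 ⟶ Q := syzπ (P Q) 0
  have : Epi π := syzπ_epi (P Q) 0
  let u : Q ⟶ (P Q).complex.X 0 := Projective.factorThru (𝟙 Q) π
  have hu : u ≫ π = 𝟙 Q := Projective.factorThru_comp (𝟙 Q) π
  have h0 : (𝟙 _ - π ≫ u) ≫ syzπ (P Q) 0 = 0 := by
    rw [Preadditive.sub_comp, Category.id_comp, Category.assoc]
    refine sub_eq_zero.2 ?_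
    exact (Category.comp_id π).symm.trans (congrArg (π ≫ ·) hu.symm)
  have h1 : 𝟙 (syz (P Q) 1) - 0 = syzι (P Q) 0 ≫ syzLift (P Q) 0 _ h0 := by
    rw [← cancel_mono (syzι (P Q) 0), Category.assoc, syzLift_ι, sub_zero, Category.id_comp,
      Preadditive.comp_sub, Category.comp_id]
    have : syzι (P Q) 0 ≫ π = 0 := syzι_π (P Q) 0
    rw [reassoc_of% this, zero_comp, sub_zero]
  have h2 := satι_map_eq P F ⟨_, h1⟩
  rw [CategoryTheory.Functor.map_id, Category.comp_id, CategoryTheory.Functor.map_zero,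
    comp_zero] at h2
  rw [IsZero.iff_id_eq_zero, ← cancel_mono (satι P F Q), Category.id_comp, zero_comp, h2]

/-- The `k`-th short exact sequence of a syzygy system. -/
abbrev SyzSystem.ses (E : SyzSystem C) (k : ℕ) : ShortComplex C :=
  ShortComplex.mk (E.κ k) (E.ρ k) (E.zero k)

/-- Lifts of the identities of the terms of a syzygy system to morphisms from the chosen
resolutions of these terms. -/
def IsIdLift (E : SyzSystem C) (h : ∀ k, syz (P (E.E k)) 1 ⟶ E.E (k + 1)) : Prop :=
  ∀ k, IsLiftOfId (E.ses k) (P (E.E k)) (h k)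

/-- The connecting homomorphism `S^{-(l + 1)}F(E k) ⟶ S^{-l}F(E (k + 1))`. -/
def sysε (F : C ⥤ D) (hF : F.Additive) (E : SyzSystem C)
    (h : ∀ k, syz (P (E.E k)) 1 ⟶ E.E (k + 1)) (l k : ℕ) :
    (sat P F hF (l + 1)).obj (E.E k) ⟶ (sat P F hF l).obj (E.E (k + 1)) :=
  satε P (sat P F hF l) (E.ses k) (h k)

/-- The composite `S^{-l}F(E k) ⟶ S^{-l + 1}F(E (k + 1)) ⟶ … ⟶ F(E (k + l))`. -/
def sysChain (F : C ⥤ D) (hF : F.Additive) (E : SyzSystem C)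
    (h : ∀ k, syz (P (E.E k)) 1 ⟶ E.E (k + 1)) :
    ∀ (l k K : ℕ), k + l = K → ((sat P F hF l).obj (E.E k) ⟶ F.obj (E.E K))
  | 0, _, _, e => eqToHom (congrArg (fun j => F.obj (E.E j)) e)
  | l + 1, k, K, e => sysε P F hF E h l k ≫ sysChain F hF E h l (k + 1) K (by omega)

variable (F : C ⥤ D) (hF : F.Additive)

lemma sysChain_succ (E : SyzSystem C) (h : ∀ k, syz (P (E.E k)) 1 ⟶ E.E (k + 1)) (l k K : ℕ)
    (e : k + (l + 1) = K) : sysChain P F hF E h (l + 1) k K e =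
      sysε P F hF E h l k ≫ sysChain P F hF E h l (k + 1) K (by omega) := rfl

variable {P} in
lemma sysε_naturality {E E' : SyzSystem C} {h : ∀ k, syz (P (E.E k)) 1 ⟶ E.E (k + 1)}
    (hh : IsIdLift P E h) {h' : ∀ k, syz (P (E'.E k)) 1 ⟶ E'.E (k + 1)} (hh' : IsIdLift P E' h')
    {s : ∀ k, E.E k ⟶ E'.E k} (hs : IsLift E E' s) (l k : ℕ) :
    sysε P F hF E h l k ≫ (sat P F hF l).map (s (k + 1)) =
      (sat P F hF (l + 1)).map (s k) ≫ sysε P F hF E' h' l k := by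
  obtain ⟨g, h₁, h₂⟩ := hs k
  exact satε_naturality P (sat P F hF l) (E'.shortExact k)
    { τ₁ := s (k + 1), τ₂ := g, τ₃ := s k, comm₁₂ := h₂.symm, comm₂₃ := h₁ } (hh k) (hh' k)

lemma satTrans_sysε {F G : C ⥤ D} (hF : F.Additive) (hG : G.Additive) (φ : F ⟶ satOne P G)
    (E : SyzSystem C) (h : ∀ k, syz (P (E.E k)) 1 ⟶ E.E (k + 1)) (l k : ℕ) :
    (satTrans P hF hG φ (l + 1)).app (E.E k) ≫ sysε P G hG E h (l + 1) k =
      sysε P F hF E h l k ≫ (satTrans P hF hG φ l).app (E.E (k + 1)) :=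
  satOneMap_satε P (satTrans P hF hG φ l) (E.ses k) (h k)

lemma satChain_eq_sysChain (M : C) (h : ∀ k, syz (P (syz (P M) k)) 1 ⟶ syz (P M) (k + 1)) :
    ∀ l k K e, satChain P F hF M h l k K e = sysChain P F hF (ofRes (P M)) h l k K e
  | 0, _, _, _ => rfl
  | l + 1, k, K, _ => congrArg (satε P (sat P F hF l) (syzSES (P M) k) (h k) ≫ ·)
      (satChain_eq_sysChain M h l (k + 1) K _)

lemma sysChain_tail (E : SyzSystem C) (h : ∀ k, syz (P (E.E k)) 1 ⟶ E.E (k + 1)) :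
    ∀ l k K e, sysChain P F hF E h l (k + 1) (K + 1) (by omega) =
      sysChain P F hF E.tail (fun k => h (k + 1)) l k K e
  | 0, _, _, _ => rfl
  | l + 1, k, K, _ => congrArg (satε P (sat P F hF l) (E.ses (k + 1)) (h (k + 1)) ≫ ·)
      (sysChain_tail E h l (k + 1) K _)

lemma sysChain_naturality {E E' : SyzSystem C} {h : ∀ k, syz (P (E.E k)) 1 ⟶ E.E (k + 1)}
    (hh : IsIdLift P E h) {h' : ∀ k, syz (P (E'.E k)) 1 ⟶ E'.E (k + 1)} (hh' : IsIdLift P E' h')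
    {s : ∀ k, E.E k ⟶ E'.E k} (hs : IsLift E E' s) : ∀ l k K e,
    sysChain P F hF E h l k K e ≫ F.map (s K) =
      (sat P F hF l).map (s k) ≫ sysChain P F hF E' h' l k K e
  | 0, _, _, rfl => (Category.id_comp _).trans (Category.comp_id _).symm
  | l + 1, k, K, e => by
    rw [sysChain_succ, sysChain_succ, Category.assoc, sysChain_naturality hh hh' hs l (k + 1) K,
      reassoc_of% sysε_naturality F hF hh hh' hs l k]

lemma satTrans_sysChain {F G : C ⥤ D} (hF : F.Additive) (hG : G.Additive) (φ : F ⟶ satOne P G)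
    (E : SyzSystem C) (h : ∀ k, syz (P (E.E k)) 1 ⟶ E.E (k + 1)) : ∀ l k K (e : k + l = K),
    (satTrans P hF hG φ l).app (E.E k) ≫ sysChain P G hG E h (l + 1) k (K + 1) (by omega) =
      sysChain P F hF E h l k K e ≫ φ.app (E.E K) ≫ satε P G (E.ses K) (h K)
  | 0, k, _, rfl => by
    refine (congrArg (φ.app (E.E k) ≫ ·) (Category.comp_id _)).trans ?_
    exact (Category.id_comp _).symm
  | l + 1, k, K, e => by
    rw [sysChain_succ, sysChain_succ P F, Category.assoc,
      ← satTrans_sysChain hF hG φ E h l (k + 1) K (by omega), reassoc_of% satTrans_sysε]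

lemma satδ_satε {T : ℤ → C ⥤ D} (t : CohStructure T) {S : ShortComplex C} (hS : S.ShortExact)
    {l : syz (P S.X₃) 1 ⟶ S.X₁} (hl : IsLiftOfId S (P S.X₃) l) (n₀ n₁ : ℤ) (h : n₀ + 1 = n₁) :
    letI := t.additive n₁
    (satδ P t n₀ n₁ h).app S.X₃ ≫ satε P (T n₁) S l = t.δ S hS n₀ n₁ h := by
  have := t.additive n₁
  exact (Category.assoc _ _ _).symm.trans ((congrArg (· ≫ _) (satLift_ι P (T n₁) _ _)).trans
    (syzδ_map_of_isLiftOfId t hS hl n₀ n₁ h))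

/-- If the middle term is projective, the lift of the identity is invertible up to morphisms which
extend to the projectives. -/
lemma IsLiftOfId.exists_inverse {S : ShortComplex C} (hS : S.ShortExact) [Projective S.X₂]
    {R : ProjectiveResolution S.X₃} {l : syz R 1 ⟶ S.X₁} (hl : IsLiftOfId S R l) :
    ∃ (l' : S.X₁ ⟶ syz R 1) (c' : S.X₂ ⟶ R.complex.X 0), S.f ≫ c' = l' ≫ syzι R 0 ∧
      (∃ u : R.complex.X 0 ⟶ syz R 1, l ≫ l' - 𝟙 _ = syzι R 0 ≫ u) ∧
      ∃ u : S.X₂ ⟶ S.X₁, l' ≫ l - 𝟙 _ = S.f ≫ u := by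
  obtain ⟨c, hc, hc'⟩ := hl
  let π : R.complex.X 0 ⟶ S.X₃ := syzπ R 0
  have : Epi π := syzπ_epi R 0
  let c' : S.X₂ ⟶ R.complex.X 0 := Projective.factorThru S.g π
  have hc₁ : c' ≫ π = S.g := Projective.factorThru_comp S.g π
  have h0 : (S.f ≫ c') ≫ syzπ R 0 = 0 := by
    rw [Category.assoc]
    exact (congrArg (S.f ≫ ·) hc₁).trans S.zero
  have hl' := syzLift_ι R 0 _ h0
  refine ⟨syzLift R 0 _ h0, c', hl'.symm, ?_, ?_⟩
  · refine exists_extension_of_lifts (syzSES_shortExact R 0) (syzι R 0) (c := c ≫ c') (c' := 𝟙 _)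
      ?_ ?_ ?_
    · exact (Category.assoc _ _ _).symm.trans ((congrArg (· ≫ c') hc').trans
        ((Category.assoc _ _ _).trans ((congrArg (l ≫ ·) hl'.symm).trans
          (Category.assoc _ _ _).symm)))
    · exact (Category.comp_id _).trans (Category.id_comp _).symm
    · exact (Category.assoc _ _ _).trans ((congrArg (c ≫ ·) hc₁).trans
        (hc.trans (Category.id_comp _).symm))
  · refine exists_extension_of_lifts hS S.f (c := c' ≫ c) (c' := 𝟙 _) ?_ ?_ ?_
    · rw [Category.assoc, ← hc', reassoc_of% hl']
    · exact (Category.comp_id _).trans (Category.id_comp _).symm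
    · rw [Category.assoc, hc]
      exact hc₁.trans (Category.id_comp _).symm

lemma mono_satε (F : C ⥤ D) [F.Additive] {S : ShortComplex C} (hS : S.ShortExact)
    [Projective S.X₂] {l : syz (P S.X₃) 1 ⟶ S.X₁} (hl : IsLiftOfId S (P S.X₃) l) :
    Mono (satε P F S l) := by
  obtain ⟨l', c', -, hu, -⟩ := hl.exists_inverse hS
  have h := satι_map_eq P F hu
  rw [CategoryTheory.Functor.map_id, Category.comp_id, Functor.map_comp] at h
  have : satε P F S l ≫ F.map l' = satι P F S.X₃ := (Category.assoc _ _ _).trans h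
  exact mono_of_mono_fac this

lemma mono_sysChain {E : SyzSystem C} {h : ∀ k, syz (P (E.E k)) 1 ⟶ E.E (k + 1)}
    (hh : IsIdLift P E h) : ∀ l k K e, Mono (sysChain P F hF E h l k K e)
  | 0, _, _, rfl => inferInstanceAs (Mono (𝟙 _))
  | l + 1, k, K, e => by
    have := mono_sysChain hh l (k + 1) K (by omega)
    have : Projective (E.ses k).X₂ := E.projective k
    have : Mono (sysε P F hF E h l k) := mono_satε P (sat P F hF l) (E.shortExact k) (hh k)
    rw [sysChain_succ]
    exact mono_comp _ _

end General

variable (P : ∀ X : C, ProjectiveResolution X)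

lemma exists_satε_eq (F : C ⥤ AddCommGrpCat.{w}) [F.Additive] {S : ShortComplex C}
    (hS : S.ShortExact) [Projective S.X₂] {l : syz (P S.X₃) 1 ⟶ S.X₁}
    (hl : IsLiftOfId S (P S.X₃) l) (z : F.obj S.X₁) (hz : F.map S.f z = 0) :
    ∃ x, satε P F S l x = z := by
  obtain ⟨l', c', hc', -, u, hu⟩ := hl.exists_inverse hS
  have h1 : F.map (syzι (P S.X₃) 0) (F.map l' z) = 0 := by
    have := ConcreteCategory.congr_hom (congrArg F.map hc') z
    rw [Functor.map_comp, Functor.map_comp] at this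
    exact this.symm.trans ((congrArg (F.map c') hz).trans (map_zero _))
  have hex := (ShortComplex.ab_exact_iff _).1
    (ShortComplex.exact_of_f_is_kernel (ShortComplex.mk _ _ (satι_comp P F S.X₃))
      (kernelIsKernel _)) (F.map l' z) h1
  obtain ⟨x, hx⟩ := hex
  refine ⟨x, ?_⟩
  have h2 : satε P F S l x = F.map l (F.map l' z) := congrArg (F.map l) hx
  rw [h2]
  have h3 : F.map (l' ≫ l) = F.map (𝟙 _) + F.map S.f ≫ F.map u := by
    rw [← Functor.map_comp, ← Functor.map_add, ← hu, add_sub_cancel]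
  rw [CategoryTheory.Functor.map_id, Functor.map_comp] at h3
  refine (ConcreteCategory.congr_hom h3 z).trans ?_
  change z + F.map u (F.map S.f z) = z
  rw [hz, map_zero, add_zero]

/-- The image of the composite of the `S^{-l}F(E k) ⟶ F(E (k + l))` contains the kernel of
`F(E (k + l)) ⟶ F(Q (k + l - 1))` for `l ≥ 1`, since satellites vanish on projectives. -/
lemma exists_sysChain_eq (F : C ⥤ AddCommGrpCat.{w}) (hF : F.Additive) {E : SyzSystem C}
    {h : ∀ k, syz (P (E.E k)) 1 ⟶ E.E (k + 1)} (hh : IsIdLift P E h) :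
    ∀ (l k K : ℕ) (e : k + (l + 1) = K + 1) (z : F.obj (E.E (K + 1))), F.map (E.κ K) z = 0 →
      ∃ x, sysChain P F hF E h (l + 1) k (K + 1) e x = z
  | 0, k, K, e, z, hz => by
    obtain rfl : k = K := by omega
    have : Projective (E.ses k).X₂ := E.projective k
    obtain ⟨x, hx⟩ := exists_satε_eq P F (E.shortExact k) (hh k) z hz
    exact ⟨x, hx⟩
  | l + 1, k, K, e, z, hz => by
    obtain ⟨y, hy⟩ := exists_sysChain_eq F hF hh l (k + 1) K (by omega) z hz
    have : Projective (E.ses k).X₂ := E.projective k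
    have h0 : (sat P F hF (l + 1)).map (E.ses k).f y = 0 := by
      have hz := (isZero_satOne P (sat P F hF l) (E.ses k).X₂).eq_of_tgt
        ((sat P F hF (l + 1)).map (E.ses k).f) 0
      rw [hz]
      rfl
    obtain ⟨x, hx⟩ := exists_satε_eq P (sat P F hF (l + 1)) (E.shortExact k) (hh k) y h0
    exact ⟨x, (congrArg _ hx).trans hy⟩

end Sat

/-! ### Comparison of the satellite functor and the resolution constructions -/

section SatComparison

open SyzSystem

/-- A morphism between sequential colimits of abelian groups is an isomorphism if it is induced by
injective morphisms whose images contain the images of the transition maps. -/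
lemma isIso_of_isColimit {F G : ℕ ⥤ AddCommGrpCat.{w}} {c : Cocone F} (hc : IsColimit c)
    {d : Cocone G} (hd : IsColimit d) (α : F ⟶ G) (f : c.pt ⟶ d.pt)
    (hf : ∀ k, c.ι.app k ≫ f = α.app k ≫ d.ι.app k)
    (hinj : ∀ k, Function.Injective (α.app k))
    (hsurj : ∀ (k : ℕ) (y : G.obj k), ∃ x : F.obj (k + 1),
      α.app (k + 1) x = G.map (homOfLE (Nat.le_add_right k 1)) y) : IsIso f := by
  refine (ConcreteCategory.isIso_iff_bijective f).2 ⟨?_, fun y => ?_⟩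
  · refine (injective_iff_map_eq_zero (AddCommGrpCat.Hom.hom f)).2 fun x hx => ?_
    obtain ⟨k, x, rfl⟩ := Concrete.isColimit_exists_rep F hc x
    have h0 : d.ι.app k (α.app k x) = 0 := (ConcreteCategory.congr_hom (hf k) x).symm.trans hx
    obtain ⟨l, g, hl⟩ := exists_map_eq_zero_of_isColimit hd _ h0
    have h1 : α.app l (F.map g x) = α.app l 0 := by
      rw [map_zero, ← hl]
      exact ConcreteCategory.congr_hom (α.naturality g) x
    have h2 := hinj l h1
    have h3 : c.ι.app l (F.map g x) = c.ι.app k x := ConcreteCategory.congr_hom (c.w g) x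
    rw [← h3, h2, map_zero]
  · obtain ⟨k, y, rfl⟩ := Concrete.isColimit_exists_rep G hd y
    obtain ⟨x, hx⟩ := hsurj k y
    refine ⟨c.ι.app (k + 1) x, (ConcreteCategory.congr_hom (hf (k + 1)) x).trans ?_⟩
    refine (congrArg (d.ι.app (k + 1)) hx).trans ?_
    exact ConcreteCategory.congr_hom (d.w _) y

variable {C : Type u} [Category.{v} C] [Abelian C] {T : ℤ → C ⥤ AddCommGrpCat.{w}}
  (P : ∀ X : C, ProjectiveResolution X) (t : CohStructure T)

lemma exists_isIdLift (M : C) : ∃ h, IsIdLift P (ofRes (P M)) h :=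
  ⟨fun k => (exists_isLiftOfId (syzSES_shortExact (P M) k) (P (syz (P M) k))).choose,
    fun k => (exists_isLiftOfId (syzSES_shortExact (P M) k) (P (syz (P M) k))).choose_spec⟩

/-- The morphism `S^{-k}F(M) ⟶ F(syz_k M)` for an arbitrary choice of lifts. -/
def satToSyz (F : C ⥤ AddCommGrpCat.{w}) (hF : F.Additive) (k : ℕ) (M : C) :
    (sat P F hF k).obj M ⟶ F.obj (syz (P M) k) :=
  sysChain P F hF (ofRes (P M)) (exists_isIdLift P M).choose k 0 k (Nat.zero_add k)

variable {P}

/-- The morphism `S^{-k}F(M) ⟶ F(syz_k M)` is independent of the choice of lifts. -/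
lemma satToSyz_eq (F : C ⥤ AddCommGrpCat.{w}) (hF : F.Additive) (k : ℕ) {M : C}
    {h : ∀ k, syz (P (syz (P M) k)) 1 ⟶ syz (P M) (k + 1)} (hh : IsIdLift P (ofRes (P M)) h) :
    satToSyz P F hF k M = sysChain P F hF (ofRes (P M)) h k 0 k (Nat.zero_add k) := by
  have := sysChain_naturality P F hF (exists_isIdLift P M).choose_spec hh (isLift_id _) k 0 k
    (Nat.zero_add k)
  rw [CategoryTheory.Functor.map_id, Category.comp_id, CategoryTheory.Functor.map_id,
    Category.id_comp] at this
  exact this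

lemma satToSyz_naturality (F : C ⥤ AddCommGrpCat.{w}) (hF : F.Additive) (k : ℕ) {M N : C}
    (f : M ⟶ N) {s : ∀ k, syz (P M) k ⟶ syz (P N) k} (hs : IsSyzLift (P M) (P N) s)
    (h0 : s 0 = f) : satToSyz P F hF k M ≫ F.map (s k) =
      (sat P F hF k).map f ≫ satToSyz P F hF k N := by
  subst h0
  exact sysChain_naturality P F hF (E := ofRes (P M)) (E' := ofRes (P N))
    (exists_isIdLift P M).choose_spec (exists_isIdLift P N).choose_spec hs k 0 k (Nat.zero_add k)

lemma satTrans_satToSyz (n₀ n₁ : ℤ) (h : n₀ + 1 = n₁) (k : ℕ) (M : C) :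
    letI := t.additive n₁
    (satTrans P (t.additive n₀) (t.additive n₁) (satδ P t n₀ n₁ h) k).app M ≫
      satToSyz P (T n₁) (t.additive n₁) (k + 1) M =
        satToSyz P (T n₀) (t.additive n₀) k M ≫ syzδ t (P M) k n₀ n₁ h := by
  have := t.additive n₁
  have h₁ := satTrans_sysChain P (t.additive n₀) (t.additive n₁) (satδ P t n₀ n₁ h) (ofRes (P M))
    (exists_isIdLift P M).choose k 0 k (Nat.zero_add k)
  have h₂ := satδ_satε P t (syzSES_shortExact (P M) k) ((exists_isIdLift P M).choose_spec k) n₀ n₁ h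
  exact h₁.trans (congrArg (satToSyz P (T n₀) (t.additive n₀) k M ≫ ·) h₂)

lemma satSystem_map_succ (n : ℤ) (k : ℕ) :
    (satSystem P t n).map (homOfLE (Nat.le_add_right k 1)) =
      satTrans P (t.additive _) (t.additive _)
        (satδ P t (n + k) (n + (k + 1 : ℕ)) (by push_cast; ring)) k :=
  Functor.ofSequence_map_homOfLE_succ _ _

/-- The morphisms `S^{-k}T^{n + k}(M) ⟶ T^{n + k}(syz_k M)` form a morphism of direct systems. -/
def satSystemToSys (n : ℤ) (M : C) :
    satSystem P t n ⋙ (evaluation C AddCommGrpCat.{w}).obj M ⟶ sysSystem t (ofRes (P M)) n :=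
  NatTrans.ofSequence (fun k : ℕ => satToSyz P (T (n + k)) (t.additive _) k M) fun k => by
    have h₁ := satTrans_satToSyz (P := P) t (n + k) (n + (k + 1 : ℕ)) (by push_cast; ring) k M
    have h₂ := sysSystem_map_succ t (ofRes (P M)) n k
    have h₃ := congrArg (fun τ => τ.app M) (satSystem_map_succ (P := P) t n k)
    exact (congrArg (· ≫ _) h₃).trans (h₁.trans (congrArg (_ ≫ ·) h₂.symm))

/-- The morphism `S^{-k}T^m ⟶ T_Res^n` for `m = n + k`. -/
def satToResLeg (n : ℤ) (k : ℕ) (m : ℤ) (hm : n + k = m) :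
    sat P (T m) (t.additive m) k ⟶ resFunctor t P n where
  app M := satToSyz P (T m) (t.additive m) k M ≫ resLeg t P n k m hm M
  naturality M N f := by
    rw [Category.assoc, resLeg_map t P n f (isSyzLift_syzMap (P M) (P N) f) rfl k m hm,
      ← reassoc_of% satToSyz_naturality (T m) (t.additive m) k f
        (isSyzLift_syzMap (P M) (P N) f) rfl]

lemma satTrans_satToResLeg (n : ℤ) (k : ℕ) (m m' : ℤ) (h : m + 1 = m') (hm : n + k = m) :
    satTrans P (t.additive m) (t.additive m') (satδ P t m m' h) k ≫
      satToResLeg t n (k + 1) m' (by push_cast; lia) = satToResLeg (P := P) t n k m hm := by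
  ext M : 2
  refine (Category.assoc _ _ _).symm.trans
    ((congrArg (· ≫ _) (satTrans_satToSyz t m m' h k M)).trans ?_)
  exact (Category.assoc _ _ _).trans (congrArg (_ ≫ ·) (syzδ_resLeg t P n k m m' hm h M))

/-- The cocone of the morphisms `S^{-k}T^{n + k} ⟶ T_Res^n`. -/
def satToResCocone (n : ℤ) : Cocone (satSystem P t n) where
  pt := resFunctor t P n
  ι := NatTrans.ofSequence (fun k : ℕ => satToResLeg t n k (n + k) rfl) fun k =>
    (congrArg (· ≫ _) (satSystem_map_succ (P := P) t n k)).trans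
      ((satTrans_satToResLeg t n k _ _ _ rfl).trans (Category.comp_id _).symm)

variable (P) in
/-- The comparison from the satellite functor construction to the resolution construction. -/
def satToRes (n : ℤ) : satFunctor P t n ⟶ resFunctor t P n :=
  colimit.desc (satSystem P t n) (satToResCocone t n)

lemma satLeg_satToRes (n : ℤ) (k : ℕ) (m : ℤ) (hm : n + k = m) (M : C) :
    (satLeg P t n k m hm).app M ≫ (satToRes P t n).app M =
      satToSyz P (T m) (t.additive m) k M ≫ resLeg t P n k m hm M := by
  subst hm
  have h : satLeg P t n k (n + k) rfl ≫ satToRes P t n = satToResLeg t n k (n + k) rfl :=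
    (congrArg (· ≫ _) (Category.id_comp _)).trans
      (colimit.ι_desc (F := satSystem P t n) (satToResCocone t n) k)
  exact congrArg (fun τ => τ.app M) h

/-- Injectivity on the terms of the direct systems holds since the connecting homomorphisms of
satellites are injective on sequences with projective middle term; the image of the connecting
homomorphism `T^n(syz_k) ⟶ T^{n + 1}(syz_{k + 1})` is killed in `T^{n + 1}(M_k)`, hence lies in the
image of the satellite. -/
lemma isIso_satToRes (n : ℤ) : IsIso (satToRes P t n) := by
  rw [NatTrans.isIso_iff_isIso_app]
  intro M
  refine isIso_of_isColimit
    (isColimitOfPreserves ((evaluation C AddCommGrpCat.{w}).obj M)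
      (colimit.isColimit (satSystem P t n)))
    (colimit.isColimit (sysSystem t (ofRes (P M)) n)) (satSystemToSys t n M)
    ((satToRes P t n).app M) (fun k => ?_) (fun k => ?_) (fun k y => ?_)
  · have h := satLeg_satToRes (P := P) t n k _ rfl M
    have h₁ : satLeg P t n k _ rfl = colimit.ι (satSystem P t n) k := Category.id_comp _
    have h₂ := sysLeg_self t (ofRes (P M)) n k
    rw [h₁] at h
    exact h.trans (congrArg (_ ≫ ·) h₂)
  · have := mono_sysChain P (T (n + k)) (t.additive _) (exists_isIdLift P M).choose_spec k 0 k
      (Nat.zero_add k)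
    exact (AddCommGrpCat.mono_iff_injective _).1 this
  · have h0 := ConcreteCategory.congr_hom (sysδ_map_κ t (ofRes (P M)) k (n + k) (n + (k + 1 : ℕ))
      (by push_cast; ring)) y
    obtain ⟨x, hx⟩ := exists_sysChain_eq P (T (n + (k + 1 : ℕ))) (t.additive _)
      (exists_isIdLift P M).choose_spec k 0 k (Nat.zero_add _) _ h0
    exact ⟨x, hx.trans (ConcreteCategory.congr_hom
      (sysSystem_map_succ t (ofRes (P M)) n k).symm y)⟩

/-- The comparison as an isomorphism. -/
def satIsoRes (n : ℤ) : satFunctor P t n ≅ resFunctor t P n :=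
  have := isIso_satToRes (P := P) t n
  asIso (satToRes P t n)

variable (P) in
/-- The satellite functor construction as a cohomological functor. -/
def satStructure : CohStructure (satFunctor P t) :=
  (resStructure t P).transport fun n => (satIsoRes t n).symm

lemma isCohIso_satToRes : IsCohIso (satStructure P t) (resStructure t P) (satToRes P t) :=
  ⟨(resStructure t P).isCohMorphism_transport_inv fun n => (satIsoRes t n).symm, isIso_satToRes t⟩

lemma isSatComparison_satToRes : IsSatComparison P t (satToRes P t) := fun M =>
  ⟨fun k => exists_isLiftOfId (syzSES_shortExact (P M) k) (P (syz (P M) k)),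
    fun h hh n k m hm => by
      rw [satLeg_satToRes, satToSyz_eq (T m) (t.additive m) k hh]
      exact congrArg (· ≫ _) (satChain_eq_sysChain P (T m) (t.additive m) M h k 0 k _).symm⟩

lemma satToSyz_succ_map (F : C ⥤ AddCommGrpCat.{w}) (hF : F.Additive) (k : ℕ) {S : ShortComplex C}
    (hS : S.ShortExact) {s : ∀ k, syz (P S.X₃) (k + 1) ⟶ syz (P S.X₁) k}
    (hs : IsLift (ofRes (P S.X₃)).tail (ofRes (P S.X₁)) s) (h0 : IsLiftOfId S (P S.X₃) (s 0)) :
    satToSyz P F hF (k + 1) S.X₃ ≫ F.map (s k) =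
      satε P (sat P F hF k) S (s 0) ≫ satToSyz P F hF k S.X₁ := by
  obtain ⟨c, hc, hc'⟩ := h0
  let φ : syzSES (P S.X₃) 0 ⟶ S :=
    { τ₁ := s 0, τ₂ := c, τ₃ := 𝟙 S.X₃, comm₁₂ := hc'.symm, comm₂₃ := hc.trans
        (Category.comp_id (syzπ (P S.X₃) 0)).symm }
  have h₁ : sysε P F hF (ofRes (P S.X₃)) (exists_isIdLift P S.X₃).choose k 0 ≫
      (sat P F hF k).map (s 0) = satε P (sat P F hF k) S (s 0) := by
    refine (satε_naturality P (sat P F hF k) hS φ ((exists_isIdLift P S.X₃).choose_spec 0)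
      ⟨c, hc, hc'⟩).trans ?_
    exact (congrArg (· ≫ _) (CategoryTheory.Functor.map_id _ _)).trans (Category.id_comp _)
  have h₂ := sysChain_naturality P F hF (E := (ofRes (P S.X₃)).tail) (E' := ofRes (P S.X₁))
    (fun k => (exists_isIdLift P S.X₃).choose_spec (k + 1)) (exists_isIdLift P S.X₁).choose_spec
    hs k 0 k (Nat.zero_add k)
  have h₃ : satToSyz P F hF (k + 1) S.X₃ =
      sysε P F hF (ofRes (P S.X₃)) (exists_isIdLift P S.X₃).choose k 0 ≫
        sysChain P F hF (ofRes (P S.X₃)).tail _ k 0 k (Nat.zero_add k) :=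
    congrArg (_ ≫ ·) (sysChain_tail P F hF (ofRes (P S.X₃)) _ k 0 k (Nat.zero_add k))
  refine (congrArg (· ≫ _) h₃).trans ((Category.assoc _ _ _).trans ((congrArg (_ ≫ ·) h₂).trans ?_))
  exact (Category.assoc _ _ _).symm.trans (congrArg (· ≫ _) h₁)

lemma isSatConnecting_satStructure : IsSatConnecting P t (satStructure P t) := fun S hS =>
  ⟨exists_isLiftOfId hS (P S.X₃), fun l hl n₀ n₁ hn k m h₀ h₁ => by
    have hs := isLift_liftSeq (ofRes (P S.X₃)).tail (ofRes (P S.X₁)) l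
    have := isIso_satToRes (P := P) t
    have e₁ := isCohIso_satToRes (P := P) t |>.1 S hS n₀ n₁ hn
    have e₂ : _ ≫ (resStructure t P).δ S hS n₀ n₁ hn = _ :=
      resLeg_succ_resConn t hS hs hl n₀ n₁ hn k m h₀ h₁
    have e₃ := satToSyz_succ_map (T m) (t.additive m) k hS hs hl
    let ε : (sat P (T m) (t.additive m) (k + 1)).obj S.X₃ ⟶
        (sat P (T m) (t.additive m) k).obj S.X₁ :=
      satε P (sat P (T m) (t.additive m) k) S l
    change _ = ε ≫ _
    rw [← cancel_mono ((satToRes P t n₁).app S.X₁), Category.assoc, Category.assoc, e₁,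
      satLeg_satToRes, reassoc_of% satLeg_satToRes (P := P) t n₀ (k + 1) m h₀ S.X₃, e₂]
    refine (Category.assoc _ _ _).symm.trans ((congrArg (· ≫ _) e₃).trans ?_)
    exact Category.assoc _ _ _⟩

end SatComparison

/-! ### Cochains with values in a projective resolution -/

section Terms

open CochainComplex CochainComplex.HomComplex

/-- Recursive construction of a sequence `f` from `f k` on, with a prescribed relation between
consecutive terms, provided that a predicate propagates; in degrees less than `k` the terms are
those of `z`. -/
lemma exists_seq_from (k : ℕ) {X : ℕ → Type*} (z : ∀ j, X j) (x₀ : X k) (good : ∀ j, X j → Prop)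
    (r : ∀ j, X j → X (j + 1) → Prop) (h₀ : good k x₀)
    (step : ∀ j, k ≤ j → ∀ x, good j x → ∃ y, r j x y ∧ good (j + 1) y) :
    ∃ f : ∀ j, X j, f k = x₀ ∧ (∀ j, j < k → f j = z j) ∧
      ∀ j, k ≤ j → r j (f j) (f (j + 1)) := by
  induction k generalizing X with
  | zero =>
    choose y hy hy' using fun j => step j (Nat.zero_le j)
    let g : ∀ j, { x : X j // good j x } := fun j =>
      Nat.rec ⟨x₀, h₀⟩ (fun i x => ⟨y i x.1 x.2, hy' i x.1 x.2⟩) j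
    exact ⟨fun j => (g j).1, rfl, fun j hj => absurd hj (Nat.not_lt_zero j),
      fun j _ => hy j (g j).1 (g j).2⟩
  | succ k ih =>
    obtain ⟨f, h₁, h₂, h₃⟩ := ih (X := fun j => X (j + 1)) (fun j => z (j + 1)) x₀
      (fun j => good (j + 1)) (fun j => r (j + 1)) h₀ fun j hj => step (j + 1) (by omega)
    refine ⟨fun j => Nat.casesOn j (z 0) f, h₁, fun j hj => ?_, fun j hj => ?_⟩
    · cases j with
      | zero => rfl
      | succ j => exact h₂ j (by omega)
    · cases j with
      | zero => omega
      | succ j => exact h₃ j (by omega)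

variable {C : Type u} [Category.{v} C] [Abelian C] {F : CochainComplex C ℤ} {B : C}
  {Q : ProjectiveResolution B} {n : ℤ}

/-- The component `F_p ⟶ Q_j` of a cochain. -/
def term (Φ : Cochain F Q.cochainComplex n) (j : ℕ) (p : ℤ) (h : p + n = -j) :
    F.X p ⟶ Q.complex.X j :=
  Φ.v p (-j) h ≫ (Q.cochainComplexXIso (-j) j rfl).hom

/-- The cochain with given components. -/
def ofTerms (φ : ∀ (j : ℕ) (p : ℤ), p + n = -j → (F.X p ⟶ Q.complex.X j)) :
    Cochain F Q.cochainComplex n :=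
  Cochain.mk fun p q hpq =>
    if h : q ≤ 0 then
      φ (-q).toNat p (by lia) ≫ (Q.cochainComplexXIso q (-q).toNat (by lia)).inv
    else 0

lemma v_eq_term (Φ : Cochain F Q.cochainComplex n) (p q : ℤ) (hpq : p + n = q) (j : ℕ)
    (h : -j = q) : Φ.v p q hpq = term Φ j p (by lia) ≫ (Q.cochainComplexXIso q j h).inv := by
  subst h
  simp [term]

lemma term_eq (Φ : Cochain F Q.cochainComplex n) (p q : ℤ) (hpq : p + n = q) (j : ℕ)
    (h : -j = q) : term Φ j p (by lia) = Φ.v p q hpq ≫ (Q.cochainComplexXIso q j h).hom := by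
  subst h
  rfl

lemma v_eq_zero (Φ : Cochain F Q.cochainComplex n) (p q : ℤ) (hpq : p + n = q) (h : 0 < q) :
    Φ.v p q hpq = 0 :=
  (CochainComplex.isZero_of_isStrictlyLE Q.cochainComplex 0 q h).eq_of_tgt _ _

lemma term_ofTerms (φ : ∀ (j : ℕ) (p : ℤ), p + n = -j → (F.X p ⟶ Q.complex.X j)) (j : ℕ)
    (p : ℤ) (h : p + n = -j) : term (ofTerms φ) j p h = φ j p h := by
  have key : ∀ (j' : ℕ) (e : j' = j), (φ j' p (by lia) ≫
      (Q.cochainComplexXIso (-j) j' (by lia)).inv) ≫ (Q.cochainComplexXIso (-j) j rfl).hom =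
        φ j p h := by
    rintro _ rfl
    simp
  unfold term ofTerms
  rw [Cochain.mk_v, dif_pos (by lia)]
  exact key _ (by lia)

lemma cochain_ext_term {Φ Ψ : Cochain F Q.cochainComplex n}
    (h : ∀ j p hp, term Φ j p hp = term Ψ j p hp) : Φ = Ψ := by
  ext p q hpq
  by_cases hq : q ≤ 0
  · rw [v_eq_term Φ p q hpq (-q).toNat (by lia), v_eq_term Ψ p q hpq (-q).toNat (by lia), h]
  · rw [v_eq_zero Φ p q hpq (by lia), v_eq_zero Ψ p q hpq (by lia)]

@[simp]
lemma term_add (Φ Ψ : Cochain F Q.cochainComplex n) (j : ℕ) (p : ℤ) (h : p + n = -j) :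
    term (Φ + Ψ) j p h = term Φ j p h + term Ψ j p h := by
  simp [term]

@[simp]
lemma term_sub (Φ Ψ : Cochain F Q.cochainComplex n) (j : ℕ) (p : ℤ) (h : p + n = -j) :
    term (Φ - Ψ) j p h = term Φ j p h - term Ψ j p h := by
  simp [term]

@[simp]
lemma term_zero (j : ℕ) (p : ℤ) (h : p + n = -j) :
    term (0 : Cochain F Q.cochainComplex n) j p h = 0 := by
  simp [term]

lemma term_δ (m : ℤ) (hm : n + 1 = m) (Φ : Cochain F Q.cochainComplex n) (j : ℕ) (p p' : ℤ)
    (h : p + m = -j) (hp : p + 1 = p') :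
    term (δ n m Φ) j p h = term Φ (j + 1) p (by push_cast; lia) ≫ Q.complex.d (j + 1) j +
      m.negOnePow • F.d p p' ≫ term Φ j p' (by lia) := by
  unfold term
  rw [δ_v n m hm Φ p (-j) h (-(j + 1 : ℕ)) p' (by push_cast; lia) hp,
    Q.cochainComplex_d (-(j + 1 : ℕ)) (-j) (j + 1) j rfl rfl]
  simp

/-- The squares of a cochain with target `Q_{j + 1} ⟶ Q_j` commute up to `(-1)^n`. -/
lemma term_δ_eq_zero_iff (Φ : Cochain F Q.cochainComplex n) (j : ℕ) (p p' : ℤ)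
    (h : p + (n + 1) = -j) (hp : p + 1 = p') :
    term (δ n (n + 1) Φ) j p h = 0 ↔
      term Φ (j + 1) p (by push_cast; lia) ≫ Q.complex.d (j + 1) j =
        n.negOnePow • F.d p p' ≫ term Φ j p' (by lia) := by
  rw [term_δ (n + 1) rfl Φ j p p' h hp, Int.negOnePow_succ, Units.neg_smul, ← sub_eq_add_neg,
    sub_eq_zero]

lemma mem_Bdd_iff (Φ : Cochain F Q.cochainComplex n) :
    Φ ∈ Bdd F Q.cochainComplex n ↔ ∃ k : ℕ, ∀ j, k ≤ j → ∀ p h, term Φ j p h = 0 := by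
  constructor
  · intro (h : {p : ℤ | Φ.v p (p + n) rfl ≠ 0}.Finite)
    obtain ⟨b, hb⟩ := h.bddBelow
    refine ⟨(-b - n + 1).toNat, fun j hj p hp => ?_⟩
    by_contra h0
    have : p ∈ {p : ℤ | Φ.v p (p + n) rfl ≠ 0} := fun h1 => h0 (by
      rw [term_eq Φ p (p + n) rfl j hp.symm, h1, zero_comp])
    have := hb this
    lia
  · rintro ⟨k, hk⟩
    refine (Set.finite_Ioc (-k - n) (-n)).subset fun p hp => ?_
    by_contra h0
    refine hp ?_
    by_cases hp' : 0 < p + n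
    · exact v_eq_zero Φ p _ rfl hp'
    · rw [Set.mem_Ioc, not_and_or] at h0
      rw [v_eq_term Φ p (p + n) rfl (-(p + n)).toNat (by lia), hk _ (by lia), zero_comp]

lemma exists_lift_syzπ {X : C} [Projective X] (k : ℕ) (x : X ⟶ syz Q k) :
    ∃ y : X ⟶ Q.complex.X k, y ≫ syzπ Q k = x :=
  ⟨_, Projective.factorThru_comp x (syzπ Q k)⟩

lemma exists_lift_d {X : C} [Projective X] (k : ℕ) (x : X ⟶ Q.complex.X k)
    (hx : x ≫ syzπ Q k = 0) : ∃ y : X ⟶ Q.complex.X (k + 1), y ≫ Q.complex.d (k + 1) k = x := by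
  obtain ⟨y, hy⟩ := exists_lift_syzπ (k + 1) (syzLift Q k x hx)
  exact ⟨y, by rw [← syzπ_ι, reassoc_of% hy, syzLift_ι]⟩

lemma comp_syzπ_eq_zero_iff {X : C} (k : ℕ) (x : X ⟶ Q.complex.X (k + 1)) :
    x ≫ syzπ Q (k + 1) = 0 ↔ x ≫ Q.complex.d (k + 1) k = 0 := by
  rw [← cancel_mono (syzι Q k), Category.assoc, syzπ_ι, zero_comp]

variable [∀ p, Projective (F.X p)]

/-- A cocycle with values in the `k`-th syzygy is covered by a cochain which is a chain map in
degrees at least `k` and vanishes in degrees less than `k`. -/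
lemma exists_cochain_of_syz (n : ℤ) (k : ℕ) (x : ∀ p : ℤ, p + n = -k → (F.X p ⟶ syz Q k))
    (hx : ∀ (p p' : ℤ) (h : p' + n = -k), F.d p p' ≫ x p' h = 0) :
    ∃ Φ : Cochain F Q.cochainComplex n, (∀ p h, term Φ k p h ≫ syzπ Q k = x p h) ∧
      (∀ j, j < k → ∀ p h, term Φ j p h = 0) ∧
      ∀ j, k ≤ j → ∀ p h, term (δ n (n + 1) Φ) j p h = 0 := by
  choose x₀ hx₀ using fun p h => exists_lift_syzπ k (x p h)
  obtain ⟨φ, h₁, h₂, h₃⟩ := exists_seq_from k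
    (X := fun j => ∀ p : ℤ, p + n = -j → (F.X p ⟶ Q.complex.X j)) (fun _ _ _ => 0) x₀
    (fun j φ => ∀ (p p' : ℤ) (h : p' + n = -j), F.d p p' ≫ φ p' h ≫ syzπ Q j = 0)
    (fun j φ ψ => ∀ (p p' : ℤ) (h : p' + n = -j) (hp : p + 1 = p'),
      ψ p (by push_cast; lia) ≫ Q.complex.d (j + 1) j = n.negOnePow • F.d p p' ≫ φ p' h)
    (fun p p' h => by rw [hx₀, hx]) (fun j _ φ hφ => by
      choose ψ hψ using fun (p : ℤ) (h : p + n = -(j + 1 : ℕ)) =>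
        exists_lift_d j (n.negOnePow • F.d p (p + 1) ≫ φ (p + 1) (by push_cast at h; lia)) (by
          rw [Linear.units_smul_comp, Category.assoc, hφ, smul_zero])
      refine ⟨ψ, fun p p' h hp => ?_, fun p p' h => ?_⟩
      · subst hp
        exact hψ p _
      · rw [← Category.assoc, comp_syzπ_eq_zero_iff, Category.assoc, hψ, Linear.comp_units_smul,
          F.d_comp_d_assoc, zero_comp, smul_zero])
  refine ⟨ofTerms φ, fun p h => ?_, fun j hj p h => ?_, fun j hj p h => ?_⟩
  · rw [term_ofTerms, h₁, hx₀]
  · rw [term_ofTerms, h₂ j hj]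
  · rw [term_δ_eq_zero_iff _ _ _ _ _ rfl, term_ofTerms, term_ofTerms]
    exact h₃ j hj p (p + 1) _ rfl

/-- A cochain which is a chain map in degrees at least `k` and whose component in degree `k` gives
a coboundary with values in the `k`-th syzygy is nullhomotopic in degrees at least `k`. -/
lemma exists_homotopy_of_syz (k : ℕ) (Φ : Cochain F Q.cochainComplex n)
    (hΦ : ∀ j, k ≤ j → ∀ p h, term (δ n (n + 1) Φ) j p h = 0)
    (y : ∀ p : ℤ, p + (n - 1) = -k → (F.X p ⟶ syz Q k))
    (hy : ∀ (p p' : ℤ) (h : p + n = -k) (hp : p + 1 = p'),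
      term Φ k p h ≫ syzπ Q k = F.d p p' ≫ y p' (by lia)) :
    ∃ e : Cochain F Q.cochainComplex (n - 1),
      ∀ j, k ≤ j → ∀ p h, term (Φ - δ (n - 1) n e) j p h = 0 := by
  choose y₀ hy₀ using fun p h => exists_lift_syzπ k (n.negOnePow • y p h)
  obtain ⟨e, h₁, -, h₃⟩ := exists_seq_from k
    (X := fun j => ∀ p : ℤ, p + (n - 1) = -j → (F.X p ⟶ Q.complex.X j)) (fun _ _ _ => 0) y₀
    (fun j e => ∀ (p p' : ℤ) (h : p + n = -j) (hp : p + 1 = p'),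
      (term Φ j p h - n.negOnePow • F.d p p' ≫ e p' (by omega)) ≫ syzπ Q j = 0)
    (fun j e e' => ∀ (p p' : ℤ) (h : p + n = -j) (hp : p + 1 = p'),
      e' p (by push_cast; omega) ≫ Q.complex.d (j + 1) j =
        term Φ j p h - n.negOnePow • F.d p p' ≫ e p' (by omega))
    (fun p p' h hp => by
      rw [Preadditive.sub_comp, Linear.units_smul_comp, Category.assoc, hy₀, hy p p' h hp,
        Linear.comp_units_smul, smul_smul, Int.units_mul_self, one_smul, sub_self])
    (fun j hj e he => by
      choose e' he' using fun (p : ℤ) (h : p + (n - 1) = -(j + 1 : ℕ)) =>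
        exists_lift_d j _ (he p (p + 1) (by push_cast at h; omega) rfl)
      refine ⟨e', fun p p' h hp => ?_, fun p p' h hp => ?_⟩
      · subst hp
        exact he' p _
      · rw [comp_syzπ_eq_zero_iff, Preadditive.sub_comp, Linear.units_smul_comp, Category.assoc,
          he',
          (term_δ_eq_zero_iff Φ j p p' (by push_cast at h; omega) hp).1 (hΦ j hj _ _),
          Preadditive.comp_sub, Linear.comp_units_smul, F.d_comp_d_assoc, zero_comp, smul_zero,
          sub_zero, sub_self])
  refine ⟨ofTerms e, fun j hj p h => ?_⟩
  rw [term_sub, term_δ n (by omega) _ j p (p + 1) h rfl, term_ofTerms, term_ofTerms,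
    h₃ j hj p (p + 1) h rfl, sub_add_cancel, sub_self]

end Terms

/-! ### Classes of cocycles in `Ext` -/

section ExtClasses

lemma homologyπ_surjective (K : CochainComplex AddCommGrpCat.{w} ℤ) (n : ℤ) :
    Function.Surjective (K.homologyπ n) :=
  (AddCommGrpCat.epi_iff_surjective _).1 inferInstance

lemma iCycles_injective (K : CochainComplex AddCommGrpCat.{w} ℤ) (n : ℤ) :
    Function.Injective (K.iCycles n) :=
  (AddCommGrpCat.mono_iff_injective _).1 inferInstance

/-- A cycle is a boundary if and only if its class vanishes. -/
lemma homologyπ_eq_zero_iff (K : CochainComplex AddCommGrpCat.{w} ℤ) (m n : ℤ) (h : m + 1 = n)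
    (c : K.cycles n) : K.homologyπ n c = 0 ↔ ∃ y : K.X m, K.d m n y = K.iCycles n c := by
  have hw : K.toCycles m n ≫ K.homologyπ n = 0 := K.toCycles_comp_homologyπ m n
  have hex : (ShortComplex.mk _ _ hw).Exact :=
    ShortComplex.exact_of_g_is_cokernel _ (K.homologyIsCokernel m n (by simp [← h]))
  constructor
  · intro h0
    obtain ⟨y, hy⟩ := (ShortComplex.ab_exact_iff _).1 hex c h0
    refine ⟨y, ?_⟩
    rw [← hy]
    exact (ConcreteCategory.congr_hom (K.toCycles_i m n) y).symm
  · rintro ⟨y, hy⟩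
    have : K.toCycles m n y = c := iCycles_injective K n
      ((ConcreteCategory.congr_hom (K.toCycles_i m n) y).trans hy)
    rw [← this]
    exact ConcreteCategory.congr_hom hw y

variable {C : Type u} [Category.{v} C] [Abelian C] {A : C} (R : ProjectiveResolution A)

lemma extMk_eq {B : C} (n : ℤ) (φ : R.cochainComplex.X (-n) ⟶ B)
    (hφ : R.cochainComplex.d (-(n + 1)) (-n) ≫ φ = 0) (c : (extComplex R B).cycles n)
    (hc : (extComplex R B).iCycles n c = φ) :
    extMk R n φ hφ = (extComplex R B).homologyπ n c := by
  refine congrArg ((extComplex R B).homologyπ n) (iCycles_injective _ _ ?_)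
  rw [hc]
  exact ShortComplex.abCyclesIso_inv_apply_iCycles _ _

lemma exists_iCycles_eq {B : C} (n : ℤ) (φ : R.cochainComplex.X (-n) ⟶ B)
    (hφ : R.cochainComplex.d (-(n + 1)) (-n) ≫ φ = 0) :
    ∃ c : (extComplex R B).cycles n, (extComplex R B).iCycles n c = φ :=
  ⟨_, ShortComplex.abCyclesIso_inv_apply_iCycles ((extComplex R B).sc n) ⟨φ, by
    have h : (extComplex R B).d n (n + 1) φ = 0 := hφ
    have h' := CochainComplex.next ℤ n
    rw [← h'] at h
    exact h⟩⟩

lemma extMk_surjective {B : C} (n : ℤ) (x : (extFunctor R n).obj B) :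
    ∃ φ hφ, extMk R n φ hφ = x := by
  obtain ⟨c, rfl⟩ := homologyπ_surjective (extComplex R B) n x
  have hφ : (extComplex R B).d n (n + 1) ((extComplex R B).iCycles n c) = 0 :=
    ConcreteCategory.congr_hom ((extComplex R B).iCycles_d n (n + 1)) c
  exact ⟨(extComplex R B).iCycles n c, hφ, extMk_eq R n _ hφ c rfl⟩

lemma extMk_add {B : C} (n : ℤ) (φ ψ : R.cochainComplex.X (-n) ⟶ B)
    (hφ : R.cochainComplex.d (-(n + 1)) (-n) ≫ φ = 0)
    (hψ : R.cochainComplex.d (-(n + 1)) (-n) ≫ ψ = 0) :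
    extMk R n (φ + ψ) (by rw [Preadditive.comp_add, hφ, hψ, add_zero]) =
      extMk R n φ hφ + extMk R n ψ hψ := by
  obtain ⟨c, hc⟩ := exists_iCycles_eq R n φ hφ
  obtain ⟨d, hd⟩ := exists_iCycles_eq R n ψ hψ
  rw [extMk_eq R n φ hφ c hc, extMk_eq R n ψ hψ d hd, extMk_eq R n (φ + ψ) _ (c + d)
    ((map_add _ _ _).trans (congrArg₂ _ hc hd))]
  exact map_add _ _ _

lemma extMk_eq_zero_iff {B : C} (m n : ℤ) (h : m + 1 = n) (φ : R.cochainComplex.X (-n) ⟶ B)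
    (hφ : R.cochainComplex.d (-(n + 1)) (-n) ≫ φ = 0) :
    extMk R n φ hφ = 0 ↔
      ∃ y : R.cochainComplex.X (-m) ⟶ B, R.cochainComplex.d (-n) (-m) ≫ y = φ := by
  obtain ⟨c, hc⟩ := exists_iCycles_eq R n φ hφ
  rw [extMk_eq R n φ hφ c hc]
  refine (homologyπ_eq_zero_iff (extComplex R B) m n h c).trans ?_
  rw [hc]
  rfl

lemma extFunctor_map_extMk {B B' : C} (f : B ⟶ B') (n : ℤ) (φ : R.cochainComplex.X (-n) ⟶ B)
    (hφ : R.cochainComplex.d (-(n + 1)) (-n) ≫ φ = 0) :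
    (extFunctor R n).map f (extMk R n φ hφ) =
      extMk R n (φ ≫ f) (by rw [← Category.assoc, hφ, zero_comp]) := by
  obtain ⟨c, hc⟩ := exists_iCycles_eq R n φ hφ
  rw [extMk_eq R n φ hφ c hc, extMk_eq R n (φ ≫ f) _
    (HomologicalComplex.cyclesMap ((extComplexFunctor R).map f) n c) (by
      rw [← hc]
      exact ConcreteCategory.congr_hom
        (HomologicalComplex.cyclesMap_i ((extComplexFunctor R).map f) n) c)]
  exact ConcreteCategory.congr_hom
    (HomologicalComplex.homologyπ_naturality ((extComplexFunctor R).map f) n) c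

/-- The connecting homomorphisms of `Ext` in terms of cocycles. -/
lemma extStructure_δ_extMk {S : ShortComplex C} (hS : S.ShortExact) (n₀ n₁ : ℤ) (h : n₀ + 1 = n₁)
    (φ : R.cochainComplex.X (-n₀) ⟶ S.X₃)
    (hφ : R.cochainComplex.d (-(n₀ + 1)) (-n₀) ≫ φ = 0)
    (ψ : R.cochainComplex.X (-n₀) ⟶ S.X₂) (hψ : ψ ≫ S.g = φ)
    (χ : R.cochainComplex.X (-n₁) ⟶ S.X₁) (hχ : χ ≫ S.f = R.cochainComplex.d (-n₁) (-n₀) ≫ ψ)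
    (hχ' : R.cochainComplex.d (-(n₁ + 1)) (-n₁) ≫ χ = 0) :
    (extStructure R).δ S hS n₀ n₁ h (extMk R n₀ φ hφ) = extMk R n₁ χ hχ' := by
  subst h
  -- `δ_apply` refers to a forgetful functor to abelian groups, which is the identity here
  let _ : HasForget₂ AddCommGrpCat.{v} AddCommGrpCat.{v} := { forget₂ := 𝟭 _ }
  have : (forget₂ AddCommGrpCat.{v} AddCommGrpCat.{v}).Additive :=
    inferInstanceAs (𝟭 AddCommGrpCat.{v}).Additive
  have : (forget₂ AddCommGrpCat.{v} AddCommGrpCat.{v}).PreservesHomology :=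
    inferInstanceAs (𝟭 AddCommGrpCat.{v}).PreservesHomology
  have := (extComplex_shortExact R S hS).δ_apply n₀ (n₀ + 1) rfl φ hφ ψ hψ χ hχ (n₀ + 1 + 1)
    (CochainComplex.next ℤ (n₀ + 1))
  rw [extMk_eq R n₀ φ hφ _ (HomologicalComplex.i_cyclesMk (extComplex R S.X₃) φ (n₀ + 1)
    (CochainComplex.next ℤ n₀) hφ), extMk_eq R (n₀ + 1) χ hχ' _ (HomologicalComplex.i_cyclesMk
    (extComplex R S.X₁) χ (n₀ + 1 + 1) (CochainComplex.next ℤ (n₀ + 1)) hχ')]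
  exact this

end ExtClasses

/-! ### The class at a syzygy of a cochain which is a chain map in high degrees -/

section SyzClass

open CochainComplex CochainComplex.HomComplex

variable {C : Type u} [Category.{v} C] [Abelian C]

/-- Auxiliary recursion for `homSyz`. -/
def homSyzAux {X Y : C} {Q : ProjectiveResolution X} {Q' : ProjectiveResolution Y} {f : X ⟶ Y}
    (h : ProjectiveResolution.Hom Q Q' f) :
    ∀ k, { s : syz Q k ⟶ syz Q' k // h.hom.f k ≫ syzπ Q' k = syzπ Q k ≫ s }
  | 0 => ⟨f, h.hom_f_zero_comp_π_f_zero.trans (congrArg (_ ≫ ·)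
      (ChainComplex.single₀_map_f_zero f))⟩
  | k + 1 => ⟨syzLift Q' k (syzι Q k ≫ h.hom.f k) (by
      rw [Category.assoc, (homSyzAux h k).2, ← Category.assoc, syzι_π, zero_comp]), by
      rw [← cancel_mono (syzι Q' k), Category.assoc, syzπ_ι, Category.assoc, syzLift_ι,
        ← Category.assoc, syzπ_ι, h.hom.comm]⟩

/-- The morphism on `k`-th syzygies induced by a chain map of projective resolutions. -/
def homSyz {X Y : C} {Q : ProjectiveResolution X} {Q' : ProjectiveResolution Y} {f : X ⟶ Y}
    (h : ProjectiveResolution.Hom Q Q' f) (k : ℕ) : syz Q k ⟶ syz Q' k := (homSyzAux h k).1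

lemma hom_syzπ {X Y : C} {Q : ProjectiveResolution X} {Q' : ProjectiveResolution Y} {f : X ⟶ Y}
    (h : ProjectiveResolution.Hom Q Q' f) (k : ℕ) :
    h.hom.f k ≫ syzπ Q' k = syzπ Q k ≫ homSyz h k := (homSyzAux h k).2

lemma isSyzLift_homSyz {X Y : C} {Q : ProjectiveResolution X} {Q' : ProjectiveResolution Y}
    {f : X ⟶ Y} (h : ProjectiveResolution.Hom Q Q' f) : IsSyzLift Q Q' (homSyz h) :=
  fun k => ⟨h.hom.f k, hom_syzπ h k, (syzLift_ι _ _ _ _).symm⟩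

variable {A : C} (R : ProjectiveResolution A) {B B' : C} (Q : ProjectiveResolution B)
  {Q' : ProjectiveResolution B'}

/-- The cochains which are chain maps in degrees at least `k`. -/
def truncCocycles (n : ℤ) (k : ℕ) : AddSubgroup (Cochain R.cochainComplex Q.cochainComplex n) where
  carrier := {Φ | ∀ j, k ≤ j → ∀ p h, term (δ n (n + 1) Φ) j p h = 0}
  zero_mem' := fun j _ p h => by simp
  add_mem' {Φ Ψ} hΦ hΨ := fun j hj p h => by rw [δ_add, term_add, hΦ j hj, hΨ j hj, add_zero]
  neg_mem' {Φ} hΦ := fun j hj p h => by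
    have := hΦ j hj p h
    rw [δ_neg, ← zero_sub, term_sub, this, term_zero, sub_zero]

variable {R Q} {n : ℤ} {k : ℕ}

lemma truncCocycles_mono {l : ℕ} (h : k ≤ l) : truncCocycles R Q n k ≤ truncCocycles R Q n l :=
  fun _ hΦ j hj => hΦ j (h.trans hj)

lemma mem_almostCocycles_iff (Φ : Cochain R.cochainComplex Q.cochainComplex n) :
    Φ ∈ almostCocycles R.cochainComplex Q.cochainComplex n ↔ ∃ k, Φ ∈ truncCocycles R Q n k := by
  rw [mem_almostCocycles, mem_Bdd_iff]
  rfl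

lemma mem_cocycle_iff (Φ : Cochain R.cochainComplex Q.cochainComplex n) :
    Φ ∈ cocycle R.cochainComplex Q.cochainComplex n ↔ Φ ∈ truncCocycles R Q n 0 := by
  rw [Cocycle.mem_iff n (n + 1) rfl]
  refine ⟨fun h j _ p hp => by rw [h, term_zero], fun h => cochain_ext_term fun j p hp => ?_⟩
  rw [h j (Nat.zero_le j) p hp, term_zero]

lemma term_square {Φ : Cochain R.cochainComplex Q.cochainComplex n}
    (hΦ : Φ ∈ truncCocycles R Q n k) (j : ℕ) (hj : k ≤ j) (p p' : ℤ) (h : p' + n = -j)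
    (hp : p + 1 = p') :
    term Φ (j + 1) p (by push_cast; lia) ≫ Q.complex.d (j + 1) j =
      n.negOnePow • R.cochainComplex.d p p' ≫ term Φ j p' h :=
  (term_δ_eq_zero_iff Φ j p p' (by lia) hp).1 (hΦ j hj p (by lia))

lemma d_comp_term_syzπ {Φ : Cochain R.cochainComplex Q.cochainComplex n}
    (hΦ : Φ ∈ truncCocycles R Q n k) (j : ℕ) (hj : k ≤ j) (p p' : ℤ) (h : p' + n = -j) :
    R.cochainComplex.d p p' ≫ term Φ j p' h ≫ syzπ Q j = 0 := by
  by_cases hp : p + 1 = p'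
  · have := congrArg (n.negOnePow • · ≫ syzπ Q j) (term_square hΦ j hj p p' h hp)
    simpa [Linear.units_smul_comp, smul_smul, Int.units_mul_self, d_syzπ] using this.symm
  · rw [R.cochainComplex.shape _ _ hp, zero_comp]

/-- The class in `Ext^m(A, syz_k B)`, for `m = n + k`, of a cochain of degree `n` which is a chain
map in degrees at least `k`: the class of its component of index `k` followed by the projection to
the syzygy. The sign makes these classes compatible with the connecting homomorphisms. -/
def syzClass (m : ℤ) (hm : n + k = m) (Φ : Cochain R.cochainComplex Q.cochainComplex n)
    (hΦ : Φ ∈ truncCocycles R Q n k) : (extFunctor R m).obj (syz Q k) :=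
  extMk R m ((k * n).negOnePow • term Φ k (-m) (by lia) ≫ syzπ Q k) (by
    rw [Linear.comp_units_smul, d_comp_term_syzπ hΦ k le_rfl, smul_zero])

lemma extMk_congr {m : ℤ} {φ ψ : R.cochainComplex.X (-m) ⟶ B} (h : φ = ψ)
    (hφ : R.cochainComplex.d (-(m + 1)) (-m) ≫ φ = 0) :
    extMk R m φ hφ = extMk R m ψ (h ▸ hφ) := by
  subst h
  rfl

lemma syzClass_add (m : ℤ) (hm : n + k = m) {Φ Ψ : Cochain R.cochainComplex Q.cochainComplex n}
    (hΦ : Φ ∈ truncCocycles R Q n k) (hΨ : Ψ ∈ truncCocycles R Q n k) :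
    syzClass m hm (Φ + Ψ) (add_mem hΦ hΨ) = syzClass m hm Φ hΦ + syzClass m hm Ψ hΨ :=
  (extMk_congr (by rw [term_add, Preadditive.add_comp, smul_add]) _).trans (extMk_add R m _ _ _ _)

/-- The classes at consecutive syzygies correspond to each other under the connecting homomorphism:
the component of index `k` lifts the class at the `k`-th syzygy, and its composition with the
differential is given, up to sign, by the component of index `k + 1`. -/
lemma syzδ_syzClass (m m' : ℤ) (hm : n + k = m) (h : m + 1 = m')
    (Φ : Cochain R.cochainComplex Q.cochainComplex n) (hΦ : Φ ∈ truncCocycles R Q n k) :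
    syzδ (extStructure R) Q k m m' h (syzClass m hm Φ hΦ) =
      syzClass m' (by push_cast; lia) Φ (truncCocycles_mono (Nat.le_succ k) hΦ) := by
  refine extStructure_δ_extMk R (syzSES_shortExact Q k) m m' h _ _
    ((k * n).negOnePow • term Φ k (-m) (by lia)) (Linear.units_smul_comp _ _ _) _ ?_ _
  have h₁ := term_square hΦ k le_rfl (-m') (-m) (by lia) (by lia)
  dsimp only [syzSES]
  rw [Linear.units_smul_comp, Category.assoc, syzπ_ι, h₁, smul_smul, Linear.comp_units_smul]
  congr 1
  rw [← Int.negOnePow_add]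
  have : ((k + 1 : ℕ) : ℤ) * n + n = k * n + 2 * n := by push_cast; ring
  rw [this, Int.negOnePow_add, Int.negOnePow_two_mul, mul_one]

lemma term_comp_ofHom {f : B ⟶ B'} (h : ProjectiveResolution.Hom Q Q' f)
    (Φ : Cochain R.cochainComplex Q.cochainComplex n) (j : ℕ) (p : ℤ) (hp : p + n = -j) :
    term (Φ.comp (Cochain.ofHom h.hom') (add_zero n)) j p hp = term Φ j p hp ≫ h.hom.f j := by
  simp [term, h.hom'_f (-j) j rfl]

lemma comp_ofHom_mem_truncCocycles {f : B ⟶ B'} (h : ProjectiveResolution.Hom Q Q' f)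
    {Φ : Cochain R.cochainComplex Q.cochainComplex n} (hΦ : Φ ∈ truncCocycles R Q n k) :
    Φ.comp (Cochain.ofHom h.hom') (add_zero n) ∈ truncCocycles R Q' n k := fun j hj p hp => by
  rw [δ_comp_ofHom, term_comp_ofHom, hΦ j hj, zero_comp]

lemma map_syzClass {f : B ⟶ B'} (h : ProjectiveResolution.Hom Q Q' f) (m : ℤ) (hm : n + k = m)
    (Φ : Cochain R.cochainComplex Q.cochainComplex n) (hΦ : Φ ∈ truncCocycles R Q n k) :
    (extFunctor R m).map (homSyz h k) (syzClass m hm Φ hΦ) =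
      syzClass m hm (Φ.comp (Cochain.ofHom h.hom') (add_zero n))
        (comp_ofHom_mem_truncCocycles h hΦ) := by
  refine (extFunctor_map_extMk R _ _ _ _).trans (extMk_congr ?_ _)
  rw [Linear.units_smul_comp, Category.assoc, term_comp_ofHom, Category.assoc, hom_syzπ]

lemma exists_syzClass_eq (m : ℤ) (hm : n + k = m) (x : (extFunctor R m).obj (syz Q k)) :
    ∃ Φ hΦ, syzClass (Q := Q) (n := n) (k := k) m hm Φ hΦ = x := by
  obtain ⟨φ, hφ, rfl⟩ := extMk_surjective R m x
  obtain ⟨Φ, h₁, -, h₃⟩ := exists_cochain_of_syz (F := R.cochainComplex) (Q := Q) n k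
    (fun p hp => (R.cochainComplex.XIsoOfEq (show p = -m by lia)).hom ≫
      ((k * n).negOnePow • φ)) (fun p p' h => by
        obtain rfl : p' = -m := by lia
        by_cases hp : p + 1 = -m
        · obtain rfl : p = -(m + 1) := by lia
          simp [Linear.comp_units_smul, hφ]
        · rw [R.cochainComplex.shape _ _ hp, zero_comp])
  refine ⟨Φ, h₃, extMk_congr ?_ _⟩
  rw [h₁]
  simp [smul_smul, Int.units_mul_self]

lemma exists_homotopy_of_syzClass_eq_zero (m : ℤ) (hm : n + k = m)
    (Φ : Cochain R.cochainComplex Q.cochainComplex n) (hΦ : Φ ∈ truncCocycles R Q n k)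
    (h0 : syzClass m hm Φ hΦ = 0) : ∃ e : Cochain R.cochainComplex Q.cochainComplex (n - 1),
      ∀ j, k ≤ j → ∀ p h, term (Φ - δ (n - 1) n e) j p h = 0 := by
  obtain ⟨y, hy⟩ := (extMk_eq_zero_iff R (m - 1) m (by lia) _ _).1 h0
  refine exists_homotopy_of_syz k Φ hΦ (fun p hp =>
    (R.cochainComplex.XIsoOfEq (show p = -(m - 1) by lia)).hom ≫ ((k * n).negOnePow • y)) ?_
  intro p p' h hp
  obtain rfl : p = -m := by lia
  obtain rfl : p' = -(m - 1) := by lia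
  simp [Linear.comp_units_smul, hy, smul_smul, Int.units_mul_self]

lemma syzClass_δ_eq_zero (m : ℤ) (hm : n + k = m)
    (Φ : Cochain R.cochainComplex Q.cochainComplex n) (hΦ : Φ ∈ truncCocycles R Q n k)
    (e : Cochain R.cochainComplex Q.cochainComplex (n - 1))
    (he : ∀ p h, term (Φ - δ (n - 1) n e) k p h = 0) : syzClass m hm Φ hΦ = 0 := by
  refine (extMk_eq_zero_iff R (m - 1) m (by lia) _ _).2
    ⟨(k * n).negOnePow • n.negOnePow • term e k (-(m - 1)) (by lia) ≫ syzπ Q k, ?_⟩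
  have h₁ := he (-m) (by lia)
  rw [term_sub, sub_eq_zero, term_δ n (by lia) e k (-m) (-(m - 1)) (by lia) (by lia)] at h₁
  rw [h₁, Preadditive.add_comp, Category.assoc, d_syzπ, comp_zero, zero_add,
    Linear.units_smul_comp, Linear.comp_units_smul, Linear.comp_units_smul, Category.assoc]

end SyzClass

/-! ### Chain maps and `Ext`, almost chain maps and the resolution construction -/

section Comparison

open CochainComplex CochainComplex.HomComplex

variable {C : Type u} [Category.{v} C] [Abelian C] {A : C} (R : ProjectiveResolution A)
  (P : ∀ X : C, ProjectiveResolution X)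

/-- The homomorphism sending the class of a chain map to the class of its component in degree `0`
followed by the augmentation. -/
def chainToExtHom (n : ℤ) {B : C} (Q : ProjectiveResolution B) :
    CohomologyClass R.cochainComplex Q.cochainComplex n →+ (extFunctor R n).obj B :=
  CohomologyClass.descAddMonoidHom
    (AddMonoidHom.mk' (fun z => syzClass (k := 0) n (by simp) z.1 ((mem_cocycle_iff z.1).1 z.2))
      fun z z' => syzClass_add n (by simp) _ _) (by
    intro z hz
    rw [mem_coboundaries_iff z (n - 1) (by lia)] at hz
    obtain ⟨e, he⟩ := hz
    exact syzClass_δ_eq_zero (k := 0) n (by simp) z.1 ((mem_cocycle_iff z.1).1 z.2) e fun p h => by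
      rw [he, sub_self, term_zero])

lemma chainToExtHom_bijective (n : ℤ) {B : C} (Q : ProjectiveResolution B) :
    Function.Bijective (chainToExtHom R n Q) := by
  refine ⟨(injective_iff_map_eq_zero _).2 fun x hx => ?_, fun x => ?_⟩
  · obtain ⟨z, rfl⟩ := x.mk_surjective
    obtain ⟨e, he⟩ := exists_homotopy_of_syzClass_eq_zero (k := 0) n (by simp) z.1
      ((mem_cocycle_iff z.1).1 z.2) hx
    rw [CohomologyClass.mk_eq_zero_iff, mem_coboundaries_iff z (n - 1) (by lia)]
    refine ⟨e, (sub_eq_zero.1 (cochain_ext_term fun j p hp => ?_)).symm⟩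
    rw [he j (Nat.zero_le j), term_zero]
  · obtain ⟨Φ, hΦ, h⟩ := exists_syzClass_eq (Q := Q) (n := n) (k := 0) n (by simp) x
    exact ⟨CohomologyClass.mk ⟨Φ, (mem_cocycle_iff Φ).2 hΦ⟩, h⟩

/-- The natural transformation `𝓔xt^n(A, -) ⟶ Ext^n(A, -)` sending the class of a chain map to the
class of its component in degree `0` followed by the augmentation. -/
def chainToExt (n : ℤ) : chainExt R P n ⟶ extFunctor R n where
  app B := AddCommGrpCat.ofHom (chainToExtHom R n (P B))
  naturality B B' f := by
    ext x
    obtain ⟨z, rfl⟩ := CohomologyClass.mk_surjective x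
    exact (map_syzClass (k := 0) (liftHom (P B) (P B') f) n (by simp) z.1
      ((mem_cocycle_iff z.1).1 z.2)).symm

lemma isIso_chainToExt (n : ℤ) : IsIso (chainToExt R P n) := by
  rw [NatTrans.isIso_iff_isIso_app]
  exact fun B => (ConcreteCategory.isIso_iff_bijective _).2 (chainToExtHom_bijective R n (P B))

variable {R P} {n : ℤ} {B : C}

/-- The element of the resolution construction given by the class at the `k`-th syzygy. -/
def resClass (k : ℕ) (Φ : Cochain R.cochainComplex (P B).cochainComplex n)
    (hΦ : Φ ∈ truncCocycles R (P B) n k) : (resFunctor (extStructure R) P n).obj B :=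
  resLeg (extStructure R) P n k (n + k) rfl B (syzClass (n + k) rfl Φ hΦ)

lemma resLeg_syzClass (k : ℕ) (m : ℤ) (hm : n + k = m)
    (Φ : Cochain R.cochainComplex (P B).cochainComplex n)
    (hΦ : Φ ∈ truncCocycles R (P B) n k) :
    resLeg (extStructure R) P n k m hm B (syzClass m hm Φ hΦ) = resClass k Φ hΦ := by
  subst hm
  rfl

lemma resClass_mono {k l : ℕ} (h : k ≤ l) (Φ : Cochain R.cochainComplex (P B).cochainComplex n)
    (hΦ : Φ ∈ truncCocycles R (P B) n k) :
    resClass l Φ (truncCocycles_mono h hΦ) = resClass k Φ hΦ := by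
  induction l, h using Nat.le_induction with
  | base => rfl
  | succ l h ih =>
    rw [← ih, ← resLeg_syzClass (l + 1) (n + l + 1) (by push_cast; ring),
      ← syzδ_syzClass (n + l) (n + l + 1) rfl rfl Φ (truncCocycles_mono h hΦ)]
    exact ConcreteCategory.congr_hom (syzδ_resLeg (extStructure R) P n l (n + l) (n + l + 1) rfl rfl
      B) (syzClass (n + l) rfl Φ (truncCocycles_mono h hΦ))

lemma resClass_add (k : ℕ) {Φ Ψ : Cochain R.cochainComplex (P B).cochainComplex n}
    (hΦ : Φ ∈ truncCocycles R (P B) n k) (hΨ : Ψ ∈ truncCocycles R (P B) n k) :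
    resClass k (Φ + Ψ) (add_mem hΦ hΨ) = resClass k Φ hΦ + resClass k Ψ hΨ :=
  (congrArg _ (syzClass_add (n + k) rfl hΦ hΨ)).trans (map_add _ _ _)

lemma resClass_eq {k l : ℕ} (Φ : Cochain R.cochainComplex (P B).cochainComplex n)
    (hΦ : Φ ∈ truncCocycles R (P B) n k) (hΦ' : Φ ∈ truncCocycles R (P B) n l) :
    resClass k Φ hΦ = resClass l Φ hΦ' :=
  (resClass_mono (le_max_left k l) Φ hΦ).symm.trans (resClass_mono (le_max_right k l) Φ hΦ')

lemma resSystem_map_syzClass {k l : ℕ} (h : k ≤ l)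
    (Φ : Cochain R.cochainComplex (P B).cochainComplex n) (hΦ : Φ ∈ truncCocycles R (P B) n k) :
    (resSystem (extStructure R) P n B).map (homOfLE h) (syzClass (n + k) rfl Φ hΦ) =
      syzClass (n + l) rfl Φ (truncCocycles_mono h hΦ) := by
  induction l, h using Nat.le_induction with
  | base => exact ConcreteCategory.congr_hom ((resSystem (extStructure R) P n B).map_id k) _
  | succ l h ih =>
    have h₁ : (resSystem (extStructure R) P n B).map (homOfLE (h.trans (Nat.le_succ l))) =
        (resSystem (extStructure R) P n B).map (homOfLE h) ≫
          (resSystem (extStructure R) P n B).map (homOfLE (Nat.le_add_right l 1)) :=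
      (resSystem (extStructure R) P n B).map_comp (homOfLE h) (homOfLE (Nat.le_add_right l 1))
    refine (ConcreteCategory.congr_hom h₁ _).trans ((congrArg _ ih).trans ?_)
    exact (ConcreteCategory.congr_hom (sysSystem_map_succ (extStructure R) (.ofRes (P B)) n l)
      _).trans (syzδ_syzClass (n + l) _ rfl _ Φ (truncCocycles_mono h hΦ))

/-- An almost chain map represents zero in the resolution construction if and only if it is
nullhomotopic in all but finitely many degrees. -/
lemma resClass_eq_zero_iff {k : ℕ} (Φ : Cochain R.cochainComplex (P B).cochainComplex n)
    (hΦ : Φ ∈ truncCocycles R (P B) n k) :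
    resClass k Φ hΦ = 0 ↔ Φ ∈ almostNull R.cochainComplex (P B).cochainComplex n := by
  rw [mem_almostNull]
  constructor
  · intro h
    obtain ⟨l, f, hl⟩ := exists_map_eq_zero_of_isColimit
      (colimit.isColimit (resSystem (extStructure R) P n B)) (k := k)
      (syzClass (n + k) rfl Φ hΦ) (by
        refine Eq.trans ?_ h
        exact (ConcreteCategory.congr_hom (sysLeg_self (extStructure R) (.ofRes (P B)) n k)
          (syzClass (n + k) rfl Φ hΦ)).symm)
    have hkl := leOfHom f
    obtain rfl : f = homOfLE hkl := Subsingleton.elim _ _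
    obtain ⟨e, he⟩ := exists_homotopy_of_syzClass_eq_zero (n + l) rfl Φ
      (truncCocycles_mono hkl hΦ) ((resSystem_map_syzClass hkl Φ hΦ).symm.trans hl)
    exact ⟨e, (mem_Bdd_iff _).2 ⟨l, he⟩⟩
  · rintro ⟨e, he⟩
    obtain ⟨l, hl⟩ := (mem_Bdd_iff _).1 he
    rw [← resClass_mono (le_max_left k l) Φ hΦ]
    exact (congrArg _ (syzClass_δ_eq_zero _ rfl Φ _ e (hl _ (le_max_right k l)))).trans
      (map_zero _)

variable (R P n B)

/-- The homomorphism sending an almost chain map to its class in the resolution construction. -/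
def almostToRes : almostCocycles R.cochainComplex (P B).cochainComplex n →+
    (resFunctor (extStructure R) P n).obj B :=
  AddMonoidHom.mk' (fun Φ => resClass ((mem_almostCocycles_iff Φ.1).1 Φ.2).choose Φ.1
      ((mem_almostCocycles_iff Φ.1).1 Φ.2).choose_spec) fun Φ Ψ => by
    obtain ⟨k, hk⟩ := (mem_almostCocycles_iff Φ.1).1 Φ.2
    obtain ⟨l, hl⟩ := (mem_almostCocycles_iff Ψ.1).1 Ψ.2
    rw [resClass_eq Φ.1 _ (truncCocycles_mono (le_max_left k l) hk),
      resClass_eq Ψ.1 _ (truncCocycles_mono (le_max_right k l) hl), ← resClass_add]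
    exact resClass_eq _ _ _

variable {R P n B} in
lemma almostToRes_eq {k : ℕ} (Φ : almostCocycles R.cochainComplex (P B).cochainComplex n)
    (hΦ : Φ.1 ∈ truncCocycles R (P B) n k) : almostToRes R P n B Φ = resClass k Φ.1 hΦ :=
  resClass_eq Φ.1 ((mem_almostCocycles_iff Φ.1).1 Φ.2).choose_spec hΦ

/-- The homomorphism sending the class of an almost chain map to its class in the resolution
construction. -/
def vogelToResHom : AlmostClass R.cochainComplex (P B).cochainComplex n →+
    (resFunctor (extStructure R) P n).obj B :=
  QuotientAddGroup.lift _ (almostToRes R P n B) fun Φ hΦ => by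
    obtain ⟨k, hk⟩ := (mem_almostCocycles_iff Φ.1).1 Φ.2
    exact (almostToRes_eq Φ hk).trans ((resClass_eq_zero_iff Φ.1 hk).2 hΦ)

variable {R P n B} in
lemma vogelToResHom_almostMk {k : ℕ} (Φ : Cochain R.cochainComplex (P B).cochainComplex n)
    (h : Φ ∈ almostCocycles R.cochainComplex (P B).cochainComplex n)
    (hΦ : Φ ∈ truncCocycles R (P B) n k) :
    vogelToResHom R P n B (almostMk Φ h) = resClass k Φ hΦ :=
  almostToRes_eq ⟨Φ, h⟩ hΦ

lemma vogelToResHom_bijective : Function.Bijective (vogelToResHom R P n B) := by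
  refine ⟨(injective_iff_map_eq_zero _).2 fun x hx => ?_, fun x => ?_⟩
  · obtain ⟨⟨Φ, h⟩, rfl⟩ := QuotientAddGroup.mk_surjective x
    obtain ⟨k, hk⟩ := (mem_almostCocycles_iff Φ).1 h
    have h0 := (vogelToResHom_almostMk Φ h hk).symm.trans hx
    exact (QuotientAddGroup.eq_zero_iff _).2 ((resClass_eq_zero_iff Φ hk).1 h0)
  · obtain ⟨k, y, rfl⟩ := Concrete.isColimit_exists_rep _
      (colimit.isColimit (resSystem (extStructure R) P n B)) x
    obtain ⟨Φ, hΦ, rfl⟩ := exists_syzClass_eq (Q := P B) (n := n) (k := k) (n + k) rfl y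
    have h := (mem_almostCocycles_iff Φ).2 ⟨k, hΦ⟩
    refine ⟨almostMk Φ h, (vogelToResHom_almostMk Φ h hΦ).trans ?_⟩
    exact ConcreteCategory.congr_hom (sysLeg_self (extStructure R) (.ofRes (P B)) n k)
      (syzClass (n + k) rfl Φ hΦ)

/-- The natural transformation from the hypercohomology construction to the resolution
construction. -/
def vogelToRes : vogel R P n ⟶ resFunctor (extStructure R) P n where
  app B := AddCommGrpCat.ofHom (vogelToResHom R P n B)
  naturality B B' f := by
    ext x
    obtain ⟨⟨Φ, h⟩, rfl⟩ := QuotientAddGroup.mk_surjective x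
    obtain ⟨k, hk⟩ := (mem_almostCocycles_iff Φ).1 h
    let l := liftHom (P B) (P B') f
    have h₁ := map_syzClass l (n + k) rfl Φ hk
    have h₂ := ConcreteCategory.congr_hom (resLeg_map (extStructure R) P n f (isSyzLift_homSyz l)
      rfl k (n + k) rfl) (syzClass (n + k) rfl Φ hk)
    have h₃ := vogelToResHom_almostMk Φ h hk
    have h₄ := vogelToResHom_almostMk _ (almostCocycles_comp_ofHom h l.hom')
      (comp_ofHom_mem_truncCocycles l hk)
    refine h₄.trans (Eq.trans ?_ (congrArg ((resFunctor (extStructure R) P n).map f) h₃).symm)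
    exact (congrArg _ h₁.symm).trans h₂.symm

lemma isIso_vogelToRes : IsIso (vogelToRes R P n) := by
  rw [NatTrans.isIso_iff_isIso_app]
  exact fun B => (ConcreteCategory.isIso_iff_bijective _).2 (vogelToResHom_bijective R P n B)

end Comparison

/-! ### The cohomology of the Vogel complex -/

section VogelCohomology

open CochainComplex CochainComplex.HomComplex

variable {C : Type u} [Category.{v} C] [Abelian C] (F G : CochainComplex C ℤ) (n : ℤ)

/-- The cycle of the Vogel complex represented by an almost chain map. -/
def almostToCycles : AddCommGrpCat.of (almostCocycles F G n) ⟶ (vogelComplex F G).cycles n :=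
  (vogelComplex F G).liftCycles (AddCommGrpCat.ofHom
    ((QuotientAddGroup.mk' (Bdd F G n)).comp (almostCocycles F G n).subtype)) (n + 1)
    (CochainComplex.next ℤ n) (by
      ext φ
      exact (QuotientAddGroup.eq_zero_iff _).2 φ.2)

lemma iCycles_almostToCycles (φ : almostCocycles F G n) :
    (vogelComplex F G).iCycles n (almostToCycles F G n φ) =
      QuotientAddGroup.mk (s := Bdd F G n) φ.1 :=
  ConcreteCategory.congr_hom ((vogelComplex F G).liftCycles_i (AddCommGrpCat.ofHom
    ((QuotientAddGroup.mk' (Bdd F G n)).comp (almostCocycles F G n).subtype)) (n + 1)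
    (CochainComplex.next ℤ n) _) φ

lemma homologyπ_almostToCycles_eq_zero_iff (φ : almostCocycles F G n) :
    (vogelComplex F G).homologyπ n (almostToCycles F G n φ) = 0 ↔ φ.1 ∈ almostNull F G n := by
  rw [homologyπ_eq_zero_iff (vogelComplex F G) (n - 1) n (by lia), iCycles_almostToCycles,
    mem_almostNull]
  constructor
  · rintro ⟨y, hy⟩
    obtain ⟨e, rfl⟩ := QuotientAddGroup.mk_surjective y
    refine ⟨e, ?_⟩
    rw [← neg_add_eq_sub]
    exact QuotientAddGroup.eq.1 hy
  · rintro ⟨e, he⟩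
    refine ⟨QuotientAddGroup.mk (s := Bdd F G (n - 1)) e, QuotientAddGroup.eq.2 ?_⟩
    rw [neg_add_eq_sub]
    exact he

/-- The homomorphism from almost chain maps modulo nullhomotopic ones to the cohomology of the
Vogel complex. -/
def almostToHomology : AlmostClass F G n →+ (vogelComplex F G).homology n :=
  QuotientAddGroup.lift _
    (AddCommGrpCat.Hom.hom (almostToCycles F G n ≫ (vogelComplex F G).homologyπ n))
    fun φ hφ => (homologyπ_almostToCycles_eq_zero_iff F G n φ).2 hφ

variable {F G n} in
lemma homologyπ_eq_almostToHomology (c : (vogelComplex F G).cycles n) (φ : Cochain F G n)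
    (h : (vogelComplex F G).iCycles n c = QuotientAddGroup.mk (s := Bdd F G n) φ) :
    ∃ hφ : φ ∈ almostCocycles F G n,
      (vogelComplex F G).homologyπ n c = almostToHomology F G n (almostMk φ hφ) := by
  have h₁ : (vogelComplex F G).d n (n + 1) (QuotientAddGroup.mk (s := Bdd F G n) φ) = 0 := by
    rw [← h]
    exact ConcreteCategory.congr_hom ((vogelComplex F G).iCycles_d n (n + 1)) c
  have hφ : φ ∈ almostCocycles F G n :=
    (QuotientAddGroup.eq_zero_iff (N := Bdd F G (n + 1)) (δ n (n + 1) φ)).1 h₁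
  refine ⟨hφ, congrArg _ (iCycles_injective _ n ?_)⟩
  exact h.trans (iCycles_almostToCycles F G n ⟨φ, hφ⟩).symm

lemma almostToHomology_bijective : Function.Bijective (almostToHomology F G n) := by
  refine ⟨(injective_iff_map_eq_zero _).2 fun x hx => ?_, fun x => ?_⟩
  · obtain ⟨φ, rfl⟩ := QuotientAddGroup.mk_surjective x
    exact (QuotientAddGroup.eq_zero_iff _).2 ((homologyπ_almostToCycles_eq_zero_iff F G n φ).1 hx)
  · obtain ⟨c, rfl⟩ := homologyπ_surjective _ n x
    obtain ⟨φ, hφ⟩ := QuotientAddGroup.mk_surjective ((vogelComplex F G).iCycles n c)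
    obtain ⟨h, h'⟩ := homologyπ_eq_almostToHomology c φ hφ.symm
    exact ⟨_, h'.symm⟩

lemma isVogelCohomology {A : C} (R : ProjectiveResolution A)
    (P : ∀ X : C, ProjectiveResolution X) : IsVogelCohomology R P := fun B n => by
  let f : (vogel R P n).obj B ⟶
      (vogelComplex R.cochainComplex (P B).cochainComplex).homology n :=
    AddCommGrpCat.ofHom (almostToHomology R.cochainComplex (P B).cochainComplex n)
  have hf : IsIso f := (ConcreteCategory.isIso_iff_bijective f).2 (almostToHomology_bijective _ _ n)
  refine ⟨(asIso f).symm, fun c φ h => ?_⟩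
  obtain ⟨hφ, h'⟩ := homologyπ_eq_almostToHomology c φ h
  refine ⟨hφ, ?_⟩
  rw [h']
  exact ConcreteCategory.congr_hom (asIso f).hom_inv_id (almostMk φ hφ)

end VogelCohomology

/-! ### The explicit formulae for connecting homomorphisms and comparison maps -/

section Formulae

open CochainComplex CochainComplex.HomComplex

variable {C : Type u} [Category.{v} C] [Abelian C]

lemma shift_π_f_zero {X : C} (Q : ProjectiveResolution X) (k : ℕ) :
    (shift Q k).π.f 0 = syzπ Q k :=
  ChainComplex.toSingle₀Equiv_symm_apply_f_zero (C := shiftComplex Q.complex k) (syzπ Q k)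
    (d_syzπ Q k)

section Conn

/-- The term `Q_{j + 1}` as the `j`-th term of the resolution `Q_{• + 1}`. -/
def shiftOneIso {X : C} (Q : ProjectiveResolution X) (j : ℕ) :
    Q.complex.X (j + 1) ≅ (shift Q 1).complex.X j :=
  Q.complex.XIsoOfEq (Nat.add_comm j 1) ≪≫ shiftXIso Q 1 j

lemma shiftOneIso_d {X : C} (Q : ProjectiveResolution X) (j : ℕ) :
    (shiftOneIso Q (j + 1)).hom ≫ (shift Q 1).complex.d (j + 1) j =
      Q.complex.d (j + 2) (j + 1) ≫ (shiftOneIso Q j).hom := by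
  have h₁ : (shiftOneIso Q (j + 1)).hom = (Q.complex.XIsoOfEq (Nat.add_comm (j + 1) 1)).hom :=
    Category.comp_id _
  have h₂ : (shiftOneIso Q j).hom = (Q.complex.XIsoOfEq (Nat.add_comm j 1)).hom :=
    Category.comp_id _
  rw [h₁, h₂]
  exact (HomologicalComplex.XIsoOfEq_hom_comp_d _ _ _).trans
    (HomologicalComplex.d_comp_XIsoOfEq_hom _ _ _).symm

lemma shiftProj_v {X : C} (Q : ProjectiveResolution X) (n : ℤ) (j : ℕ) (p : ℤ) (hp : p + 1 = -j) :
    (shiftProj Q n).v p (-j) hp ≫ ((shift Q 1).cochainComplexXIso (-j) j rfl).hom =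
      (n + j).negOnePow • (Q.cochainComplexXIso p (j + 1) (by push_cast; lia)).hom ≫
        (shiftOneIso Q j).hom := by
  have e : ∀ (i i' : ℕ) (e : i = i') (hi : -(i : ℤ) = p), (Q.cochainComplexXIso p i' (by lia)).hom =
      (Q.cochainComplexXIso p i hi).hom ≫ (Q.complex.XIsoOfEq e).hom := by
    rintro i _ rfl hi
    simp
  have key : ∀ (j' : ℕ) (_ : j' = j), ((n - -j).negOnePow •
      ((Q.cochainComplexXIso p (1 + j') (by lia)).hom ≫ (shiftXIso Q 1 j').hom ≫
        ((shift Q 1).cochainComplexXIso (-j) j' (by lia)).inv)) ≫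
      ((shift Q 1).cochainComplexXIso (-j) j rfl).hom =
      (n + j).negOnePow • (Q.cochainComplexXIso p (j + 1) (by push_cast; lia)).hom ≫
        (shiftOneIso Q j).hom := by
    intro j' e'
    subst e'
    rw [e (j' + 1) (1 + j') (Nat.add_comm j' 1) (by push_cast; lia), sub_neg_eq_add,
      Linear.units_smul_comp]
    simp only [Category.assoc, Iso.inv_hom_id, shiftOneIso, Iso.trans_hom]
    exact congrArg ((n + (j' : ℤ)).negOnePow • ·) (congrArg (_ ≫ _ ≫ ·) (Category.comp_id _))
  rw [shiftProj, Cochain.mk_v, dif_pos (by lia)]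
  exact key _ (by lia)

variable {X Y : C} {Q : ProjectiveResolution X} {Q' : ProjectiveResolution Y} {f : syz Q 1 ⟶ Y}
  (h : ProjectiveResolution.Hom (shift Q 1) Q' f)

/-- The component `Q_{j + 1} ⟶ Q'_j` of a chain map from the shifted resolution. -/
def unshiftHom (j : ℕ) : Q.complex.X (j + 1) ⟶ Q'.complex.X j :=
  (shiftOneIso Q j).hom ≫ h.hom.f j

lemma unshiftHom_d (j : ℕ) : unshiftHom h (j + 1) ≫ Q'.complex.d (j + 1) j =
    Q.complex.d (j + 2) (j + 1) ≫ unshiftHom h j := by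
  rw [unshiftHom, unshiftHom, Category.assoc, h.hom.comm, reassoc_of% shiftOneIso_d]

lemma unshiftHom_zero_syzπ : unshiftHom h 0 ≫ syzπ Q' 0 = syzπ Q 1 ≫ f := by
  have h₁ := h.hom_f_zero_comp_π_f_zero
  rw [shift_π_f_zero, ChainComplex.single₀_map_f_zero] at h₁
  refine Eq.trans (congrArg (· ≫ syzπ Q' 0) ?_) h₁
  have h₂ : (shiftOneIso Q 0).hom = 𝟙 (Q.complex.X 1) :=
    (Category.comp_id _).trans (congrArg Iso.hom (HomologicalComplex.XIsoOfEq_rfl Q.complex 1))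
  exact (congrArg (· ≫ h.hom.f 0) h₂).trans (Category.id_comp (h.hom.f 0))

/-- Auxiliary recursion for `unshiftSyz`. -/
def unshiftSyzAux : ∀ k, { s : syz Q (k + 1) ⟶ syz Q' k //
    unshiftHom h k ≫ syzπ Q' k = syzπ Q (k + 1) ≫ s }
  | 0 => ⟨f, unshiftHom_zero_syzπ h⟩
  | k + 1 => ⟨syzLift Q' k (syzι Q (k + 1) ≫ unshiftHom h k) (by
      rw [Category.assoc, (unshiftSyzAux k).2, ← Category.assoc, syzι_π, zero_comp]), by
      rw [← cancel_mono (syzι Q' k), Category.assoc, syzπ_ι, Category.assoc, syzLift_ι,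
        ← Category.assoc, syzπ_ι, unshiftHom_d]⟩

/-- The morphisms from the `(k + 1)`-st syzygies to the `k`-th syzygies induced by a chain map from
the shifted resolution. -/
def unshiftSyz (k : ℕ) : syz Q (k + 1) ⟶ syz Q' k := (unshiftSyzAux h k).1

lemma unshiftHom_syzπ (k : ℕ) :
    unshiftHom h k ≫ syzπ Q' k = syzπ Q (k + 1) ≫ unshiftSyz h k := (unshiftSyzAux h k).2

lemma isLift_unshiftSyz :
    SyzSystem.IsLift (SyzSystem.ofRes Q).tail (SyzSystem.ofRes Q') (unshiftSyz h) :=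
  fun k => ⟨unshiftHom h k, unshiftHom_syzπ h k, (syzLift_ι _ _ _ _).symm⟩

end Conn

variable {A : C} {R : ProjectiveResolution A} {P : ∀ X : C, ProjectiveResolution X}

section Connecting

variable {S : ShortComplex C} {h₁ : syz (P S.X₃) 1 ⟶ S.X₁}
  (h : ProjectiveResolution.Hom (shift (P S.X₃) 1) (P S.X₁) h₁) (n₀ n₁ : ℤ) (hn : n₀ + 1 = n₁)

lemma term_connCochain (φ : Cochain R.cochainComplex (P S.X₃).cochainComplex n₀) (j : ℕ) (p : ℤ)
    (hp : p + n₁ = -j) : term (connCochain R P h n₀ n₁ hn φ) j p hp =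
      (n₀ + j).negOnePow • term φ (j + 1) p (by push_cast; lia) ≫ unshiftHom h j := by
  rw [term_eq φ p (p + n₀) rfl (j + 1) (by push_cast; lia)]
  have h₂ := shiftProj_v (P S.X₃) n₀ j (p + n₀) (by lia)
  simp only [term, connCochain, Cochain.comp_zero_cochain_v, Cochain.ofHom_v,
    Cochain.comp_v φ (shiftProj (P S.X₃) n₀) hn p (p + n₀) (-j) rfl (by lia), h.hom'_f (-j) j rfl,
    Category.assoc, Iso.inv_hom_id, Category.comp_id, unshiftHom, reassoc_of% h₂,
    Linear.comp_units_smul, Linear.units_smul_comp]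

lemma connCochain_mem_truncCocycles {φ : Cochain R.cochainComplex (P S.X₃).cochainComplex n₀}
    {k : ℕ} (hφ : φ ∈ truncCocycles R (P S.X₃) n₀ (k + 1)) :
    connCochain R P h n₀ n₁ hn φ ∈ truncCocycles R (P S.X₁) n₁ k := fun j hj p hp => by
  rw [term_δ_eq_zero_iff _ j p (p + 1) hp rfl, term_connCochain, term_connCochain,
    Linear.units_smul_comp, Category.assoc, unshiftHom_d,
    reassoc_of% (term_square hφ (j + 1) (by omega) p (p + 1) (by push_cast; omega) rfl),
    Linear.units_smul_comp, Linear.comp_units_smul, smul_smul, smul_smul, Category.assoc]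
  congr 1
  rw [← Int.negOnePow_add, ← Int.negOnePow_add]
  congr 1
  push_cast
  omega

/-- The formula for the connecting homomorphism, in terms of classes at syzygies. -/
lemma map_unshiftSyz_syzClass (k : ℕ) (m : ℤ) (h₀ : n₀ + (k + 1 : ℕ) = m) (h₁ : n₁ + k = m)
    (φ : Cochain R.cochainComplex (P S.X₃).cochainComplex n₀)
    (hφ : φ ∈ truncCocycles R (P S.X₃) n₀ (k + 1)) :
    (extFunctor R m).map (unshiftSyz h k) (syzClass m h₀ φ hφ) =
      syzClass m h₁ (connCochain R P h n₀ n₁ hn φ)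
        (connCochain_mem_truncCocycles h n₀ n₁ hn hφ) := by
  refine (extFunctor_map_extMk R _ _ _ _).trans (extMk_congr ?_ _)
  rw [term_connCochain, Linear.units_smul_comp, Linear.units_smul_comp, Category.assoc,
    Category.assoc, unshiftHom_syzπ, smul_smul, ← Int.negOnePow_add]
  congr 1
  -- the exponents `k * n₁ + (n₀ + k)` and `(k + 1) * n₀` differ by `2 * k`
  rw [Int.negOnePow_eq_iff]
  refine ⟨-k, ?_⟩
  subst hn
  push_cast
  ring

end Connecting

section Theta

lemma term_comp_unshift {X : C} {Q : ProjectiveResolution X} {F : CochainComplex C ℤ} {m n : ℤ}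
    {l : ℕ} (hn : m + -l = n) (ψ : Cochain F (shift Q l).cochainComplex m) (i : ℕ) (p : ℤ)
    (hp : p + n = -(l + i : ℕ)) :
    term (ψ.comp (unshift Q l) hn) (l + i) p hp =
      term ψ i p (by push_cast at hp; omega) ≫ (shiftXIso Q l i).inv := by
  have key : ∀ (i' : ℕ) (_ : i' = i), (((shift Q l).cochainComplexXIso (-i) i' (by omega)).hom ≫
      (shiftXIso Q l i').inv ≫ (Q.cochainComplexXIso (-(l + i : ℕ)) (l + i') (by omega)).inv) ≫
        (Q.cochainComplexXIso (-(l + i : ℕ)) (l + i) rfl).hom =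
      ((shift Q l).cochainComplexXIso (-i) i rfl).hom ≫ (shiftXIso Q l i).inv := by
    intro i' e
    subst e
    simp
  have h₁ : (unshift Q l).v (-i) (-(l + i : ℕ)) (by push_cast; omega) ≫
      (Q.cochainComplexXIso (-(l + i : ℕ)) (l + i) rfl).hom =
      ((shift Q l).cochainComplexXIso (-i) i rfl).hom ≫ (shiftXIso Q l i).inv := by
    rw [unshift, Cochain.mk_v, dif_pos (by omega)]
    exact key _ (by omega)
  unfold term
  rw [Cochain.comp_v ψ (unshift Q l) hn p (-i) (-(l + i : ℕ)) (by push_cast at hp; omega)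
    (by push_cast; omega), Category.assoc, Category.assoc, h₁]

lemma comp_unshift_mem_truncCocycles {X : C} {Q : ProjectiveResolution X} {m n : ℤ} {k : ℕ}
    (hn : m + -(2 * k : ℕ) = n)
    (ψ : Cocycle R.cochainComplex (shift Q (2 * k)).cochainComplex m) :
    ψ.1.comp (unshift Q (2 * k)) hn ∈ truncCocycles R Q n (2 * k) := fun j hj p hp => by
  obtain ⟨i, rfl⟩ := Nat.exists_eq_add_of_le hj
  have h₁ := term_square ((mem_cocycle_iff ψ.1).1 ψ.2) i (Nat.zero_le i) p (p + 1)
    (by push_cast at hp; omega) rfl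
  rw [term_δ_eq_zero_iff _ _ p (p + 1) hp rfl, term_comp_unshift hn ψ.1 i]
  -- the degree is lowered by an even number, so the signs of the squares do not change
  have hs : n.negOnePow = m.negOnePow := by
    rw [Int.negOnePow_eq_iff]
    exact ⟨-k, by push_cast at hn; omega⟩
  rw [hs]
  refine Eq.trans ?_ (h₁.trans (congrArg (m.negOnePow • _ ≫ ·) (Category.comp_id _).symm))
  have h₂ := term_comp_unshift hn ψ.1 (i + 1) p (by push_cast at hp ⊢; omega)
  exact congrArg (· ≫ Q.complex.d (2 * k + i + 1) (2 * k + i)) (h₂.trans (Category.comp_id _))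

/-- The class at the `2k`-th syzygy of the extension by zero of a chain map `φ` to a resolution of
that syzygy is the class of `φ` itself. -/
lemma syzClass_comp_unshift {B : C} {m n : ℤ} {k : ℕ} (hm : n + (2 * k : ℕ) = m)
    (hn : m + -(2 * k : ℕ) = n)
    {Q : ProjectiveResolution B} {Q' : ProjectiveResolution (syz Q (2 * k))}
    (c : ProjectiveResolution.Hom Q' (shift Q (2 * k)) (𝟙 _))
    (φ : Cocycle R.cochainComplex Q'.cochainComplex m) :
    syzClass m hm ((φ.postcomp c.hom').1.comp (unshift Q (2 * k)) hn)
      (comp_unshift_mem_truncCocycles hn (φ.postcomp c.hom')) =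
    syzClass (k := 0) m (by simp) φ.1 ((mem_cocycle_iff φ.1).1 φ.2) := by
  refine extMk_congr ?_ _
  have h₁ := term_comp_unshift hn (φ.postcomp c.hom').1 0 (-m) (by push_cast; omega)
  have h₂ := term_comp_ofHom c φ.1 0 (-m) (by simp)
  have h₃ := c.hom_f_zero_comp_π_f_zero
  rw [shift_π_f_zero, ChainComplex.single₀_map_f_zero] at h₃
  have h₄ : ((2 * k : ℕ) * n).negOnePow = (((0 : ℕ) : ℤ) * m).negOnePow := by
    rw [Int.negOnePow_eq_iff]
    exact ⟨k * n, by push_cast; ring⟩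
  rw [h₄]
  refine congrArg (_ • ·) ?_
  refine (congrArg (· ≫ syzπ Q (2 * k)) (h₁.trans (Category.comp_id _))).trans ?_
  refine (congrArg (· ≫ syzπ Q (2 * k)) h₂).trans ((Category.assoc _ _ _).trans ?_)
  exact congrArg (term φ.1 0 (-m) _ ≫ ·) (h₃.trans (Category.comp_id _))

end Theta

end Formulae

/-! ### The cohomological functors of chain maps and of almost chain maps -/

section Structures

open CochainComplex CochainComplex.HomComplex

variable {C : Type u} [Category.{v} C] [Abelian C] {A : C} (R : ProjectiveResolution A)
  (P : ∀ X : C, ProjectiveResolution X)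

/-- The isomorphism `Ext^n(A, -) ≅ 𝓔xt^n(A, -)`. -/
def extIsoChain (n : ℤ) : extFunctor R n ≅ chainExt R P n :=
  have := isIso_chainToExt R P n
  (asIso (chainToExt R P n)).symm

/-- The isomorphism from the resolution construction to the hypercohomology construction. -/
def resIsoVogel (n : ℤ) : resFunctor (extStructure R) P n ≅ vogel R P n :=
  have := isIso_vogelToRes R P n
  (asIso (vogelToRes R P n)).symm

/-- `𝓔xt^•(A, -)` as a cohomological functor. -/
def chainStructure : CohStructure (chainExt R P) := (extStructure R).transport (extIsoChain R P)

/-- The hypercohomology construction as a cohomological functor. -/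
def vogelStructure : CohStructure (vogel R P) :=
  (resStructure (extStructure R) P).transport (resIsoVogel R P)

variable {R P}

lemma extIsoChain_hom_app_eq {n : ℤ} {B : C} {x : (extFunctor R n).obj B}
    {z : Cocycle R.cochainComplex (P B).cochainComplex n}
    (h : syzClass (k := 0) n (by simp) z.1 ((mem_cocycle_iff z.1).1 z.2) = x) :
    (extIsoChain R P n).hom.app B x = CohomologyClass.mk z := by
  subst h
  have h := congrArg (fun τ => τ.app B) (extIsoChain R P n).inv_hom_id
  exact ConcreteCategory.congr_hom (C := AddCommGrpCat.{v}) h (CohomologyClass.mk z)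

lemma resIsoVogel_hom_app_eq {n : ℤ} {B : C} {k : ℕ}
    {x : (resFunctor (extStructure R) P n).obj B}
    {Φ : Cochain R.cochainComplex (P B).cochainComplex n} (hΦ : Φ ∈ truncCocycles R (P B) n k)
    (h : resClass k Φ hΦ = x) :
    (resIsoVogel R P n).hom.app B x = almostMk Φ ((mem_almostCocycles_iff Φ).2 ⟨k, hΦ⟩) := by
  subst h
  rw [← vogelToResHom_almostMk Φ ((mem_almostCocycles_iff Φ).2 ⟨k, hΦ⟩)]
  have h := congrArg (fun τ => τ.app B) (resIsoVogel R P n).inv_hom_id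
  exact ConcreteCategory.congr_hom (C := AddCommGrpCat.{v}) h
    (almostMk Φ ((mem_almostCocycles_iff Φ).2 ⟨k, hΦ⟩))

lemma syzClass_of_liftsCocycle {n : ℤ} {B : C} {φ : R.cochainComplex.X (-n) ⟶ B}
    {hφ : R.cochainComplex.d (-(n + 1)) (-n) ≫ φ = 0}
    {z : Cocycle R.cochainComplex (P B).cochainComplex n} (h : LiftsCocycle R P n φ z) :
    syzClass (k := 0) n (by simp) z.1 ((mem_cocycle_iff z.1).1 z.2) = extMk R n φ hφ := by
  refine extMk_congr ?_ _
  rw [term_eq z.1 (-n) 0 (neg_add_cancel n) 0 rfl, Category.assoc]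
  simp only [Nat.cast_zero, zero_mul, Int.negOnePow_zero, one_smul]
  exact h

lemma exists_liftsCocycle {n : ℤ} {B : C} (φ : R.cochainComplex.X (-n) ⟶ B)
    (hφ : R.cochainComplex.d (-(n + 1)) (-n) ≫ φ = 0) : ∃ z, LiftsCocycle R P n φ z := by
  obtain ⟨Φ, h₁, -, h₃⟩ := exists_cochain_of_syz (F := R.cochainComplex) (Q := P B) n 0
    (fun p hp => (R.cochainComplex.XIsoOfEq (show p = -n by omega)).hom ≫ φ) (fun p p' h => by
      obtain rfl : p' = -n := by omega
      by_cases hp : p + 1 = -n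
      · obtain rfl : p = -(n + 1) := by omega
        exact (congrArg (_ ≫ ·) (Category.id_comp φ)).trans hφ
      · rw [R.cochainComplex.shape _ _ hp, zero_comp])
  refine ⟨⟨Φ, (mem_cocycle_iff Φ).2 h₃⟩, ?_⟩
  have h₄ := h₁ (-n) (by simp)
  rw [term_eq Φ (-n) 0 (neg_add_cancel n) 0 rfl, Category.assoc] at h₄
  exact h₄.trans (Category.id_comp φ)

lemma isZeta_extIsoChain : IsZeta R P fun n => (extIsoChain R P n).hom := fun _ _ φ hφ =>
  ⟨exists_liftsCocycle φ hφ, fun _ hz =>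
    extIsoChain_hom_app_eq (syzClass_of_liftsCocycle (hφ := hφ) hz)⟩

lemma isChainConnecting_chainStructure : IsChainConnecting R P (chainStructure R P) :=
  fun S hS => ⟨exists_isLiftOfId hS (P S.X₃), fun h₁ hh₁ => ⟨⟨liftHom _ _ h₁⟩,
    fun h n₀ n₁ hn φ => by
      have hφ : φ.1 ∈ truncCocycles R (P S.X₃) n₀ 0 := (mem_cocycle_iff φ.1).1 φ.2
      have hφ' := truncCocycles_mono (Nat.zero_le (0 + 1)) hφ
      refine ⟨(mem_cocycle_iff _).2 (connCochain_mem_truncCocycles h n₀ n₁ hn hφ'), ?_⟩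
      refine extIsoChain_hom_app_eq (Eq.trans ?_ (ConcreteCategory.congr_hom
        (syzδ_map_of_isLiftOfId (extStructure R) hS hh₁ n₀ n₁ hn) _))
      refine (map_unshiftSyz_syzClass h n₀ n₁ hn 0 n₁ (by simpa using hn) (by simp) φ.1
        hφ').symm.trans ?_
      exact congrArg ((extFunctor R n₁).map h₁)
        (syzδ_syzClass n₀ n₁ (by simp) hn φ.1 hφ).symm⟩⟩

lemma isVogelConnecting_vogelStructure : IsVogelConnecting R P (vogelStructure R P) :=
  fun S hS => ⟨exists_isLiftOfId hS (P S.X₃), fun h₁ hh₁ => ⟨⟨liftHom _ _ h₁⟩,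
    fun h n₀ n₁ hn φ hφ => by
      obtain ⟨k, hk⟩ := (mem_almostCocycles_iff φ).1 hφ
      have hk' := truncCocycles_mono (Nat.le_succ k) hk
      have hconn := connCochain_mem_truncCocycles h n₀ n₁ hn hk'
      refine ⟨(mem_almostCocycles_iff _).2 ⟨k, hconn⟩, resIsoVogel_hom_app_eq hconn ?_⟩
      have e₁ := ConcreteCategory.congr_hom (resLeg_succ_resConn (extStructure R) hS
        (isLift_unshiftSyz h) hh₁ n₀ n₁ hn k (n₁ + k) (by push_cast; omega) rfl)
          (syzClass (n₁ + k) (by push_cast; omega) φ hk')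
      have e₂ : vogelToResHom R P n₀ S.X₃ (almostMk φ hφ) =
          resLeg (extStructure R) P n₀ (k + 1) (n₁ + k) (by push_cast; omega) S.X₃
            (syzClass (n₁ + k) (by push_cast; omega) φ hk') :=
        (vogelToResHom_almostMk φ hφ hk').trans (resLeg_syzClass (k + 1) _ _ φ hk').symm
      refine Eq.trans ?_ (e₁.symm.trans (congrArg (resConn (extStructure R) P hS n₀ n₁ hn)
        e₂.symm))
      exact congrArg (resLeg (extStructure R) P n₁ k (n₁ + k) rfl S.X₁)
        (map_unshiftSyz_syzClass h n₀ n₁ hn k (n₁ + k) _ rfl φ hk').symm⟩⟩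

variable (R P)

lemma isCohIso_extIsoChain :
    IsCohIso (extStructure R) (chainStructure R P) fun n => (extIsoChain R P n).hom :=
  ⟨(extStructure R).isCohMorphism_transport _, fun _ => inferInstance⟩

lemma isCohIso_resIsoVogel : IsCohIso (resStructure (extStructure R) P) (vogelStructure R P)
    fun n => (resIsoVogel R P n).hom :=
  ⟨(resStructure (extStructure R) P).isCohMorphism_transport _, fun _ => inferInstance⟩

/-- The direct limit of the isomorphisms `Ext^{n + k}(A, -) ≅ 𝓔xt^{n + k}(A, -)` at the
syzygies. -/
def resZeta (n : ℤ) :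
    resFunctor (extStructure R) P n ⟶ resFunctor (chainStructure R P) P n :=
  resMap P (isCohIso_extIsoChain R P).1 n

lemma isCohIso_resZeta : IsCohIso (resStructure (extStructure R) P)
    (resStructure (chainStructure R P) P) (resZeta R P) :=
  have := (isCohIso_extIsoChain R P).2
  ⟨isCohMorphism_resMap P _, isIso_resMap P _⟩

lemma isResZeta_resZeta :
    IsResZeta R P (chainStructure R P) (fun n => (extIsoChain R P n).hom) (resZeta R P) :=
  fun n k m hm B => resLeg_resMap P _ n k m hm B

/-- The comparison map from the resolution construction of `𝓔xt^•(A, -)` to the hypercohomology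
construction. -/
def theta (n : ℤ) : resFunctor (chainStructure R P) P n ⟶ vogel R P n :=
  have := (isCohIso_resZeta R P).2
  inv (resZeta R P n) ≫ (resIsoVogel R P n).hom

lemma resZeta_theta (n : ℤ) : resZeta R P n ≫ theta R P n = (resIsoVogel R P n).hom := by
  have := (isCohIso_resZeta R P).2
  exact IsIso.hom_inv_id_assoc _ _

lemma isCohIso_theta :
    IsCohIso (resStructure (chainStructure R P) P) (vogelStructure R P) (theta R P) :=
  have := (isCohIso_resZeta R P).2
  IsCohIso.comp ⟨(isCohIso_resZeta R P).1.inv, fun _ => inferInstance⟩ (isCohIso_resIsoVogel R P)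

lemma isTheta_theta : IsTheta R P (chainStructure R P) (theta R P) := fun n k m hm B =>
  ⟨⟨liftHom _ _ _⟩, fun c φ => by
    have hn : m + -(2 * k : ℕ) = n := by omega
    have hΦ := comp_unshift_mem_truncCocycles hn (φ.postcomp c.hom')
    refine ⟨(mem_almostCocycles_iff _).2 ⟨_, hΦ⟩, ?_⟩
    let x : (extFunctor R m).obj (syz (P B) (2 * k)) :=
      syzClass (k := 0) m (by simp) φ.1 ((mem_cocycle_iff φ.1).1 φ.2)
    have h₁ : (extIsoChain R P m).hom.app _ x = CohomologyClass.mk φ := extIsoChain_hom_app_eq rfl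
    have h₂ := ConcreteCategory.congr_hom (isResZeta_resZeta R P n (2 * k) m hm B) x
    have h₃ := ConcreteCategory.congr_hom (congrArg (fun τ => τ.app B) (resZeta_theta R P n))
      (resLeg (extStructure R) P n (2 * k) m hm B x)
    have h₄ : (resIsoVogel R P n).hom.app B (resLeg (extStructure R) P n (2 * k) m hm B x) = _ :=
      resIsoVogel_hom_app_eq hΦ ((resLeg_syzClass (2 * k) m hm _ hΦ).symm.trans
        (congrArg _ (syzClass_comp_unshift hm hn c φ)))
    refine Eq.trans ?_ (h₃.trans h₄)
    exact congrArg ((theta R P n).app B) (((congrArg (resLeg (chainStructure R P) P n (2 * k) m hm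
      B) h₁).symm).trans h₂.symm)⟩

/-- The canonical map to the resolution construction followed by the isomorphism to the
hypercohomology construction regards a chain map as an almost chain map. -/
lemma resUnit_resIsoVogel (n : ℤ) (B : C) :
    (resUnit (extStructure R) P n).app B ≫ (resIsoVogel R P n).hom.app B =
      (extIsoChain R P n).hom.app B ≫
        AddCommGrpCat.ofHom (chainToAlmost R.cochainComplex (P B).cochainComplex n) := by
  ext x
  obtain ⟨φ, hφ, rfl⟩ := extMk_surjective R n x
  obtain ⟨z, hz⟩ := exists_liftsCocycle (P := P) φ hφ
  have h₁ := syzClass_of_liftsCocycle (hφ := hφ) hz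
  have h₂ := extIsoChain_hom_app_eq h₁
  have h₃ := (mem_cocycle_iff z.1).1 z.2
  have h₄ := resIsoVogel_hom_app_eq h₃ ((resLeg_syzClass 0 n (add_zero n) z.1 h₃).symm.trans
    (congrArg _ h₁))
  exact h₄.trans (congrArg (chainToAlmost R.cochainComplex (P B).cochainComplex n) h₂).symm

end Structures

end

end Mislin

theorem mainTheorem4 {C : Type u} [Category.{v} C] [Abelian C] [EnoughProjectives C]
    (P : ∀ X : C, ProjectiveResolution X) (A : C) (R : ProjectiveResolution A) :
    Mislin.IsVogelCohomology R P ∧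
    ∃ (Δ : Mislin.CohStructure (Mislin.chainExt R P))
      (Δhat : Mislin.CohStructure (Mislin.vogel R P))
      (δsat : Mislin.CohStructure (Mislin.satFunctor P (Mislin.extStructure R)))
      (δres : Mislin.CohStructure (Mislin.resFunctor (Mislin.extStructure R) P))
      (Δres : Mislin.CohStructure (Mislin.resFunctor Δ P))
      (ζ : ∀ n, Mislin.extFunctor R n ⟶ Mislin.chainExt R P n)
      (ω : ∀ n, Mislin.satFunctor P (Mislin.extStructure R) n ⟶
        Mislin.resFunctor (Mislin.extStructure R) P n)
      (ζR : ∀ n, Mislin.resFunctor (Mislin.extStructure R) P n ⟶ Mislin.resFunctor Δ P n)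
      (ϑ : ∀ n, Mislin.resFunctor Δ P n ⟶ Mislin.vogel R P n)
      (ν : ∀ n, Mislin.extFunctor R n ⟶ Mislin.vogel R P n),
      -- explicit formulae for the connecting homomorphisms
      (Mislin.IsChainConnecting R P Δ ∧ Mislin.IsVogelConnecting R P Δhat ∧
        Mislin.IsSatConnecting P (Mislin.extStructure R) δsat ∧
        Mislin.IsResConnecting (Mislin.extStructure R) P δres ∧
        Mislin.IsResConnecting Δ P Δres) ∧
      -- explicit formulae for the comparison maps
      (Mislin.IsZeta R P ζ ∧ Mislin.IsSatComparison P (Mislin.extStructure R) ω ∧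
        Mislin.IsResZeta R P Δ ζ ζR ∧ Mislin.IsTheta R P Δ ϑ) ∧
      -- they are isomorphisms of cohomological functors
      (Mislin.IsCohIso (Mislin.extStructure R) Δ ζ ∧ Mislin.IsCohIso δsat δres ω ∧
        Mislin.IsCohIso δres Δres ζR ∧ Mislin.IsCohIso Δres Δhat ϑ ∧
        Mislin.IsCohIso δres Δhat (fun n => ζR n ≫ ϑ n) ∧
        Mislin.IsCohIso δsat Δhat (fun n => ω n ≫ ζR n ≫ ϑ n)) ∧
      -- the hypercohomology construction is a Mislin completion
      Mislin.IsMislinCompletion (Mislin.extStructure R) Δhat ν ∧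
      ∀ (n : ℤ) (B : C),
        (ν n).app B = Mislin.resLeg (Mislin.extStructure R) P n 0 n (add_zero n) B ≫
          (ζR n).app B ≫ (ϑ n).app B ∧
        (ν n).app B = (ζ n).app B ≫ AddCommGrpCat.ofHom
          (Mislin.chainToAlmost R.cochainComplex (P B).cochainComplex n) := by
  have hζ := Mislin.isCohIso_extIsoChain R P
  have hω := Mislin.isCohIso_satToRes (P := P) (Mislin.extStructure R)
  have hζR := Mislin.isCohIso_resZeta R P
  have hϑ := Mislin.isCohIso_theta R P
  refine ⟨Mislin.isVogelCohomology R P, Mislin.chainStructure R P, Mislin.vogelStructure R P,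
    Mislin.satStructure P (Mislin.extStructure R), Mislin.resStructure (Mislin.extStructure R) P,
    Mislin.resStructure (Mislin.chainStructure R P) P, fun n => (Mislin.extIsoChain R P n).hom,
    Mislin.satToRes P (Mislin.extStructure R), Mislin.resZeta R P, Mislin.theta R P,
    fun n => Mislin.resUnit (Mislin.extStructure R) P n ≫ (Mislin.resIsoVogel R P n).hom,
    ⟨Mislin.isChainConnecting_chainStructure, Mislin.isVogelConnecting_vogelStructure,
      Mislin.isSatConnecting_satStructure _, Mislin.isResConnecting_resStructure _ P,
      Mislin.isResConnecting_resStructure _ P⟩,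
    ⟨Mislin.isZeta_extIsoChain, Mislin.isSatComparison_satToRes _, Mislin.isResZeta_resZeta R P,
      Mislin.isTheta_theta R P⟩,
    ⟨hζ, hω, hζR, hϑ, hζR.comp hϑ, hω.comp (hζR.comp hϑ)⟩,
    (Mislin.isMislinCompletion_res _ P).comp_iso (Mislin.isCohIso_resIsoVogel R P),
    fun n B => ⟨?_, Mislin.resUnit_resIsoVogel R P n B⟩⟩
  rw [NatTrans.comp_app, ← Mislin.resZeta_theta, NatTrans.comp_app]
  rfl
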